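/- Let $\mathbb K$ be a field of characteristic $0$. For $N\ge 0$ let $FA_N$ be the free associative $\mathbb K$-algebra on $x_1,\dots,x_N$, graded by $\bigoplus_i \mathbb N\delta_i$ with $\deg x_i=\delta_i$. For $n\ge 0$ set $$(U(\mathfrak g)^{\otimes n})_{\rm univ}=\bigoplus_{N\ge 0}\Big(\big(FA_N^{\otimes n}\big)_{\delta_1+\dots+\delta_N}\otimes \big(FA_N^{\otimes n}\big)_{\delta_1+\dots+\delta_N}\Big)_{\mathfrak S_N}$$ (coinvariants for the simultaneous permutation of the generators in both tensor factors). The class of $(u_1\otimes\dots\otimes u_n)\otimes(v_1\otimes\dots\otimes v_n)$, with all $u_\alpha,v_\alpha$ monomials, is thought of as the normally ordered expression $\sum u_1(a)v_1(b)\otimes\dots\otimes u_n(a)v_n(b)$, where each letter $x_i$ of the $u_\alpha$ is replaced by $a_i$, each letter $x_i$ of the $v_\alpha$ by $b_i$, and $r=\sum_i a_i\otimes b_i$ is a "universal" solution of the classical Yang-Baxter equation $[r^{1,2},r^{1,3}]+[r^{1,2},r^{2,3}]+[r^{1,3},r^{2,3}]=0$. The product is the one obtained by multiplying two such expressions factor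 by factor (with disjoint sets of summation indices) and restoring the normal order by repeated use of $$\sum a_i\otimes [b_i,a_j]\otimes b_j=-\sum [a_i,a_j]\otimes b_i\otimes b_j-\sum a_i\otimes a_j\otimes [b_i,b_j].$$ With this product $(U(\mathfrak g)^{\otimes n})_{\rm univ}$ is an algebra, graded by $N$; let $(U(\mathfrak g)^{\widehat\otimes n})_{\rm univ}$ be its completion with respect to this grading. For $1\le i\ne j\le 3$ let $x\mapsto x^{i,j}$, $(U(\mathfrak g)^{\widehat\otimes 2})_{\rm univ}\to (U(\mathfrak g)^{\widehat\otimes 3})_{\rm univ}$, be the map placing the first tensor factor in position $i$, the second one in position $j$, and $1$ in the remaining position. Let $r\in (U(\mathfrak g)^{\widehat\otimes 2})_{\rm univ}$ be the degree $1$ element given by the class of $(x_1\otimes 1)\otimes(1\otimes x_1)$, that is, by the expression $\sum a\otimes b$. The degree $N$ component of $(U(\mathfrak g)^{\otimes 2})_{\rm univ}$ is the direct sum of the subspaces spanned by the classes of the $(u_1\otimes u_2)\otimes(v_1\otimes v_2)$, with all $u_\alpha,v_\alpha$ monomials, having prescribed degrees of $u_1,u_2,v_1,v_2$. Let $(U(\mathfrak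 g)\widehat\otimes U(\mathfrak a)U(\mathfrak b)_0)_{\rm univ}$ be the completed sum, over all $N$, of those subspaces for which $\deg v_2\ne 0$ (a letter $b$ occurs in the second factor), and let $(U(\mathfrak a)_0U(\mathfrak b)\widehat\otimes U(\mathfrak g))_{\rm univ}$ be the completed sum of those for which $\deg u_1\neq 0$ (a letter $a$ occurs in the first factor). **Theorem.** Let $\mathcal R\in (U(\mathfrak g)^{\widehat\otimes 2})_{\rm univ}$ be a solution of the quantum Yang-Baxter equation $$\mathcal R^{1,2}\mathcal R^{1,3}\mathcal R^{2,3}=\mathcal R^{2,3}\mathcal R^{1,3}\mathcal R^{1,2}$$ in $(U(\mathfrak g)^{\widehat\otimes 3})_{\rm univ}$, with homogeneous components $\mathcal R_N$, $N\geq 0$, such that $\mathcal R_0=1$ and $\mathcal R_1=r$. Then for every $N\ge 1$ we have $$\mathcal R_N\in (U(\mathfrak g)\widehat\otimes U(\mathfrak a)U(\mathfrak b)_0)_{\rm univ}\quad\text{and}\quad \mathcal R_N\in (U(\mathfrak a)_0U(\mathfrak b)\widehat\otimes U(\mathfrak g))_{\rm univ}.$$ -/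

import Mathlib

namespace UnivAlg

/-! ### Multilinear words -/

/-- An `n`-tuple of words in the letters `x_l`, `l : Λ`, i.e. a monomial
`w 0 ⊗ ... ⊗ w (n-1)` of the `n`-th tensor power of the free associative algebra on `Λ`. -/
abbrev Words (n : ℕ) (Λ : Type) : Type := Fin n → List Λ

/-- The number of occurrences of the letter `l` in a tuple of words. -/
def cnt {n : ℕ} {Λ : Type} [DecidableEq Λ] (w : Words n Λ) (l : Λ) : ℕ :=
  ∑ α, (w α).count l

/-- Renaming of the letters. -/
def rename {n : ℕ} {Λ Λ' : Type} (f : Λ → Λ') (w : Words n Λ) : Words n Λ' :=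
  fun α => (w α).map f

/-- `Diag n N` is the monomial basis of
`((FA_N)^{⊗ n})_{δ_1 + ... + δ_N} ⊗ ((FA_N)^{⊗ n})_{δ_1 + ... + δ_N}`:
pairs `(A, B)` of `n`-tuples of words in `N` letters, in each of which every letter occurs exactly
once.  Such a pair stands for the normally ordered expression whose tensor factor number `α` is the
product of the `a_l`, `l` running through the word `A α`, followed by the product of the `b_l`,
`l` running through `B α`, where `r = ∑ a ⊗ b` and the letters are summation indices. -/
def Diag (n N : ℕ) : Type :=
  {d : Words n (Fin N) × Words n (Fin N) // (∀ l, cnt d.1 l = 1) ∧ (∀ l, cnt d.2 l = 1)}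

theorem cnt_rename {n : ℕ} {Λ Λ' : Type} [DecidableEq Λ] [DecidableEq Λ'] (f : Λ → Λ')
    (hf : Function.Injective f) (w : Words n Λ) (l : Λ) : cnt (rename f w) (f l) = cnt w l := by
  simp [cnt, rename, List.count_map_of_injective _ _ hf]

theorem cnt_perm {n N : ℕ} (σ : Equiv.Perm (Fin N)) (w : Words n (Fin N))
    (hw : ∀ l, cnt w l = 1) (l : Fin N) : cnt (rename σ w) l = 1 := by
  obtain ⟨l, rfl⟩ := σ.surjective l
  rw [cnt_rename σ σ.injective, hw]

/-- The symmetric group acts on diagrams by simultaneous renaming of both sets of letters. -/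
instance (n N : ℕ) : MulAction (Equiv.Perm (Fin N)) (Diag n N) where
  smul σ d := ⟨(rename σ d.1.1, rename σ d.1.2),
    cnt_perm σ _ d.2.1, cnt_perm σ _ d.2.2⟩
  one_smul d := by
    apply Subtype.ext
    change (rename _ d.1.1, rename _ d.1.2) = d.1
    ext <;> simp [rename]
  mul_smul σ τ d := by
    apply Subtype.ext
    change (rename _ d.1.1, rename _ d.1.2) =
      (rename σ (rename τ d.1.1), rename σ (rename τ d.1.2))
    ext <;> simp [rename]

theorem smul_val {n N : ℕ} (σ : Equiv.Perm (Fin N)) (d : Diag n N) :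
    (σ • d).1 = (rename σ d.1.1, rename σ d.1.2) := rfl

/-! ### The graded components of the universal algebras -/

/-- The action of the symmetric group on
`((FA_N)^{⊗ n})_{δ_1 + ... + δ_N} ⊗ ((FA_N)^{⊗ n})_{δ_1 + ... + δ_N}`. -/
noncomputable def relabelRep (K : Type*) [Field K] (n N : ℕ) :
    Representation K (Equiv.Perm (Fin N)) (Diag n N →₀ K) where
  toFun σ := Finsupp.lmapDomain K K (fun d => σ • d)
  map_one' := by ext; simp
  map_mul' σ τ := by ext; simp [mul_smul]

theorem relabelRep_single (K : Type*) [Field K] {n N : ℕ} (σ : Equiv.Perm (Fin N))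
    (d : Diag n N) (c : K) :
    relabelRep K n N σ (Finsupp.single d c) = Finsupp.single (σ • d) c :=
  Finsupp.mapDomain_single

/-- The degree `N` component of `(U(g)^{⊗ n})_univ`: the space of coinvariants
`(((FA_N)^{⊗ n})_{δ_1 + ... + δ_N} ⊗ ((FA_N)^{⊗ n})_{δ_1 + ... + δ_N})_{S_N}`. -/
abbrev Univ (K : Type*) [Field K] (n N : ℕ) : Type _ := (relabelRep K n N).Coinvariants

/-- The class of a diagram in the space of coinvariants. -/
noncomputable def Diag.toUniv (K : Type*) [Field K] {n N : ℕ} (d : Diag n N) : Univ K n N :=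
  Representation.Coinvariants.mk (relabelRep K n N) (Finsupp.single d 1)

/-! ### Normal ordering

Write `r = ∑ a ⊗ b`.  The classical Yang-Baxter equation
`[r^{12}, r^{13}] + [r^{12}, r^{23}] + [r^{13}, r^{23}] = 0` reads
`∑ a_i ⊗ [b_i, a_j] ⊗ b_j = - ∑ [a_i, a_j] ⊗ b_i ⊗ b_j - ∑ a_i ⊗ a_j ⊗ [b_i, b_j]`.
Hence in any expression that also contains `a_i` and `b_j`, each once, the subword `b_i a_j`
may be replaced by the sum of
* `a_j b_i`;
* minus the expression in which `b_i a_j` is replaced by `b_i` and `a_i` by `a_i a_j - a_j a_i`;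
* minus the expression in which `b_i a_j` is replaced by `a_j` and `b_j` by `b_i b_j - b_j b_i`. -/

/-- Replace `x_i` by `x_i x_j`. -/
def insAfter {n : ℕ} {Λ : Type} [DecidableEq Λ] (i j : Λ) (w : Words n Λ) : Words n Λ :=
  fun α => (w α).flatMap fun l => if l = i then [i, j] else [l]

/-- Replace `x_i` by `x_j x_i`. -/
def insBefore {n : ℕ} {Λ : Type} [DecidableEq Λ] (i j : Λ) (w : Words n Λ) : Words n Λ :=
  fun α => (w α).flatMap fun l => if l = i then [j, i] else [l]

/-- A state `(X, A, B)` of the ordering process for a product `x * y`.  Its tensor factor `α`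
consists of the `a`-letters `X α`, then the `b`-letters of `x` that have not been moved yet, then
the `a`-letters `A α`, then the `b`-letters `B α`. -/
abbrev State (n : ℕ) (Λ : Type) : Type := Words n Λ × Words n Λ × Words n Λ

/-- Move the letter `b_i`, which stands in factor `α` between the words `pre` and `rest` of
`a`-letters, to the right through `rest`, by repeated use of the rule above.  The value of `A` at
`α` is ignored, the `a`-letters in question being `pre ++ rest`. -/
noncomputable def pushB (K : Type*) [Field K] {n : ℕ} {Λ : Type} [DecidableEq Λ] (α : Fin n)
    (i : Λ) (A B : Words n Λ) : (X : Words n Λ) → (pre rest : List Λ) → State n Λ →₀ K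
  | X, pre, [] =>
      Finsupp.single (X, Function.update A α pre, Function.update B α (i :: B α)) 1
  | X, pre, j :: rest =>
      pushB K α i A B X (pre ++ [j]) rest
      - (pushB K α i A B (insAfter i j X) pre rest
        - pushB K α i A B (insBefore i j X) pre rest)
      - (Finsupp.single (X, Function.update A α (pre ++ j :: rest), insBefore j i B) 1
        - Finsupp.single (X, Function.update A α (pre ++ j :: rest), insAfter j i B) 1)

/-- Move the last remaining letter `b_i` of factor `α` through the word `A α`. -/
noncomputable def moveB (K : Type*) [Field K] {n : ℕ} {Λ : Type} [DecidableEq Λ] (α : Fin n)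
    (i : Λ) : (State n Λ →₀ K) →ₗ[K] (State n Λ →₀ K) :=
  Finsupp.linearCombination K fun s => pushB K α i s.2.1 s.2.2 s.1 [] (s.2.1 α)

/-- The letters of a tuple of words, together with the factors in which they stand. -/
def letters {n : ℕ} {Λ : Type} (B : Words n Λ) : List (Fin n × Λ) :=
  (List.finRange n).flatMap fun α => (B α).map fun l => (α, l)

/-- The normal ordering of the product of the normally ordered expressions `x = (x.1, x.2)` and
`y = (y.1, y.2)` with disjoint sets of letters, which in factor `α` is the concatenation of the
`a`-letters `x.1 α`, the `b`-letters `x.2 α`, the `a`-letters `y.1 α` and the `b`-letters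
`y.2 α`. -/
noncomputable def normalOrder (K : Type*) [Field K] {n : ℕ} {Λ : Type} [DecidableEq Λ]
    (x y : Words n Λ × Words n Λ) : (Words n Λ × Words n Λ) →₀ K :=
  Finsupp.mapDomain (fun s : State n Λ => (fun α => s.1 α ++ s.2.1 α, s.2.2))
    ((letters x.2).foldr (fun p => moveB K p.1 p.2) (Finsupp.single (x.1, y.1, y.2) 1))

/-! ### Compatibility of the normal ordering with renaming -/

theorem rename_insAfter {n : ℕ} {Λ Λ' : Type} [DecidableEq Λ] [DecidableEq Λ'] {f : Λ → Λ'}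
    (hf : Function.Injective f) (i j : Λ) (w : Words n Λ) :
    insAfter (f i) (f j) (rename f w) = rename f (insAfter i j w) := by
  funext α
  simp only [insAfter, rename, List.flatMap_map, List.map_flatMap]
  congr 1
  funext l
  by_cases h : l = i <;> simp [h, hf.eq_iff]

theorem rename_insBefore {n : ℕ} {Λ Λ' : Type} [DecidableEq Λ] [DecidableEq Λ'] {f : Λ → Λ'}
    (hf : Function.Injective f) (i j : Λ) (w : Words n Λ) :
    insBefore (f i) (f j) (rename f w) = rename f (insBefore i j w) := by
  funext α
  simp only [insBefore, rename, List.flatMap_map, List.map_flatMap]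
  congr 1
  funext l
  by_cases h : l = i <;> simp [h, hf.eq_iff]

theorem rename_update {n : ℕ} {Λ Λ' : Type} (f : Λ → Λ') (w : Words n Λ) (α : Fin n)
    (v : List Λ) :
    rename f (Function.update w α v) = Function.update (rename f w) α (v.map f) := by
  funext β
  by_cases h : β = α
  · subst h; simp [rename]
  · simp [rename, h]

/-- Renaming of the letters of a state. -/
def renameState {n : ℕ} {Λ Λ' : Type} (f : Λ → Λ') (s : State n Λ) : State n Λ' :=
  (rename f s.1, rename f s.2.1, rename f s.2.2)

theorem pushB_rename (K : Type*) [Field K] {n : ℕ} {Λ Λ' : Type} [DecidableEq Λ]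
    [DecidableEq Λ'] {f : Λ → Λ'} (hf : Function.Injective f) (α : Fin n) (i : Λ)
    (A B : Words n Λ) (X : Words n Λ) (pre rest : List Λ) :
    pushB K α (f i) (rename f A) (rename f B) (rename f X) (pre.map f) (rest.map f) =
      Finsupp.mapDomain (renameState f) (pushB K α i A B X pre rest) := by
  induction rest generalizing X pre with
  | nil =>
    simp only [List.map_nil, pushB, Finsupp.mapDomain_single, renameState, rename_update]
    rfl
  | cons j rest ih =>
    have h1 := ih X (pre ++ [j])
    have h2 := ih (insAfter i j X) pre
    have h3 := ih (insBefore i j X) pre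
    simp only [List.map_append, List.map_cons, List.map_nil] at h1
    have hs : ∀ u v : State n Λ →₀ K, Finsupp.mapDomain (renameState f) (u - v) =
        Finsupp.mapDomain (renameState f) u - Finsupp.mapDomain (renameState f) v :=
      fun u v => map_sub (Finsupp.lmapDomain K K (renameState f)) u v
    simp only [List.map_cons, pushB, hs, h1, h2, h3, Finsupp.mapDomain_single, renameState,
      rename_update, rename_insAfter hf, rename_insBefore hf, List.map_append]

theorem moveB_rename (K : Type*) [Field K] {n : ℕ} {Λ Λ' : Type} [DecidableEq Λ]
    [DecidableEq Λ'] {f : Λ → Λ'} (hf : Function.Injective f) (α : Fin n) (i : Λ)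
    (u : State n Λ →₀ K) :
    moveB K α (f i) (Finsupp.mapDomain (renameState f) u) =
      Finsupp.mapDomain (renameState f) (moveB K α i u) := by
  have h : moveB K α (f i) ∘ₗ Finsupp.lmapDomain K K (renameState f) =
      Finsupp.lmapDomain K K (renameState f) ∘ₗ moveB K α i := by
    ext1 s
    ext1
    simpa [moveB, renameState, rename] using
      pushB_rename K hf α i s.2.1 s.2.2 s.1 [] (s.2.1 α)
  exact LinearMap.congr_fun h u

theorem letters_rename {n : ℕ} {Λ Λ' : Type} (f : Λ → Λ') (B : Words n Λ) :
    letters (rename f B) = (letters B).map fun p => (p.1, f p.2) := by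
  simp [letters, rename, List.map_flatMap, Function.comp_def]

theorem normalOrder_rename (K : Type*) [Field K] {n : ℕ} {Λ Λ' : Type} [DecidableEq Λ]
    [DecidableEq Λ'] {f : Λ → Λ'} (hf : Function.Injective f)
    (x y : Words n Λ × Words n Λ) :
    normalOrder K (rename f x.1, rename f x.2) (rename f y.1, rename f y.2) =
      Finsupp.mapDomain (fun d => (rename f d.1, rename f d.2)) (normalOrder K x y) := by
  have h : ∀ (L : List (Fin n × Λ)) (u : State n Λ →₀ K),
      (L.map fun p => (p.1, f p.2)).foldr (fun p => moveB K p.1 p.2)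
        (Finsupp.mapDomain (renameState f) u) =
      Finsupp.mapDomain (renameState f) (L.foldr (fun p => moveB K p.1 p.2) u) := by
    intro L u
    induction L with
    | nil => rfl
    | cons p L ih => simp only [List.map_cons, List.foldr_cons, ih, moveB_rename K hf]
  have h0 := h (letters x.2) (Finsupp.single (x.1, y.1, y.2) 1)
  rw [Finsupp.mapDomain_single] at h0
  simp only [normalOrder, letters_rename]
  rw [← Finsupp.mapDomain_comp]
  change Finsupp.mapDomain _ (List.foldr _ (Finsupp.single (renameState f (x.1, y.1, y.2)) 1) _) = _
  rw [h0, ← Finsupp.mapDomain_comp]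
  congr 1
  funext s
  simp only [Function.comp_apply, renameState, Prod.mk.injEq, and_true]
  funext α
  simp [rename]

/-! ### All terms of the normal ordering are multilinear -/

theorem cnt_update {n : ℕ} {Λ : Type} [DecidableEq Λ] (w : Words n Λ) (α : Fin n)
    (v : List Λ) (l : Λ) :
    cnt (Function.update w α v) l =
      v.count l + ∑ β ∈ Finset.univ \ {α}, (w β).count l := by
  have : (fun β => (Function.update w α v β).count l) =
      Function.update (fun β => (w β).count l) α (v.count l) := by
    funext β
    by_cases h : β = α
    · subst h; simp
    · simp [h]
  unfold cnt
  rw [this, Finset.sum_update_of_mem (Finset.mem_univ α)]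

theorem cnt_insAfter {n : ℕ} {Λ : Type} [DecidableEq Λ] (i j : Λ) (w : Words n Λ) (l : Λ) :
    cnt (insAfter i j w) l = cnt w l + if l = j then cnt w i else 0 := by
  have h : ∀ v : List Λ, (v.flatMap fun l => if l = i then [i, j] else [l]).count l =
      v.count l + if l = j then v.count i else 0 := by
    intro v
    induction v with
    | nil => simp
    | cons a v ih =>
      rw [List.flatMap_cons, List.count_append, ih]
      split_ifs <;> simp only [List.count_cons, List.count_nil, beq_iff_eq] <;> grind
  simp only [cnt, insAfter, h, Finset.sum_add_distrib]
  split_ifs <;> simp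

theorem cnt_insBefore {n : ℕ} {Λ : Type} [DecidableEq Λ] (i j : Λ) (w : Words n Λ) (l : Λ) :
    cnt (insBefore i j w) l = cnt w l + if l = j then cnt w i else 0 := by
  rw [← cnt_insAfter]
  unfold cnt
  refine Finset.sum_congr rfl fun α _ => ?_
  refine List.Perm.count_eq ?_ l
  refine List.Perm.flatMap_left _ fun a _ => ?_
  split_ifs
  · exact List.Perm.swap _ _ _
  · exact List.Perm.refl _

/-- The invariant of the ordering process: `P` singles out the letters of the left factor, and
`rem` is the list of the `b`-letters that have not been moved yet. -/
def Inv {n : ℕ} {Λ : Type} [DecidableEq Λ] (P : Λ → Prop) (rem : List Λ) (s : State n Λ) :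
    Prop :=
  ∀ l, cnt s.1 l + cnt s.2.1 l = 1 ∧ (P l → cnt s.1 l = 1) ∧ (¬ P l → cnt s.2.2 l = 1) ∧
    cnt s.2.2 l + rem.count l = 1

theorem pushB_inv (K : Type*) [Field K] {n : ℕ} {Λ : Type} [DecidableEq Λ] (P : Λ → Prop)
    (rem : List Λ) (α : Fin n) (i : Λ) (hi : P i) (A B X : Words n Λ) (pre rest : List Λ)
    (h : Inv P (i :: rem) (X, Function.update A α (pre ++ rest), B)) :
    pushB K α i A B X pre rest ∈ Finsupp.supported K K {s | Inv P rem s} := by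
  induction rest generalizing X pre with
  | nil =>
    refine Finsupp.single_mem_supported K _ fun l => ?_
    have h1 := h l
    have h2 : cnt (Function.update B α (i :: B α)) l = cnt B l + if i = l then 1 else 0 := by
      have h3 := cnt_update B α (B α) l
      rw [Function.update_eq_self] at h3
      rw [cnt_update, h3, List.count_cons]
      simp only [beq_iff_eq]
      omega
    simp only [List.append_nil, List.count_cons, beq_iff_eq] at h1
    refine ⟨h1.1, h1.2.1, fun hl => ?_, ?_⟩
    · have := h1.2.2.1 hl
      have hne : i ≠ l := by rintro rfl; exact hl hi
      simp only [h2, hne, if_false]; omega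
    · simp only [h2]; omega
  | cons j rest ih =>
    have hX : cnt X i = 1 := (h i).2.1 hi
    have hA : ∀ l, cnt (Function.update A α (pre ++ j :: rest)) l =
        cnt (Function.update A α (pre ++ rest)) l + if j = l then 1 else 0 := by
      intro l
      simp only [cnt_update, List.count_append, List.count_cons, beq_iff_eq]
      omega
    have hj0 : cnt X j = 0 := by
      have h1 := (h j).1
      have h2 := hA j
      simp only [if_true] at h2
      simp only [h2] at h1
      omega
    have hPj : ¬ P j := fun hp => by have := (h j).2.1 hp; simp only [hj0] at this; omega
    have hBj : cnt B j = 1 := (h j).2.2.1 hPj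
    have hij : i ≠ j := by rintro rfl; exact hPj hi
    have key : ∀ X', (∀ l, cnt X' l = cnt X l + if l = j then cnt X i else 0) →
        Inv P (i :: rem) (X', Function.update A α (pre ++ rest), B) := by
      intro X' hX' l
      have h1 := h l
      simp only [hA] at h1
      refine ⟨?_, fun hl => ?_, h1.2.2.1, h1.2.2.2⟩
      · simp only [hX', hX, eq_comm (a := l)]; omega
      · have hne : l ≠ j := by rintro rfl; exact hPj hl
        have := h1.2.1 hl
        simp only [hX', hne, if_false]; omega
    have key2 : ∀ B', (∀ l, cnt B' l = cnt B l + if l = i then cnt B j else 0) →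
        Inv P rem (X, Function.update A α (pre ++ j :: rest), B') := by
      intro B' hB' l
      have h1 := h l
      simp only [List.count_cons, beq_iff_eq] at h1
      refine ⟨h1.1, h1.2.1, fun hl => ?_, ?_⟩
      · have hne : l ≠ i := by rintro rfl; exact hl hi
        have := h1.2.2.1 hl
        simp only [hB', hne, if_false]; omega
      · simp only [hB', hBj, eq_comm (a := l)]; omega
    simp only [pushB]
    refine Submodule.sub_mem _ (Submodule.sub_mem _ (ih _ _ (by simpa using h))
      (Submodule.sub_mem _ (ih _ _ (key _ (cnt_insAfter i j X)))
        (ih _ _ (key _ (cnt_insBefore i j X))))) (Submodule.sub_mem _ ?_ ?_)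
    · exact Finsupp.single_mem_supported K _ (key2 _ (cnt_insBefore j i B))
    · exact Finsupp.single_mem_supported K _ (key2 _ (cnt_insAfter j i B))

theorem moveB_inv (K : Type*) [Field K] {n : ℕ} {Λ : Type} [DecidableEq Λ] (P : Λ → Prop)
    (rem : List Λ) (α : Fin n) (i : Λ) (hi : P i) (u : State n Λ →₀ K)
    (hu : u ∈ Finsupp.supported K K {s | Inv P (i :: rem) s}) :
    moveB K α i u ∈ Finsupp.supported K K {s | Inv P rem s} := by
  rw [moveB, Finsupp.linearCombination_apply]
  refine Submodule.sum_mem _ fun s hs => Submodule.smul_mem _ _ ?_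
  refine pushB_inv K P rem α i hi _ _ _ _ _ ?_
  have := hu hs
  simpa using this

theorem count_letters {n : ℕ} {Λ : Type} [DecidableEq Λ] (B : Words n Λ) (l : Λ) :
    ((letters B).map Prod.snd).count l = cnt B l := by
  simp [letters, cnt, List.map_flatMap, List.count_flatMap, Function.comp_def,
    Fin.sum_univ_def]

/-- If together `x` and `y` contain each letter exactly once among the `a`-letters and exactly once
among the `b`-letters, and the letters of `x` are the same in both cases, then all terms of
the normal ordering of `x * y` contain each letter exactly once among the `a`-letters and exactly
once among the `b`-letters. -/
theorem normalOrder_multilinear (K : Type*) [Field K] {n : ℕ} {Λ : Type} [DecidableEq Λ]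
    (x y : Words n Λ × Words n Λ) (hA : ∀ l, cnt x.1 l + cnt y.1 l = 1)
    (hB : ∀ l, cnt x.2 l + cnt y.2 l = 1) (hx : ∀ l, cnt x.1 l = cnt x.2 l)
    (d : Words n Λ × Words n Λ) (hd : d ∈ (normalOrder K x y).support) :
    (∀ l, cnt d.1 l = 1) ∧ (∀ l, cnt d.2 l = 1) := by
  classical
  have h : ∀ (L : List (Fin n × Λ)) (rem : List Λ), (∀ p ∈ L, cnt x.1 p.2 = 1) →
      Inv (fun l => cnt x.1 l = 1) (L.map Prod.snd ++ rem) (x.1, y.1, y.2) →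
      L.foldr (fun p => moveB K p.1 p.2) (Finsupp.single (x.1, y.1, y.2) 1) ∈
        Finsupp.supported K K {s : State n Λ | Inv (fun l => cnt x.1 l = 1) rem s} := by
    intro L
    induction L with
    | nil => exact fun rem _ hs => Finsupp.single_mem_supported K _ (by simpa using hs)
    | cons p L ih =>
      intro rem hL hs
      rw [List.foldr_cons]
      refine moveB_inv K (fun l => cnt x.1 l = 1) rem p.1 p.2 (hL p (by simp)) _
        (ih (p.2 :: rem) (fun q hq => hL q (by simp [hq])) fun l => ?_)
      have h1 := hs l
      simp only [List.map_cons, List.count_append, List.count_cons, List.cons_append] at h1 ⊢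
      refine ⟨h1.1, h1.2.1, h1.2.2.1, ?_⟩
      omega
  have h1 := h (letters x.2) [] (fun p hp => ?_) (fun l => ?_)
  · have h2 := Finsupp.mapDomain_support hd
    obtain ⟨s, hs, rfl⟩ := Finset.mem_image.1 h2
    have h3 := h1 hs
    refine ⟨fun l => ?_, fun l => ?_⟩
    · have h4 := (h3 l).1
      simpa [cnt, List.count_append, Finset.sum_add_distrib] using h4
    · have h4 := (h3 l).2.2.2
      simpa using h4
  · have h2 : 0 < ((letters x.2).map Prod.snd).count p.2 :=
      List.count_pos_iff.2 (List.mem_map_of_mem hp)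
    rw [count_letters] at h2
    have := hA p.2
    have := hx p.2
    omega
  · refine ⟨hA l, fun h => h, fun h => ?_, ?_⟩
    · have := hA l
      have := hx l
      have := hB l
      simp only at h ⊢
      omega
    · rw [List.append_nil, count_letters]
      have := hB l
      simp only
      omega

/-! ### The product -/

/-- The inclusion of the letters of the first factor of a product. -/
def inL {p q N : ℕ} (h : p + q = N) (i : Fin p) : Fin N := Fin.cast h (Fin.castAdd q i)

/-- The inclusion of the letters of the second factor of a product. -/
def inR {p q N : ℕ} (h : p + q = N) (i : Fin q) : Fin N := Fin.cast h (Fin.natAdd p i)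

/-- The product of two diagrams before passing to coinvariants.  All terms of the normal
ordering are multilinear, so that nothing is lost by restricting to `Diag n N`
(see `mapDomain_mulDiag`). -/
noncomputable def mulDiag (K : Type*) [Field K] {n p q N : ℕ} (h : p + q = N) (x : Diag n p)
    (y : Diag n q) : Diag n N →₀ K :=
  Finsupp.subtypeDomain _ (normalOrder K (rename (inL h) x.1.1, rename (inL h) x.1.2)
    (rename (inR h) y.1.1, rename (inR h) y.1.2))

theorem cnt_rename_eq_zero {n : ℕ} {Λ Λ' : Type} [DecidableEq Λ'] (f : Λ → Λ')
    (w : Words n Λ) (l : Λ') (hl : ∀ i, f i ≠ l) : cnt (rename f w) l = 0 :=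
  Finset.sum_eq_zero fun α _ => List.count_eq_zero.2 fun h => by
    obtain ⟨i, _, hi⟩ := List.mem_map.1 h
    exact hl i hi

theorem cnt_inL_inR {n p q N : ℕ} (h : p + q = N) (u : Words n (Fin p)) (v : Words n (Fin q))
    (hu : ∀ l, cnt u l = 1) (hv : ∀ l, cnt v l = 1) (l : Fin N) :
    cnt (rename (inL h) u) l = (if l.1 < p then 1 else 0) ∧
      cnt (rename (inR h) v) l = (if l.1 < p then 0 else 1) := by
  subst h
  have hL : Function.Injective (inL (p := p) (q := q) rfl) := fun a b hab => by
    simpa [inL] using hab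
  have hR : Function.Injective (inR (p := p) (q := q) rfl) := fun a b hab => by
    simpa [inR] using hab
  refine Fin.addCases (fun i => ?_) (fun i => ?_) l
  · have h1 := cnt_rename _ hL u i
    have h2 := cnt_rename_eq_zero (inR (p := p) (q := q) rfl) v (Fin.castAdd q i) fun j hj => by
      have := congrArg Fin.val hj
      simp only [inR, Fin.val_cast, Fin.val_natAdd, Fin.val_castAdd] at this
      omega
    rw [hu] at h1
    exact ⟨by simpa [inL] using h1, by simpa using h2⟩
  · have h1 := cnt_rename _ hR v i
    have h2 := cnt_rename_eq_zero (inL (p := p) (q := q) rfl) u (Fin.natAdd p i) fun j hj => by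
      have := congrArg Fin.val hj
      simp only [inL, Fin.val_cast, Fin.val_natAdd, Fin.val_castAdd] at this
      omega
    rw [hv] at h1
    exact ⟨by simpa using h2, by simpa [inR] using h1⟩

theorem mapDomain_mulDiag (K : Type*) [Field K] {n p q N : ℕ} (h : p + q = N) (x : Diag n p)
    (y : Diag n q) : Finsupp.mapDomain (fun d : Diag n N => d.1) (mulDiag K h x y) =
      normalOrder K (rename (inL h) x.1.1, rename (inL h) x.1.2)
        (rename (inR h) y.1.1, rename (inR h) y.1.2) := by
  have hs := normalOrder_multilinear K (rename (inL h) x.1.1, rename (inL h) x.1.2)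
    (rename (inR h) y.1.1, rename (inR h) y.1.2)
    (fun l => by
      have := cnt_inL_inR h _ _ x.2.1 y.2.1 l
      simp only [this]; split_ifs <;> rfl)
    (fun l => by
      have := cnt_inL_inR h _ _ x.2.2 y.2.2 l
      simp only [this]; split_ifs <;> rfl)
    (fun l => by
      have h1 := cnt_inL_inR h _ _ x.2.1 y.2.1 l
      have h2 := cnt_inL_inR h _ _ x.2.2 y.2.2 l
      simp only [h1, h2])
  ext d
  by_cases hd : (∀ l, cnt d.1 l = 1) ∧ (∀ l, cnt d.2 l = 1)
  · exact Finsupp.mapDomain_apply Subtype.val_injective _ (⟨d, hd⟩ : Diag n N)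
  · have h0 := Finsupp.mapDomain_of_notMem_range (f := fun d : Diag n N => d.1)
      (mulDiag K h x y) d fun ⟨e, (he : e.1 = d)⟩ => hd (by rw [← he]; exact e.2)
    rw [h0]
    by_contra hne
    exact hd (hs d (Finsupp.mem_support_iff.2 (Ne.symm hne)))

/-- The permutation of the letters of a product given by permutations of the letters of the two
factors. -/
def sumPerm {p q N : ℕ} (h : p + q = N) (σ : Equiv.Perm (Fin p)) (τ : Equiv.Perm (Fin q)) :
    Equiv.Perm (Fin N) :=
  (finSumFinEquiv.trans (finCongr h)).permCongr (Equiv.sumCongr σ τ)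

theorem sumPerm_inL {p q N : ℕ} (h : p + q = N) (σ : Equiv.Perm (Fin p))
    (τ : Equiv.Perm (Fin q)) (i : Fin p) : sumPerm h σ τ (inL h i) = inL h (σ i) := by
  subst h
  simp [sumPerm, inL, Equiv.permCongr_apply]

theorem sumPerm_inR {p q N : ℕ} (h : p + q = N) (σ : Equiv.Perm (Fin p))
    (τ : Equiv.Perm (Fin q)) (i : Fin q) : sumPerm h σ τ (inR h i) = inR h (τ i) := by
  subst h
  simp [sumPerm, inR, Equiv.permCongr_apply]

theorem mulDiag_smul (K : Type*) [Field K] {n p q N : ℕ} (h : p + q = N)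
    (σ : Equiv.Perm (Fin p)) (τ : Equiv.Perm (Fin q)) (x : Diag n p) (y : Diag n q) :
    mulDiag K h (σ • x) (τ • y) = relabelRep K n N (sumPerm h σ τ) (mulDiag K h x y) := by
  have hL : ∀ w : Words n (Fin p),
      rename (inL h) (rename σ w) = rename (sumPerm h σ τ) (rename (inL h) w) := by
    intro w
    funext α
    simp [rename, Function.comp_def, sumPerm_inL]
  have hR : ∀ w : Words n (Fin q),
      rename (inR h) (rename τ w) = rename (sumPerm h σ τ) (rename (inR h) w) := by
    intro w
    funext α
    simp [rename, Function.comp_def, sumPerm_inR]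
  ext d
  obtain ⟨d, rfl⟩ := MulAction.surjective (sumPerm h σ τ) d
  change _ = Finsupp.mapDomain (fun d => sumPerm h σ τ • d) (mulDiag K h x y)
    (sumPerm h σ τ • d)
  rw [Finsupp.mapDomain_apply (MulAction.injective (sumPerm h σ τ))]
  have hinj : Function.Injective fun d : Words n (Fin N) × Words n (Fin N) =>
      (rename (sumPerm h σ τ) d.1, rename (sumPerm h σ τ) d.2) := by
    have h1 : Function.Injective (rename (n := n) (sumPerm h σ τ)) := fun u v huv =>
      funext fun α => (List.map_injective_iff.2 (sumPerm h σ τ).injective) (congrFun huv α)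
    exact h1.prodMap h1
  have hn := normalOrder_rename K (sumPerm h σ τ).injective
    (rename (inL h) x.1.1, rename (inL h) x.1.2) (rename (inR h) y.1.1, rename (inR h) y.1.2)
  simp only [mulDiag, smul_val, hL, hR]
  simp only at hn
  rw [hn]
  exact Finsupp.mapDomain_apply hinj _ d.1

/-- The product on the space before passing to coinvariants. -/
noncomputable def mulFree (K : Type*) [Field K] {n p q N : ℕ} (h : p + q = N) :
    (Diag n p →₀ K) →ₗ[K] (Diag n q →₀ K) →ₗ[K] Univ K n N :=
  Finsupp.linearCombination K fun x => Finsupp.linearCombination K fun y =>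
    Representation.Coinvariants.mk (relabelRep K n N) (mulDiag K h x y)

theorem mulFree_smul (K : Type*) [Field K] {n p q N : ℕ} (h : p + q = N)
    (σ : Equiv.Perm (Fin p)) (τ : Equiv.Perm (Fin q)) (u : Diag n p →₀ K) (v : Diag n q →₀ K) :
    mulFree K h (relabelRep K n p σ u) (relabelRep K n q τ v) = mulFree K h u v := by
  have : (mulFree K h).compl₁₂ (relabelRep K n p σ) (relabelRep K n q τ) =
      mulFree (n := n) K h := by
    refine Finsupp.lhom_ext' fun x => LinearMap.ext_ring (Finsupp.lhom_ext' fun y =>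
      LinearMap.ext_ring ?_)
    change mulFree K h (relabelRep K n p σ (Finsupp.single x 1))
      (relabelRep K n q τ (Finsupp.single y 1)) =
      mulFree K h (Finsupp.single x 1) (Finsupp.single y 1)
    simp only [relabelRep_single, mulFree, Finsupp.linearCombination_single, one_smul,
      mulDiag_smul, Representation.Coinvariants.mk_self_apply]
  exact LinearMap.congr_fun (LinearMap.congr_fun this u) v

/-- The product `(U(g)^{⊗ n})_univ,p × (U(g)^{⊗ n})_univ,q → (U(g)^{⊗ n})_univ,p+q`. -/
noncomputable def gmul (K : Type*) [Field K] {n p q N : ℕ} (h : p + q = N) :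
    Univ K n p →ₗ[K] Univ K n q →ₗ[K] Univ K n N :=
  Representation.Coinvariants.lift _
    (LinearMap.flip (Representation.Coinvariants.lift _ (LinearMap.flip (mulFree K h))
      fun τ => by
        ext1 y; ext1; ext1 x
        ext1
        simpa using mulFree_smul K h 1 τ (Finsupp.single x 1) (Finsupp.single y 1)))
    fun σ => by
      ext1 x; ext1
      refine Representation.Coinvariants.hom_ext ?_
      ext1 y; ext1
      simpa using mulFree_smul K h σ 1 (Finsupp.single x 1) (Finsupp.single y 1)

/-! ### Insertion into tensor factors -/

/-- Put the word number `α` in position `f α`, and the empty word in the other positions. -/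
noncomputable def placeWords {n m : ℕ} {Λ : Type} (f : Fin n ↪ Fin m) (w : Words n Λ) :
    Words m Λ :=
  Function.extend f w fun _ => []

theorem cnt_placeWords {n m : ℕ} {Λ : Type} [DecidableEq Λ] (f : Fin n ↪ Fin m)
    (w : Words n Λ) (l : Λ) : cnt (placeWords f w) l = cnt w l := by
  refine (Fintype.sum_of_injective f f.injective _ _ (fun β hβ => ?_) fun α => ?_).symm
  · rw [placeWords, Function.extend_apply' _ _ _ (by simpa using hβ)]; rfl
  · rw [placeWords, f.injective.extend_apply]

theorem rename_placeWords {n m : ℕ} {Λ Λ' : Type} (f : Fin n ↪ Fin m) (g : Λ → Λ')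
    (w : Words n Λ) : rename g (placeWords f w) = placeWords f (rename g w) := by
  funext β
  by_cases h : ∃ α, f α = β
  · obtain ⟨α, rfl⟩ := h
    simp [rename, placeWords, f.injective.extend_apply]
  · simp [rename, placeWords, Function.extend_apply' _ _ _ h]

/-- Insertion on diagrams. -/
noncomputable def placeDiag {n m N : ℕ} (f : Fin n ↪ Fin m) (d : Diag n N) : Diag m N :=
  ⟨(placeWords f d.1.1, placeWords f d.1.2),
    fun l => by rw [cnt_placeWords, d.2.1], fun l => by rw [cnt_placeWords, d.2.2]⟩

/-- The linear map `(U(g)^{⊗ n})_univ → (U(g)^{⊗ m})_univ` which puts the tensor factor number `α`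
in position `f α` and `1` in the other positions, in degree `N`. -/
noncomputable def place (K : Type*) [Field K] {n m N : ℕ} (f : Fin n ↪ Fin m) :
    Univ K n N →ₗ[K] Univ K m N :=
  Representation.Coinvariants.lift _
    (Representation.Coinvariants.mk (relabelRep K m N) ∘ₗ Finsupp.lmapDomain K K (placeDiag f))
    fun σ => by
      have h : ∀ d, placeDiag f (σ • d) = σ • placeDiag f d := fun d => by
        apply Subtype.ext
        rw [smul_val]
        simp only [placeDiag, smul_val, rename_placeWords]
      refine Finsupp.lhom_ext' fun d => LinearMap.ext_ring ?_
      change Representation.Coinvariants.mk (relabelRep K m N)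
        (Finsupp.mapDomain (placeDiag f) (relabelRep K n N σ (Finsupp.single d 1))) =
        Representation.Coinvariants.mk (relabelRep K m N)
        (Finsupp.mapDomain (placeDiag f) (Finsupp.single d 1))
      rw [relabelRep_single, Finsupp.mapDomain_single, Finsupp.mapDomain_single, h,
        ← relabelRep_single, Representation.Coinvariants.mk_self_apply]

/-! ### The completed algebras -/

/-- The completion of `(U(g)^{⊗ n})_univ` with respect to the degree: the product of the graded
components. -/
def UnivHat (K : Type*) [Field K] (n : ℕ) : Type _ := (N : ℕ) → Univ K n N

noncomputable instance (K : Type*) [Field K] (n : ℕ) : AddCommGroup (UnivHat K n) :=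
  inferInstanceAs (AddCommGroup ((N : ℕ) → Univ K n N))

noncomputable instance (K : Type*) [Field K] (n : ℕ) : Module K (UnivHat K n) :=
  inferInstanceAs (Module K ((N : ℕ) → Univ K n N))

/-- The product `(x y)_N = ∑ x_p y_q`, `p + q = N`. -/
noncomputable instance (K : Type*) [Field K] (n : ℕ) : Mul (UnivHat K n) where
  mul x y := fun N => ∑ pq : {pq // pq ∈ Finset.HasAntidiagonal.antidiagonal N},
    gmul K (Finset.HasAntidiagonal.mem_antidiagonal.1 pq.2) (x pq.1.1) (y pq.1.2)

/-- The diagram without letters. -/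
def emptyDiag (n : ℕ) : Diag n 0 :=
  ⟨(fun _ => [], fun _ => []), fun l => l.elim0, fun l => l.elim0⟩

/-- The diagram `a ⊗ b`. -/
def rDiag : Diag 2 1 :=
  ⟨(![[0], []], ![[], [0]]), by decide, by decide⟩

/-- The homogeneous component `x_N`, as an element of the completed algebra. -/
noncomputable def homComp (K : Type*) [Field K] {n : ℕ} (N : ℕ) (x : UnivHat K n) :
    UnivHat K n :=
  Pi.single (M := fun N => Univ K n N) N (x N)

/-- The unit `1`, in degree `0`. -/
noncomputable instance (K : Type*) [Field K] (n : ℕ) : One (UnivHat K n) where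
  one := Pi.single (M := fun N => Univ K n N) 0 ((emptyDiag n).toUniv K)

/-- The element `r = a ⊗ b`, in degree `1`. -/
noncomputable def rMatrix (K : Type*) [Field K] : UnivHat K 2 :=
  Pi.single (M := fun N => Univ K 2 N) 1 (rDiag.toUniv K)

/-- `leg i j h x = x^{i,j}`: the image of `x` under the map which puts the first tensor factor in
position `i`, the second one in position `j`, and `1` in the other positions. -/
noncomputable def leg {K : Type*} [Field K] {m : ℕ} (i j : Fin m) (h : i ≠ j) (x : UnivHat K 2) :
    UnivHat K m :=
  fun N => place K ⟨![i, j], by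
    intro a b hab
    fin_cases a <;> fin_cases b <;> simp_all⟩ (x N)

/-- The quantum Yang-Baxter equation `R^{1,2} R^{1,3} R^{2,3} = R^{2,3} R^{1,3} R^{1,2}`. -/
def IsQYBESolution {K : Type*} [Field K] (R : UnivHat K 2) : Prop :=
  leg (m := 3) 0 1 (by decide) R * leg 0 2 (by decide) R * leg 1 2 (by decide) R =
    leg 1 2 (by decide) R * leg 0 2 (by decide) R * leg 0 1 (by decide) R

/-- `(U(g) ⊗ U(a)U(b)_0)_univ`, completed: the sum of all summands of `(U(g)^{⊗ 2})_univ` in which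
the second tensor factor contains at least one letter `b`. -/
noncomputable def UgUaUb0 (K : Type*) [Field K] : Submodule K (UnivHat K 2) :=
  Submodule.pi (φ := fun N => Univ K 2 N) Set.univ fun N =>
    Submodule.span K {u | ∃ d : Diag 2 N, d.1.2 1 ≠ [] ∧ d.toUniv K = u}

/-- `(U(a)_0 U(b) ⊗ U(g))_univ`, completed: the sum of all summands of `(U(g)^{⊗ 2})_univ` in which
the first tensor factor contains at least one letter `a`. -/
noncomputable def Ua0UbUg (K : Type*) [Field K] : Submodule K (UnivHat K 2) :=
  Submodule.pi (φ := fun N => Univ K 2 N) Set.univ fun N =>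
    Submodule.span K {u | ∃ d : Diag 2 N, d.1.1 0 ≠ [] ∧ d.toUniv K = u}

end UnivAlg

/-!
Write `R_k` for the component of degree `k` of `R`, and `r^{12}`, `R_k^{12}`, ... for the elements
with three tensor factors obtained by insertion.  The proof is by induction on `k`, the case
`k = 1` being `R_1 = r`.

For `k ≥ 2` the quantum Yang-Baxter equation is considered in degree `k + 1`.  Let `D` be the span
of the diagrams which have a letter `b` in the third factor (for the claim about the second factor
of `R_k`), or a letter `a` in the first factor (for the claim about the first factor).  Normal
ordering moves letters around, but letters `b` of the right factor of a product and letters `a` of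
the left factor stay in their tensor factors (`normalOrder_snd_ne_nil`, `normalOrder_fst_ne_nil`).
By the induction hypothesis all products of three components of degrees smaller than `k` therefore
lie in `D`, and what remains is linear in `R_k`
(`mul_mul_linear`, `commutator_mem_of_mul_mul_eq`).  Let `S` be the part of `R_k` without letters
`b` in the second factor (without letters `a` in the first factor).  Two steps show that `S = 0`.

* All terms of the linear equation but one have letters `b` (letters `a`) in places where the
  remaining one, `r^{23} S^{13}` (`S^{13} r^{12}`), need not have any.  In that term the letter
  `b` (`a`) of `r` has to be absorbed by one of the letters that it meets.  Reading off the
  coefficients of terms in which the place of the absorbed letter determines the absorbing one,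
  one finds that `S` is concentrated in one tensor factor, `S = X ⊗ 1` (`S = 1 ⊗ X`); see
  `fst_one_eq_nil_of_mem` and `snd_zero_eq_nil_of_mem`.
* The equation then says that `X ⊗ 1 + 1 ⊗ X` commutes with `r`, modulo terms with letters in a
  third factor, and this forces `X = 0` (`mk_eq_zero_of_commutator`).

For the last statement let `c_j (u, v)` be the coefficients of `X` with respect to `u(a) v(b)`,
where the words `u` and `v` use all letters of a set `Λ` of `k + 1` elements except `j`.
Functionals of the form `w(U) η(V) [Z = Z₀]` on normally ordered expressions `U(a) V(b) ⊗ Z(b)`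
turn the commutation relation into the equations collected in `IsCommuting`, with the coefficients
`aVal`.  Colour the letters of the first and of the second words.  It is shown that the sums of
the coefficients over all pairs of shuffles of given words, one for each colour, vanish
(`IsCommuting.vanishes`), by induction, starting from fine colourings.  If all letters of the first
word have different colours, only the sum of all coefficients and the symmetry under renaming
matter (`IsCommuting.vanishes_of_injective`).  Otherwise a suitable functional expresses the sum in
question through sums for finer colourings (`IsCommuting.sum_shuffles_eq_zero_of_append`).  For the
colourings with one colour the statement says that `c = 0` (`IsCommuting.eq_zero`).  Since the
graded components are spaces of coinvariants of a finite group, in characteristic `0` an element is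
determined by the sum of all its relabellings (`mk_eq_zero_of_spread`), so that functionals can be
evaluated on representatives.
-/

namespace UnivAlg

/-! ### Supports of normally ordered products -/

theorem pushB_mem_supported (K : Type*) [Field K] {n : ℕ} {Λ : Type} [DecidableEq Λ]
    (α : Fin n) (i : Λ) (A B : Words n Λ) (P : Words n Λ → List Λ → List Λ → Prop)
    (Q : State n Λ → Prop)
    (h0 : ∀ X pre, P X pre [] →
      Q (X, Function.update A α pre, Function.update B α (i :: B α)))
    (h1 : ∀ X pre j rest, P X pre (j :: rest) →
      P X (pre ++ [j]) rest ∧ P (insAfter i j X) pre rest ∧ P (insBefore i j X) pre rest ∧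
        Q (X, Function.update A α (pre ++ j :: rest), insBefore j i B) ∧
        Q (X, Function.update A α (pre ++ j :: rest), insAfter j i B))
    (X : Words n Λ) (pre rest : List Λ) (h : P X pre rest) :
    pushB K α i A B X pre rest ∈ Finsupp.supported K K {s | Q s} := by
  induction rest generalizing X pre with
  | nil => exact Finsupp.single_mem_supported K _ (h0 _ _ h)
  | cons j rest ih =>
    obtain ⟨a, b, c, d, e⟩ := h1 _ _ _ _ h
    exact Submodule.sub_mem _ (Submodule.sub_mem _ (ih _ _ a)
      (Submodule.sub_mem _ (ih _ _ b) (ih _ _ c)))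
      (Submodule.sub_mem _ (Finsupp.single_mem_supported K _ d)
        (Finsupp.single_mem_supported K _ e))

theorem foldr_moveB_mem_supported (K : Type*) [Field K] {n : ℕ} {Λ : Type} [DecidableEq Λ]
    (Q : List (Fin n × Λ) → State n Λ → Prop)
    (h : ∀ p L s, Q (p :: L) s →
      pushB K p.1 p.2 s.2.1 s.2.2 s.1 [] (s.2.1 p.1) ∈ Finsupp.supported K K {s | Q L s})
    (L rem : List (Fin n × Λ)) (s : State n Λ) (hs : Q (L.reverse ++ rem) s) :
    L.foldr (fun p => moveB K p.1 p.2) (Finsupp.single s 1) ∈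
      Finsupp.supported K K {s | Q rem s} := by
  induction L generalizing rem with
  | nil => exact Finsupp.single_mem_supported K _ hs
  | cons p L ih =>
    have h2 := ih (p :: rem) (by simpa using hs)
    rw [List.foldr_cons, moveB, Finsupp.linearCombination_apply]
    exact Submodule.sum_mem _ fun t ht => Submodule.smul_mem _ _ (h _ _ _ (h2 ht))

theorem insAfter_ne_nil {n : ℕ} {Λ : Type} [DecidableEq Λ] (i j : Λ) (w : Words n Λ)
    (β : Fin n) (h : w β ≠ []) : insAfter i j w β ≠ [] := by
  obtain ⟨a, t, h⟩ := List.exists_cons_of_ne_nil h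
  rw [insAfter, h, List.flatMap_cons]
  split_ifs <;> simp

theorem insBefore_ne_nil {n : ℕ} {Λ : Type} [DecidableEq Λ] (i j : Λ) (w : Words n Λ)
    (β : Fin n) (h : w β ≠ []) : insBefore i j w β ≠ [] := by
  obtain ⟨a, t, h⟩ := List.exists_cons_of_ne_nil h
  rw [insBefore, h, List.flatMap_cons]
  split_ifs <;> simp

theorem normalOrder_induct (K : Type*) [Field K] {n : ℕ} {Λ : Type} [DecidableEq Λ]
    (Q : List (Fin n × Λ) → State n Λ → Prop)
    (h : ∀ p L s, Q (p :: L) s →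
      pushB K p.1 p.2 s.2.1 s.2.2 s.1 [] (s.2.1 p.1) ∈ Finsupp.supported K K {s | Q L s})
    (x y : Words n Λ × Words n Λ) (hs : Q (letters x.2).reverse (x.1, y.1, y.2))
    (R : Words n Λ × Words n Λ → Prop)
    (hR : ∀ s : State n Λ, Q [] s → R (fun α => s.1 α ++ s.2.1 α, s.2.2))
    (d : Words n Λ × Words n Λ) (hd : d ∈ (normalOrder K x y).support) : R d := by
  classical
  have h1 := foldr_moveB_mem_supported K Q h (letters x.2) [] (x.1, y.1, y.2) (by simpa using hs)
  obtain ⟨s, hs, rfl⟩ := Finset.mem_image.1 (Finsupp.mapDomain_support hd)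
  exact hR s (h1 hs)

theorem mem_letters {n : ℕ} {Λ : Type} (B : Words n Λ) (p : Fin n × Λ) :
    p ∈ letters B ↔ p.2 ∈ B p.1 := by
  simp only [letters, List.mem_flatMap, List.mem_finRange, List.mem_map, true_and]
  exact ⟨fun ⟨α, l, h, e⟩ => by subst e; exact h, fun h => ⟨_, _, h, rfl⟩⟩

/-- The letters `b` of the right factor never leave their tensor factor, and neither do those of
the left factor which meet no letter `a` on their way. -/
theorem normalOrder_snd_ne_nil (K : Type*) [Field K] {n : ℕ} {Λ : Type} [DecidableEq Λ]
    (x y : Words n Λ × Words n Λ) (β : Fin n) (h : y.2 β ≠ [] ∨ (y.1 β = [] ∧ x.2 β ≠ []))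
    (d : Words n Λ × Words n Λ) (hd : d ∈ (normalOrder K x y).support) : d.2 β ≠ [] := by
  refine normalOrder_induct K
    (fun L s => s.2.2 β ≠ [] ∨ (s.2.1 β = [] ∧ ∃ p ∈ L, p.1 = β)) (fun p L s hs => ?_) x y ?_
    (fun d => d.2 β ≠ []) (fun s hs => ?_) d hd
  · rcases hs with hs | ⟨hs, hp⟩
    · refine pushB_mem_supported K _ _ _ _ (fun _ _ _ => True) _ (fun X pre _ => Or.inl ?_)
        (fun X pre j rest _ => ⟨trivial, trivial, trivial, Or.inl (insBefore_ne_nil _ _ _ _ hs),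
          Or.inl (insAfter_ne_nil _ _ _ _ hs)⟩) _ _ _ trivial
      by_cases hβ : β = p.1
      · subst hβ; simp
      · simpa [Function.update_of_ne hβ] using hs
    · by_cases hβ : p.1 = β
      · rw [hβ, hs]
        exact Finsupp.single_mem_supported K _ (Or.inl (by simp))
      · have hL : ∃ q ∈ L, q.1 = β := by
          obtain ⟨q, hq, hqβ⟩ := hp
          rcases List.mem_cons.1 hq with rfl | hq
          · exact absurd hqβ hβ
          · exact ⟨q, hq, hqβ⟩
        have hA : ∀ v, Function.update s.2.1 p.1 v β = [] := fun v => by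
          rw [Function.update_of_ne (Ne.symm hβ), hs]
        exact pushB_mem_supported K _ _ _ _ (fun _ _ _ => True) _
          (fun X pre _ => Or.inr ⟨hA _, hL⟩)
          (fun X pre j rest _ => ⟨trivial, trivial, trivial, Or.inr ⟨hA _, hL⟩,
            Or.inr ⟨hA _, hL⟩⟩) _ _ _ trivial
  · rcases h with h | ⟨h, h'⟩
    · exact Or.inl h
    · obtain ⟨l, hl⟩ := List.exists_mem_of_ne_nil _ h'
      exact Or.inr ⟨h, (β, l), List.mem_reverse.2 ((mem_letters _ _).2 hl), rfl⟩
  · simpa using hs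

/-- The letters `a` of the left factor never leave their tensor factor, and neither do those of
the right factor which meet no letter `b` on their way. -/
theorem normalOrder_fst_ne_nil (K : Type*) [Field K] {n : ℕ} {Λ : Type} [DecidableEq Λ]
    (x y : Words n Λ × Words n Λ) (β : Fin n) (h : x.1 β ≠ [] ∨ (y.1 β ≠ [] ∧ x.2 β = []))
    (d : Words n Λ × Words n Λ) (hd : d ∈ (normalOrder K x y).support) : d.1 β ≠ [] := by
  refine normalOrder_induct K
    (fun L s => s.1 β ≠ [] ∨ (s.2.1 β ≠ [] ∧ ∀ p ∈ L, p.1 ≠ β)) (fun p L s hs => ?_) x y ?_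
    (fun d => d.1 β ≠ []) (fun s hs => ?_) d hd
  · rcases hs with hs | ⟨hs, hp⟩
    · exact pushB_mem_supported K _ _ _ _ (fun X _ _ => X β ≠ []) _ (fun X pre h => Or.inl h)
        (fun X pre j rest h => ⟨h, insAfter_ne_nil _ _ _ _ h, insBefore_ne_nil _ _ _ _ h,
          Or.inl h, Or.inl h⟩) _ _ _ hs
    · have hβ : β ≠ p.1 := fun e => hp p (by simp) e.symm
      have hA : ∀ v, Function.update s.2.1 p.1 v β ≠ [] := fun v => by
          rwa [Function.update_of_ne hβ]
      have hL : ∀ q ∈ L, q.1 ≠ β := fun q hq => hp q (by simp [hq])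
      exact pushB_mem_supported K _ _ _ _ (fun _ _ _ => True) _
          (fun X pre _ => Or.inr ⟨hA _, hL⟩)
          (fun X pre j rest _ => ⟨trivial, trivial, trivial, Or.inr ⟨hA _, hL⟩,
            Or.inr ⟨hA _, hL⟩⟩) _ _ _ trivial
  · rcases h with h | ⟨h, h'⟩
    · exact Or.inl h
    · refine Or.inr ⟨h, fun p hp e => ?_⟩
      have := (mem_letters _ _).1 (List.mem_reverse.1 hp)
      rw [e, h'] at this
      simp at this
  · rcases hs with hs | hs
    · simp [hs]
    · simp [hs.1]

/-! ### Spans of classes of diagrams -/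

/-- The span of the classes of the diagrams with the property `P`. -/
noncomputable def diagSpan (K : Type*) [Field K] {n N : ℕ} (P : Diag n N → Prop) :
    Submodule K (Univ K n N) :=
  Submodule.span K {u | ∃ d, P d ∧ d.toUniv K = u}

theorem toUniv_mem_diagSpan (K : Type*) [Field K] {n N : ℕ} {P : Diag n N → Prop} {d : Diag n N}
    (h : P d) : d.toUniv K ∈ diagSpan K P := Submodule.subset_span ⟨d, h, rfl⟩

theorem mk_eq_sum (K : Type*) [Field K] {n N : ℕ} (s : Diag n N →₀ K) :
    Representation.Coinvariants.mk (relabelRep K n N) s = s.sum fun d a => a • d.toUniv K := by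
  conv_lhs => rw [← Finsupp.sum_single s]
  rw [Finsupp.sum, map_sum, Finsupp.sum]
  refine Finset.sum_congr rfl fun d _ => ?_
  rw [show d.toUniv K = Representation.Coinvariants.mk (relabelRep K n N) (Finsupp.single d 1)
    from rfl, ← map_smul, Finsupp.smul_single_one]

theorem mk_mem_diagSpan (K : Type*) [Field K] {n N : ℕ} {P : Diag n N → Prop} (s : Diag n N →₀ K)
    (h : ∀ d ∈ s.support, P d) :
    Representation.Coinvariants.mk (relabelRep K n N) s ∈ diagSpan K P := by
  rw [mk_eq_sum]
  exact Submodule.sum_mem _ fun d hd => Submodule.smul_mem _ _ (toUniv_mem_diagSpan K (h d hd))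

theorem diagSpan_le (K : Type*) [Field K] {n N : ℕ} {P : Diag n N → Prop}
    {W : Submodule K (Univ K n N)} (h : ∀ d, P d → d.toUniv K ∈ W) : diagSpan K P ≤ W :=
  Submodule.span_le.2 fun _ ⟨d, hd, e⟩ => e ▸ h d hd

theorem gmul_toUniv (K : Type*) [Field K] {n p q N : ℕ} (h : p + q = N) (x : Diag n p)
    (y : Diag n q) : gmul K h (x.toUniv K) (y.toUniv K) =
      Representation.Coinvariants.mk (relabelRep K n N) (mulDiag K h x y) := by
  change mulFree K h (Finsupp.single x 1) (Finsupp.single y 1) = _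
  simp [mulFree]

theorem gmul_mem_diagSpan (K : Type*) [Field K] {n p q N : ℕ} (h : p + q = N)
    {P : Diag n p → Prop} {Q : Diag n q → Prop} {R : Diag n N → Prop}
    (hR : ∀ x y, P x → Q y → ∀ d ∈ (mulDiag K h x y).support, R d) {u : Univ K n p}
    {v : Univ K n q} (hu : u ∈ diagSpan K P) (hv : v ∈ diagSpan K Q) :
    gmul K h u v ∈ diagSpan K R := by
  have h1 : diagSpan K P ≤ Submodule.comap ((gmul K h).flip v) (diagSpan K R) := by
    refine diagSpan_le K fun x hx => ?_
    have h2 : diagSpan K Q ≤ Submodule.comap (gmul K h (x.toUniv K)) (diagSpan K R) := by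
      refine diagSpan_le K fun y hy => ?_
      rw [Submodule.mem_comap, gmul_toUniv]
      exact mk_mem_diagSpan K _ (hR x y hx hy)
    exact h2 hv
  exact h1 hu

theorem diagSpan_true (K : Type*) [Field K] {n N : ℕ} (u : Univ K n N) :
    u ∈ diagSpan K (fun _ : Diag n N => True) := by
  obtain ⟨s, rfl⟩ := Representation.Coinvariants.mk_surjective (relabelRep K n N) u
  exact mk_mem_diagSpan K s fun _ _ => trivial

theorem rename_eq_nil {n : ℕ} {Λ Λ' : Type} (f : Λ → Λ') (w : Words n Λ) (β : Fin n) :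
    rename f w β = [] ↔ w β = [] := by simp [rename]

theorem mem_support_mulDiag (K : Type*) [Field K] {n p q N : ℕ} (h : p + q = N) (x : Diag n p)
    (y : Diag n q) (d : Diag n N) : d ∈ (mulDiag K h x y).support ↔
      d.1 ∈ (normalOrder K (rename (inL h) x.1.1, rename (inL h) x.1.2)
        (rename (inR h) y.1.1, rename (inR h) y.1.2)).support := by
  rw [Finsupp.mem_support_iff, Finsupp.mem_support_iff]; rfl

/-- The span of the classes of the diagrams with a letter `b` in factor `β`. -/
noncomputable abbrev spanB (K : Type*) [Field K] {n N : ℕ} (β : Fin n) :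
    Submodule K (Univ K n N) := diagSpan K fun d : Diag n N => d.1.2 β ≠ []

/-- The span of the classes of the diagrams with a letter `a` in factor `β`. -/
noncomputable abbrev spanA (K : Type*) [Field K] {n N : ℕ} (β : Fin n) :
    Submodule K (Univ K n N) := diagSpan K fun d : Diag n N => d.1.1 β ≠ []

theorem gmul_mem_spanB_right (K : Type*) [Field K] {n p q N : ℕ} (h : p + q = N) {β : Fin n}
    (u : Univ K n p) {v : Univ K n q} (hv : v ∈ spanB K β) : gmul K h u v ∈ spanB K β :=
  gmul_mem_diagSpan K h (fun x y _ hy d hd => normalOrder_snd_ne_nil K _ _ β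
    (Or.inl (by simpa only [ne_eq, rename_eq_nil] using hy)) _
    ((mem_support_mulDiag K h x y d).1 hd)) (diagSpan_true K u) hv

theorem gmul_mem_spanB_left (K : Type*) [Field K] {n p q N : ℕ} (h : p + q = N) {β : Fin n}
    {u : Univ K n p} {v : Univ K n q} (hu : u ∈ spanB K β)
    (hv : v ∈ diagSpan K fun d : Diag n q => d.1.1 β = []) : gmul K h u v ∈ spanB K β :=
  gmul_mem_diagSpan K h (fun x y hx hy d hd => normalOrder_snd_ne_nil K _ _ β
    (Or.inr ⟨by simpa only [rename_eq_nil] using hy,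
      by simpa only [ne_eq, rename_eq_nil] using hx⟩) _
    ((mem_support_mulDiag K h x y d).1 hd)) hu hv

theorem gmul_mem_spanA_left (K : Type*) [Field K] {n p q N : ℕ} (h : p + q = N) {β : Fin n}
    {u : Univ K n p} (v : Univ K n q) (hu : u ∈ spanA K β) : gmul K h u v ∈ spanA K β :=
  gmul_mem_diagSpan K h (fun x y hx _ d hd => normalOrder_fst_ne_nil K _ _ β
    (Or.inl (by simpa only [ne_eq, rename_eq_nil] using hx)) _
    ((mem_support_mulDiag K h x y d).1 hd)) hu (diagSpan_true K v)

theorem gmul_mem_spanA_right (K : Type*) [Field K] {n p q N : ℕ} (h : p + q = N) {β : Fin n}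
    {u : Univ K n p} {v : Univ K n q} (hu : u ∈ diagSpan K fun d : Diag n p => d.1.2 β = [])
    (hv : v ∈ spanA K β) : gmul K h u v ∈ spanA K β :=
  gmul_mem_diagSpan K h (fun x y hx hy d hd => normalOrder_fst_ne_nil K _ _ β
    (Or.inr ⟨by simpa only [ne_eq, rename_eq_nil] using hy,
      by simpa only [rename_eq_nil] using hx⟩) _
    ((mem_support_mulDiag K h x y d).1 hd)) hu hv

theorem place_toUniv (K : Type*) [Field K] {n m N : ℕ} (f : Fin n ↪ Fin m) (d : Diag n N) :
    place K f (d.toUniv K) = (placeDiag f d).toUniv K := by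
  change Representation.Coinvariants.mk (relabelRep K m N)
    (Finsupp.mapDomain (placeDiag f) (Finsupp.single d 1)) = _
  rw [Finsupp.mapDomain_single]; rfl

theorem place_mem_diagSpan (K : Type*) [Field K] {n m N : ℕ} (f : Fin n ↪ Fin m)
    {P : Diag n N → Prop} {Q : Diag m N → Prop} (h : ∀ d, P d → Q (placeDiag f d))
    {u : Univ K n N} (hu : u ∈ diagSpan K P) : place K f u ∈ diagSpan K Q := by
  have h1 : diagSpan K P ≤ Submodule.comap (place K f) (diagSpan K Q) :=
    diagSpan_le K fun d hd => by
      rw [Submodule.mem_comap, place_toUniv]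
      exact toUniv_mem_diagSpan K (h d hd)
  exact h1 hu

/-! ### The unit, and products of three elements up to first order -/

theorem moveB_single_of_eq_nil (K : Type*) [Field K] {n : ℕ} {Λ : Type} [DecidableEq Λ]
    (α : Fin n) (i : Λ) (X A B : Words n Λ) (h : A α = []) :
    moveB K α i (Finsupp.single (X, A, B) 1) =
      Finsupp.single (X, A, Function.update B α (i :: B α)) 1 := by
  have h2 : Function.update A α [] = A := by rw [← h, Function.update_eq_self]
  simp [moveB, h, pushB, h2]

theorem foldr_moveB_of_eq_nil (K : Type*) [Field K] {n : ℕ} {Λ : Type} [DecidableEq Λ]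
    (L : List (Fin n × Λ)) (X A B : Words n Λ) (h : ∀ p ∈ L, A p.1 = []) :
    L.foldr (fun p => moveB K p.1 p.2) (Finsupp.single (X, A, B) 1) =
      Finsupp.single (X, A, fun α => (L.filter (fun p => p.1 = α)).map Prod.snd ++ B α) 1 := by
  induction L with
  | nil => rfl
  | cons p L ih =>
    rw [List.foldr_cons, ih fun q hq => h q (by simp [hq]),
      moveB_single_of_eq_nil K _ _ _ _ _ (h p (by simp))]
    congr 3
    funext α
    by_cases hα : p.1 = α
    · subst hα; simp
    · simp [hα, Function.update_of_ne (Ne.symm hα)]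

theorem map_snd_filter_letters {n : ℕ} {Λ : Type} (B : Words n Λ) (α : Fin n) :
    ((letters B).filter (fun p => p.1 = α)).map Prod.snd = B α := by
  have h : ∀ L : List (Fin n), L.Nodup → (((L.flatMap fun β => (B β).map fun l => (β, l)).filter
      (fun p => p.1 = α)).map Prod.snd) = if α ∈ L then B α else [] := by
    intro L hL
    induction L with
    | nil => simp
    | cons β L ih =>
      rw [List.nodup_cons] at hL
      rw [List.flatMap_cons, List.filter_append, List.map_append, ih hL.2]
      by_cases hβ : β = α
      · subst hβ
        simp [List.filter_map, Function.comp_def, hL.1]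
      · simp [List.filter_map, Function.comp_def, hβ, Ne.symm hβ]
  exact (h _ (List.nodup_finRange n)).trans (if_pos (List.mem_finRange α))

theorem normalOrder_one_right (K : Type*) [Field K] {n : ℕ} {Λ : Type} [DecidableEq Λ]
    (x : Words n Λ × Words n Λ) :
    normalOrder K x (fun _ => [], fun _ => []) = Finsupp.single x 1 := by
  rw [normalOrder, foldr_moveB_of_eq_nil K _ _ _ _ fun _ _ => rfl, Finsupp.mapDomain_single]
  simp [map_snd_filter_letters]

theorem normalOrder_one_left (K : Type*) [Field K] {n : ℕ} {Λ : Type} [DecidableEq Λ]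
    (y : Words n Λ × Words n Λ) :
    normalOrder K (fun _ => [], fun _ => []) y = Finsupp.single y 1 := by
  have : letters (fun _ : Fin n => ([] : List Λ)) = [] := by simp [letters]
  rw [normalOrder, this, List.foldr_nil, Finsupp.mapDomain_single]
  simp

theorem mulDiag_eq_single (K : Type*) [Field K] {n p q N : ℕ} (h : p + q = N) (x : Diag n p)
    (y : Diag n q) (d : Diag n N) (hd : normalOrder K (rename (inL h) x.1.1, rename (inL h) x.1.2)
      (rename (inR h) y.1.1, rename (inR h) y.1.2) = Finsupp.single d.1 1) :
    mulDiag K h x y = Finsupp.single d 1 := by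
  classical
  ext e
  have h1 : mulDiag K h x y e = Finsupp.single d.1 1 e.1 := by rw [← hd]; rfl
  rw [h1, Finsupp.single_apply, Finsupp.single_apply]
  exact if_congr Subtype.ext_iff.symm rfl rfl

theorem rename_id {n : ℕ} {Λ : Type} (w : Words n Λ) : rename (fun l => l) w = w := by
  funext α; simp [rename]

theorem rename_elim {n : ℕ} {Λ Λ' : Type} (f : Λ → Λ') :
    rename f (fun _ : Fin n => []) = fun _ => [] := by
  funext α; simp [rename]

theorem gmul_one (K : Type*) [Field K] {n p : ℕ} (h : p + 0 = p) (u : Univ K n p) :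
    gmul K h u ((emptyDiag n).toUniv K) = u := by
  have h1 : (gmul K h).flip ((emptyDiag n).toUniv K) = LinearMap.id := by
    refine Representation.Coinvariants.hom_ext ?_
    ext1 x; ext1
    change gmul K h (x.toUniv K) ((emptyDiag n).toUniv K) = x.toUniv K
    rw [gmul_toUniv, mulDiag_eq_single K h x _ x]
    · rfl
    · have : inL h = fun i => i := by funext i; apply Fin.ext; simp [inL]
      simp only [this, rename_id]
      change normalOrder K _ (rename (inR h) (fun _ => []), rename (inR h) (fun _ => [])) = _
      rw [rename_elim, normalOrder_one_right]
  exact LinearMap.congr_fun h1 u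

theorem one_gmul (K : Type*) [Field K] {n p : ℕ} (h : 0 + p = p) (u : Univ K n p) :
    gmul K h ((emptyDiag n).toUniv K) u = u := by
  have h1 : gmul K h ((emptyDiag n).toUniv K) = LinearMap.id := by
    refine Representation.Coinvariants.hom_ext ?_
    ext1 x; ext1
    change gmul K h ((emptyDiag n).toUniv K) (x.toUniv K) = x.toUniv K
    rw [gmul_toUniv, mulDiag_eq_single K h _ x x]
    · rfl
    · have : inR h = fun i => i := by funext i; apply Fin.ext; simp [inR]
      simp only [this, rename_id]
      change normalOrder K (rename (inL h) (fun _ => []), rename (inL h) (fun _ => [])) _ = _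
      rw [rename_elim, normalOrder_one_left]
  exact LinearMap.congr_fun h1 u

theorem gmul_gmul_one (K : Type*) [Field K] {n p q m N : ℕ} (hm : p + q = m) (h : m + 0 = N)
    (h' : p + q = N) (u : Univ K n p) (v : Univ K n q) :
    gmul K h (gmul K hm u v) ((emptyDiag n).toUniv K) = gmul K h' u v := by
  obtain rfl : m = N := by omega
  exact gmul_one K h _

theorem gmul_gmul_one_left (K : Type*) [Field K] {n q m r N : ℕ} (hm : 0 + q = m) (h : m + r = N)
    (h' : q + r = N) (u : Univ K n q) (v : Univ K n r) :
    gmul K h (gmul K hm ((emptyDiag n).toUniv K) u) v = gmul K h' u v := by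
  obtain rfl : q = m := by omega
  rw [one_gmul K hm]

theorem gmul_gmul_one_mid (K : Type*) [Field K] {n p m r N : ℕ} (hm : p + 0 = m) (h : m + r = N)
    (h' : p + r = N) (u : Univ K n p) (v : Univ K n r) :
    gmul K h (gmul K hm u ((emptyDiag n).toUniv K)) v = gmul K h' u v := by
  obtain rfl : p = m := by omega
  rw [gmul_one K hm]

/-- The contribution of the components of degrees `t.1`, `t.2.1`, `t.2.2` to the component of
degree `N` of a product of three elements. -/
noncomputable def tripleTerm {K : Type*} [Field K] {n : ℕ} (N : ℕ) (x y z : UnivHat K n)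
    (t : ℕ × ℕ × ℕ) : Univ K n N :=
  if h : t.1 + t.2.1 + t.2.2 = N then gmul K h (gmul K rfl (x t.1) (y t.2.1)) (z t.2.2) else 0

theorem tripleTerm_eq {K : Type*} [Field K] {n N : ℕ} (x y z : UnivHat K n) {p q m r : ℕ}
    (hm : p + q = m) (h : m + r = N) :
    tripleTerm N x y z (p, q, r) = gmul K h (gmul K hm (x p) (y q)) (z r) := by
  subst hm
  exact dif_pos h

theorem mul_apply {K : Type*} [Field K] {n : ℕ} (x y : UnivHat K n) (N : ℕ) :
    (x * y) N = ∑ pq : {pq // pq ∈ Finset.HasAntidiagonal.antidiagonal N},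
      gmul K (Finset.HasAntidiagonal.mem_antidiagonal.1 pq.2) (x pq.1.1) (y pq.1.2) := rfl

theorem mul_mul_apply {K : Type*} [Field K] {n : ℕ} (N : ℕ) (x y z : UnivHat K n) :
    (x * y * z) N = ∑ ms ∈ Finset.HasAntidiagonal.antidiagonal N,
      ∑ pq ∈ Finset.HasAntidiagonal.antidiagonal ms.1,
      tripleTerm N x y z (pq.1, pq.2, ms.2) := by
  rw [mul_apply]
  refine Eq.trans ?_ (Finset.sum_coe_sort (Finset.HasAntidiagonal.antidiagonal N) fun ms =>
    ∑ pq ∈ Finset.HasAntidiagonal.antidiagonal ms.1, tripleTerm N x y z (pq.1, pq.2, ms.2))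
  refine Finset.sum_congr rfl fun ms _ => ?_
  rw [mul_apply, map_sum, LinearMap.sum_apply]
  refine Eq.trans ?_ (Finset.sum_coe_sort (Finset.HasAntidiagonal.antidiagonal ms.1.1) fun pq =>
    tripleTerm N x y z (pq.1, pq.2, ms.1.2))
  refine Finset.sum_congr rfl fun pq _ => ?_
  exact (tripleTerm_eq x y z _ _).symm

/-- In a product of three elements with constant term `1`, all contributions to degree `k + 1`
that do not lie in `D` are those which involve only one component of positive degree, or one of
degree `k` and one of degree `1`. -/
theorem mul_mul_linear {K : Type*} [Field K] {n : ℕ} (k : ℕ) (hk : 2 ≤ k) (x y z : UnivHat K n)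
    (hx : x 0 = (emptyDiag n).toUniv K) (hy : y 0 = (emptyDiag n).toUniv K)
    (hz : z 0 = (emptyDiag n).toUniv K) (D : Submodule K (Univ K n (k + 1)))
    (hD : ∀ p q r m (hm : p + q = m) (h : m + r = k + 1), p < k → q < k → r < k →
      gmul K h (gmul K hm (x p) (y q)) (z r) ∈ D) :
    (x * y * z) (k + 1) - (x (k + 1) + y (k + 1) + z (k + 1)
      + (gmul K (by omega) (x 1) (y k) + gmul K (by omega) (x k) (y 1)
      + gmul K (by omega) (x 1) (z k) + gmul K (by omega) (x k) (z 1)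
      + gmul K (by omega) (y 1) (z k) + gmul K (by omega) (y k) (z 1))) ∈ D := by
  rw [← Submodule.Quotient.mk_eq_zero, ← Submodule.mkQ_apply, map_sub, sub_eq_zero, mul_mul_apply]
  simp only [map_sum]
  rw [Finset.sum_sigma']
  set U : Finset (ℕ × ℕ × ℕ) :=
    ((Finset.range (k + 2)) ×ˢ (Finset.range (k + 2)) ×ˢ (Finset.range (k + 2))).filter
      fun t => t.1 + t.2.1 + t.2.2 = k + 1 with hU
  have hsum : ∑ a ∈ (Finset.HasAntidiagonal.antidiagonal (k + 1)).sigma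
        fun ms => Finset.HasAntidiagonal.antidiagonal ms.1,
      D.mkQ (tripleTerm (k + 1) x y z (a.2.1, a.2.2, a.1.2)) =
      ∑ t ∈ U, D.mkQ (tripleTerm (k + 1) x y z t) := by
    refine Finset.sum_nbij' (fun a => (a.2.1, a.2.2, a.1.2))
      (fun t => ⟨(t.1 + t.2.1, t.2.2), (t.1, t.2.1)⟩) ?_ ?_ ?_ ?_ ?_
    · rintro ⟨⟨m, r⟩, ⟨p, q⟩⟩ h
      simp only [Finset.mem_sigma, Finset.HasAntidiagonal.mem_antidiagonal] at h
      simp only [hU, Finset.mem_filter, Finset.mem_product, Finset.mem_range]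
      omega
    · rintro ⟨p, q, r⟩ h
      simp only [hU, Finset.mem_filter, Finset.mem_product, Finset.mem_range] at h
      simp only [Finset.mem_sigma, Finset.HasAntidiagonal.mem_antidiagonal]
      exact ⟨h.2, trivial⟩
    · rintro ⟨⟨m, r⟩, ⟨p, q⟩⟩ h
      simp only [Finset.mem_sigma, Finset.HasAntidiagonal.mem_antidiagonal] at h
      obtain ⟨_, rfl⟩ := h
      rfl
    · rintro ⟨p, q, r⟩ _
      rfl
    · rintro ⟨⟨m, r⟩, ⟨p, q⟩⟩ _
      rfl
  rw [hsum]
  set S : Finset (ℕ × ℕ × ℕ) := {(k + 1, 0, 0), (0, k + 1, 0), (0, 0, k + 1), (1, k, 0), (k, 1, 0),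
    (1, 0, k), (k, 0, 1), (0, 1, k), (0, k, 1)} with hS
  have hSU : S ⊆ U := by
    intro t ht
    simp only [hS, Finset.mem_insert, Finset.mem_singleton] at ht
    simp only [hU, Finset.mem_filter, Finset.mem_product, Finset.mem_range]
    rcases ht with rfl | rfl | rfl | rfl | rfl | rfl | rfl | rfl | rfl <;> dsimp only <;> omega
  rw [← Finset.sum_subset hSU]
  · have e1 : tripleTerm (k + 1) x y z (k + 1, 0, 0) = x (k + 1) := by
      rw [tripleTerm_eq x y z rfl (by omega)]
      rw [hy, hz, gmul_gmul_one K _ _ (by omega), gmul_one]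
    have e2 : tripleTerm (k + 1) x y z (0, k + 1, 0) = y (k + 1) := by
      rw [tripleTerm_eq x y z rfl (by omega)]
      rw [hx, hz, gmul_gmul_one K _ _ (by omega), one_gmul]
    have e3 : tripleTerm (k + 1) x y z (0, 0, k + 1) = z (k + 1) := by
      rw [tripleTerm_eq x y z rfl (by omega)]
      rw [hx, hy, gmul_gmul_one_left K _ _ (by omega), one_gmul]
    have e4 : tripleTerm (k + 1) x y z (1, k, 0) = gmul K (by omega) (x 1) (y k) := by
      rw [tripleTerm_eq x y z rfl (by omega)]
      rw [hz, gmul_gmul_one K _ _ (by omega)]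
    have e5 : tripleTerm (k + 1) x y z (k, 1, 0) = gmul K (by omega) (x k) (y 1) := by
      rw [tripleTerm_eq x y z rfl (by omega)]
      rw [hz, gmul_gmul_one K _ _ (by omega)]
    have e6 : tripleTerm (k + 1) x y z (1, 0, k) = gmul K (by omega) (x 1) (z k) := by
      rw [tripleTerm_eq x y z rfl (by omega)]
      rw [hy, gmul_gmul_one_mid K _ _ (by omega)]
    have e7 : tripleTerm (k + 1) x y z (k, 0, 1) = gmul K (by omega) (x k) (z 1) := by
      rw [tripleTerm_eq x y z rfl (by omega)]
      rw [hy, gmul_gmul_one_mid K _ _ (by omega)]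
    have e8 : tripleTerm (k + 1) x y z (0, 1, k) = gmul K (by omega) (y 1) (z k) := by
      rw [tripleTerm_eq x y z rfl (by omega)]
      rw [hx, gmul_gmul_one_left K _ _ (by omega)]
    have e9 : tripleTerm (k + 1) x y z (0, k, 1) = gmul K (by omega) (y k) (z 1) := by
      rw [tripleTerm_eq x y z rfl (by omega)]
      rw [hx, gmul_gmul_one_left K _ _ (by omega)]
    rw [hS]
    repeat rw [Finset.sum_insert (by
      simp only [Finset.mem_insert, Finset.mem_singleton, Prod.mk.injEq]; omega)]
    rw [Finset.sum_singleton, e1, e2, e3, e4, e5, e6, e7, e8, e9]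
    simp only [map_add]
    abel
  · rintro ⟨p, q, r⟩ ht hts
    simp only [hU, Finset.mem_filter, Finset.mem_product, Finset.mem_range] at ht
    simp only [hS, Finset.mem_insert, Finset.mem_singleton, Prod.mk.injEq] at hts
    rw [Submodule.mkQ_apply, Submodule.Quotient.mk_eq_zero, tripleTerm_eq x y z rfl ht.2]
    refine hD p q r (p + q) rfl ht.2 ?_ ?_ ?_ <;> by_contra hlt
    · have h3 : (p = k + 1 ∧ q = 0 ∧ r = 0) ∨ (p = k ∧ q = 1 ∧ r = 0) ∨
          (p = k ∧ q = 0 ∧ r = 1) := by clear hts; omega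
      rcases h3 with ⟨rfl, rfl, rfl⟩ | ⟨rfl, rfl, rfl⟩ | ⟨rfl, rfl, rfl⟩ <;> simp at hts
    · have h3 : (p = 0 ∧ q = k + 1 ∧ r = 0) ∨ (p = 1 ∧ q = k ∧ r = 0) ∨
          (p = 0 ∧ q = k ∧ r = 1) := by clear hts; omega
      rcases h3 with ⟨rfl, rfl, rfl⟩ | ⟨rfl, rfl, rfl⟩ | ⟨rfl, rfl, rfl⟩ <;> simp at hts
    · have h3 : (p = 0 ∧ q = 0 ∧ r = k + 1) ∨ (p = 1 ∧ q = 0 ∧ r = k) ∨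
          (p = 0 ∧ q = 1 ∧ r = k) := by clear hts; omega
      rcases h3 with ⟨rfl, rfl, rfl⟩ | ⟨rfl, rfl, rfl⟩ | ⟨rfl, rfl, rfl⟩ <;> simp at hts

/-! ### Words with one letter inserted next to another one -/

theorem split_unique {Λ : Type*} {j : Λ} {P Q P₁ Q₁ : List Λ} (hnd : (P ++ j :: Q).Nodup)
    (e : P ++ j :: Q = P₁ ++ j :: Q₁) : P = P₁ ∧ Q = Q₁ := by
  have h : j ∉ P ∧ j ∉ Q := by
    simp only [List.nodup_append, List.nodup_cons, List.mem_cons] at hnd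
    exact ⟨fun h => hnd.2.2 j h j (Or.inl rfl) rfl, hnd.2.1.1⟩
  have := (List.append_cons_inj_of_notMem h.1 h.2).1 e
  exact ⟨this.1, this.2.2⟩

section Words

variable {Λ : Type} [DecidableEq Λ]

/-- Replace `i` by `i j` in a word. -/
def lAfter (i j : Λ) (w : List Λ) : List Λ := w.flatMap fun l => if l = i then [i, j] else [l]

/-- Replace `i` by `j i` in a word. -/
def lBefore (i j : Λ) (w : List Λ) : List Λ := w.flatMap fun l => if l = i then [j, i] else [l]

theorem lAfter_of_notMem {i j : Λ} {w : List Λ} (h : i ∉ w) : lAfter i j w = w := by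
  induction w with
  | nil => rfl
  | cons a w ih =>
    rw [List.mem_cons, not_or] at h
    have := ih h.2
    rw [lAfter] at this ⊢
    rw [List.flatMap_cons, this, if_neg (Ne.symm h.1)]; rfl

theorem lBefore_of_notMem {i j : Λ} {w : List Λ} (h : i ∉ w) : lBefore i j w = w := by
  induction w with
  | nil => rfl
  | cons a w ih =>
    rw [List.mem_cons, not_or] at h
    have := ih h.2
    rw [lBefore] at this ⊢
    rw [List.flatMap_cons, this, if_neg (Ne.symm h.1)]; rfl

theorem lAfter_split {i j : Λ} {p q : List Λ} (hp : i ∉ p) (hq : i ∉ q) :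
    lAfter i j (p ++ i :: q) = p ++ i :: j :: q := by
  have h1 := lAfter_of_notMem (j := j) hp
  have h2 := lAfter_of_notMem (j := j) hq
  rw [lAfter] at h1 h2 ⊢
  rw [List.flatMap_append, List.flatMap_cons, h1, h2, if_pos rfl]; rfl

theorem lBefore_split {i j : Λ} {p q : List Λ} (hp : i ∉ p) (hq : i ∉ q) :
    lBefore i j (p ++ i :: q) = p ++ j :: i :: q := by
  have h1 := lBefore_of_notMem (j := j) hp
  have h2 := lBefore_of_notMem (j := j) hq
  rw [lBefore] at h1 h2 ⊢
  rw [List.flatMap_append, List.flatMap_cons, h1, h2, if_pos rfl]; rfl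

theorem mem_lAfter {i j l : Λ} {w : List Λ} : l ∈ lAfter i j w ↔ l ∈ w ∨ (i ∈ w ∧ l = j) := by
  rw [lAfter, List.mem_flatMap]
  constructor
  · rintro ⟨a, ha, h⟩
    split_ifs at h with hi
    · subst hi; simp at h; grind
    · simp at h; grind
  · rintro (h | ⟨h, rfl⟩)
    · exact ⟨l, h, by split_ifs with h <;> simp [h]⟩
    · exact ⟨i, h, by simp⟩

theorem mem_lBefore {i j l : Λ} {w : List Λ} :
    l ∈ lBefore i j w ↔ l ∈ w ∨ (i ∈ w ∧ l = j) := by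
  rw [lBefore, List.mem_flatMap]
  constructor
  · rintro ⟨a, ha, h⟩
    split_ifs at h with hi
    · subst hi; simp at h; grind
    · simp at h; grind
  · rintro (h | ⟨h, rfl⟩)
    · exact ⟨l, h, by split_ifs with h <;> simp [h]⟩
    · exact ⟨i, h, by simp⟩

theorem filter_lAfter_eq_filter_lBefore {i j : Λ} (p : Λ → Bool) (w : List Λ)
    (h : ¬ (p i = true ∧ p j = true)) : (lAfter i j w).filter p = (lBefore i j w).filter p := by
  induction w with
  | nil => rfl
  | cons a w ih =>
    rw [lAfter, lBefore] at ih ⊢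
    rw [List.flatMap_cons, List.flatMap_cons, List.filter_append, List.filter_append, ih]
    congr 1
    split_ifs
    · by_cases hi : p i = true <;> by_cases hj : p j = true <;> simp_all
    · rfl

theorem lAfter_cons (i j a : Λ) (w : List Λ) :
    lAfter i j (a :: w) = (if a = i then [i, j] else [a]) ++ lAfter i j w := rfl

theorem lBefore_cons (i j a : Λ) (w : List Λ) :
    lBefore i j (a :: w) = (if a = i then [j, i] else [a]) ++ lBefore i j w := rfl

theorem filter_lAfter {i j : Λ} (p : Λ → Bool) (w : List Λ) (h : p i = true) (h' : p j = true) :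
    (lAfter i j w).filter p = lAfter i j (w.filter p) := by
  induction w with
  | nil => rfl
  | cons a w ih =>
    rw [lAfter_cons, List.filter_append, ih]
    by_cases ha : a = i
    · subst ha; simp [h, h', lAfter_cons]
    · by_cases hp : p a = true <;> simp [ha, hp, lAfter_cons]

theorem filter_lBefore {i j : Λ} (p : Λ → Bool) (w : List Λ) (h : p i = true)
    (h' : p j = true) : (lBefore i j w).filter p = lBefore i j (w.filter p) := by
  induction w with
  | nil => rfl
  | cons a w ih =>
    rw [lBefore_cons, List.filter_append, ih]
    by_cases ha : a = i
    · subst ha; simp [h, h', lBefore_cons]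
    · by_cases hp : p a = true <;> simp [ha, hp, lBefore_cons]

theorem filter_lAfter_of_not {i j : Λ} (p : Λ → Bool) (w : List Λ) (h' : ¬ p j = true) :
    (lAfter i j w).filter p = w.filter p := by
  induction w with
  | nil => rfl
  | cons a w ih =>
    rw [lAfter] at ih ⊢
    rw [List.flatMap_cons, List.filter_append, ih]
    by_cases ha : a = i
    · subst ha; by_cases hp : p a = true <;> simp [hp, h']
    · by_cases hp : p a = true <;> simp [ha, hp]

end Words

/-! ### The coefficients of a commutator -/

section Coefficients

variable {K : Type*} [Field K] {Λ : Type} [DecidableEq Λ]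

/-- The value of the functional `(U, V, Z) ↦ w U * η V * [Z = Z₀]` on the normal ordering of
`u(a) v(b) V'(b) a_j ⊗ Z(b)`, in which `a_j` has already been moved to the left through `V'` and
`rv` is the word `v` read backwards. -/
noncomputable def aVal (w η : List Λ → K) (Z₀ : List Λ) (j : Λ) :
    (rv u V Z : List Λ) → K
  | [], u, V, Z => if Z = Z₀ then w (u ++ [j]) * η V else 0
  | i :: rv, u, V, Z => aVal w η Z₀ j rv u (i :: V) Z
      - (if Z = Z₀ then (w (lAfter i j u) - w (lBefore i j u)) * η (rv.reverse ++ i :: V) else 0)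
      - (aVal w η Z₀ j rv u V (lBefore j i Z) - aVal w η Z₀ j rv u V (lAfter j i Z))

/-- The part of `aVal` in which `a_j` is never absorbed by one of the letters of `u`. -/
noncomputable def bVal (η : List Λ → K) (Z₀ : List Λ) (j : Λ) : (rv V Z : List Λ) → K
  | [], V, Z => if Z = Z₀ then η V else 0
  | i :: rv, V, Z => bVal η Z₀ j rv (i :: V) Z
      - (bVal η Z₀ j rv V (lBefore j i Z) - bVal η Z₀ j rv V (lAfter j i Z))

theorem aVal_eq_mul_bVal (w η : List Λ → K) (Z₀ : List Λ) (j : Λ) (rv u V Z : List Λ)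
    (hrv : rv.Nodup)
    (h : ∀ i ∈ rv, w (lAfter i j u) = w (lBefore i j u) ∨ (i ∈ Z₀ ∧ i ∉ Z)) :
    aVal w η Z₀ j rv u V Z = w (u ++ [j]) * bVal η Z₀ j rv V Z := by
  induction rv generalizing V Z with
  | nil => simp [aVal, bVal]
  | cons i rv ih =>
    rw [List.nodup_cons] at hrv
    have h0 : (if Z = Z₀ then (w (lAfter i j u) - w (lBefore i j u)) * η (rv.reverse ++ i :: V)
        else 0) = 0 := by
      rcases h i (by simp) with h | ⟨h, h'⟩
      · simp [h]
      · exact if_neg fun e : Z = Z₀ => h' (e ▸ h)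
    have h1 : ∀ Z' : List Λ, (∀ l, l ∈ Z' → l ∈ Z ∨ l = i) →
        ∀ i' ∈ rv, w (lAfter i' j u) = w (lBefore i' j u) ∨ (i' ∈ Z₀ ∧ i' ∉ Z') := by
      intro Z' hZ' i' hi'
      rcases h i' (by simp [hi']) with h | ⟨h, h'⟩
      · exact Or.inl h
      · refine Or.inr ⟨h, fun hm => ?_⟩
        rcases hZ' _ hm with hm | rfl
        exacts [h' hm, hrv.1 hi']
    rw [aVal, bVal, h0, ih _ _ hrv.2 (h1 _ fun l hl => Or.inl hl),
      ih _ _ hrv.2 (h1 _ fun l hl => (mem_lBefore.1 hl).imp_right And.right),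
      ih _ _ hrv.2 (h1 _ fun l hl => (mem_lAfter.1 hl).imp_right And.right)]
    ring

theorem aVal_eq_zero_of_mem (w η : List Λ → K) (Z₀ : List Λ) (j : Λ) (rv u V Z : List Λ)
    (hZ : j ∈ Z) (hZ₀ : j ∉ Z₀) : aVal w η Z₀ j rv u V Z = 0 := by
  induction rv generalizing V Z with
  | nil => exact if_neg fun e : Z = Z₀ => hZ₀ (e ▸ hZ)
  | cons i rv ih =>
    rw [aVal, ih _ _ hZ, ih _ _ (mem_lBefore.2 (Or.inl hZ)), ih _ _ (mem_lAfter.2 (Or.inl hZ)),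
      if_neg fun e : Z = Z₀ => hZ₀ (e ▸ hZ)]
    ring

theorem aVal_congr (w η : List Λ → K) (Z₀ : List Λ) (j : Λ) (rv u u' V Z : List Λ)
    (h0 : w (u ++ [j]) = w (u' ++ [j]))
    (h1 : ∀ i ∈ rv, w (lAfter i j u) - w (lBefore i j u) = w (lAfter i j u') - w (lBefore i j u')) :
    aVal w η Z₀ j rv u V Z = aVal w η Z₀ j rv u' V Z := by
  induction rv generalizing V Z with
  | nil => simp [aVal, h0]
  | cons i rv ih =>
    have h2 := fun V Z => ih V Z fun i' hi' => h1 i' (by simp [hi'])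
    rw [aVal, aVal, h2, h2, h2, h1 i (by simp)]

theorem bVal_eq_zero (η : List Λ → K) (Z₀ : List Λ) (j : Λ) (rv V P Q : List Λ)
    (hP : j ∉ P) (hQ : j ∉ Q) (hrv : j ∉ rv) (h : ∀ P' Q', Z₀ ≠ P ++ P' ++ j :: (Q' ++ Q)) :
    bVal η Z₀ j rv V (P ++ j :: Q) = 0 := by
  induction rv generalizing V P Q with
  | nil => exact if_neg fun e => h [] [] (by simpa using e.symm)
  | cons i rv ih =>
    rw [List.mem_cons, not_or] at hrv
    rw [bVal, lBefore_split hP hQ, lAfter_split hP hQ, ih _ _ _ hP hQ hrv.2 h]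
    have e1 : P ++ i :: j :: Q = (P ++ [i]) ++ j :: Q := by simp
    rw [e1, ih _ (P ++ [i]) Q (by simp [hP, hrv.1]) hQ hrv.2
      (fun P' Q' e => h (i :: P') Q' (by simpa using e)),
      ih _ P (i :: Q) hP (by simp [hQ, hrv.1]) hrv.2
      (fun P' Q' e => h P' (Q' ++ [i]) (by simpa using e))]
    ring

/-- The letters which end up before (after) `b_j` in the second tensor factor are those which
precede (follow) `j` in `Z₀`.  The former have to be taken from `v` in the reverse order, since
`a_j` meets the last letter of `v` first. -/
theorem bVal_split (η : List Λ → K) (j : Λ) (rv V P P' Q' Q : List Λ)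
    (hnd : (P ++ P' ++ j :: (Q' ++ Q)).Nodup) (hrv : rv.Nodup) (hj : j ∉ rv) :
    bVal η (P ++ P' ++ j :: (Q' ++ Q)) j rv V (P ++ j :: Q) =
      if rv.filter (· ∈ P') = P' ∧ rv.filter (· ∈ Q') = Q'.reverse then
        (-1) ^ P'.length * η ((rv.filter fun l => l ∉ P' ∧ l ∉ Q').reverse ++ V) else 0 := by
  induction rv generalizing V P P' Q' Q with
  | nil =>
    by_cases h : P' = [] ∧ Q' = []
    · obtain ⟨rfl, rfl⟩ := h; simp [bVal]
    · rw [if_neg, bVal, if_neg]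
      · intro e
        have := congrArg List.length e
        simp only [List.length_append, List.length_cons] at this
        exact h ⟨List.length_eq_zero_iff.1 (by omega), List.length_eq_zero_iff.1 (by omega)⟩
      · rintro ⟨h1, h2⟩
        exact h ⟨h1.symm, by simpa using h2.symm⟩
  | cons i rv ih =>
    have hd : j ∉ P ∧ j ∉ P' ∧ j ∉ Q' ∧ j ∉ Q ∧ (∀ l ∈ P', l ∉ Q' ++ Q) := by
      simp only [List.nodup_append, List.nodup_cons, List.mem_append, List.mem_cons] at hnd
      grind
    obtain ⟨hP, hP', hQ', hQ, hPQ⟩ := hd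
    rw [List.mem_cons, not_or] at hj
    rw [List.nodup_cons] at hrv
    have e1 : P ++ i :: j :: Q = (P ++ [i]) ++ j :: Q := by simp
    have hPi : j ∉ P ++ [i] := by simp [hP, hj.1]
    have hQi : j ∉ i :: Q := by simp [hQ, hj.1]
    rw [bVal, lBefore_split hP hQ, lAfter_split hP hQ, e1, ih (i :: V) P P' Q' Q hnd hrv.2 hj.2]
    by_cases hiP : i ∈ P'
    · have hiQ : i ∉ Q' := fun h => hPQ i hiP (by simp [h])
      rw [bVal_eq_zero η _ j rv V P (i :: Q) hP hQi hj.2 fun P'' Q'' e => ?_]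
      swap
      · have h1 := (split_unique hnd e).2
        exact hPQ i hiP (by rw [h1]; simp)
      rw [if_neg fun h => ?_]
      swap
      · have : i ∈ rv.filter (· ∈ P') := by rw [h.1]; exact hiP
        exact hrv.1 (List.mem_filter.1 this).1
      obtain ⟨a, P'', rfl⟩ := List.exists_cons_of_ne_nil (List.ne_nil_of_mem hiP)
      by_cases ha : i = a
      · subst ha
        have e2 : P ++ i :: P'' = (P ++ [i]) ++ P'' := by simp
        rw [e2] at hnd ⊢
        rw [ih V (P ++ [i]) P'' Q' Q hnd hrv.2 hj.2]
        have h1 : rv.filter (· ∈ i :: P'') = rv.filter (· ∈ P'') := by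
          refine List.filter_congr fun l hl => ?_
          have : l ≠ i := fun e => hrv.1 (e ▸ hl)
          simp [this]
        have h2 : (rv.filter fun l => l ∉ i :: P'' ∧ l ∉ Q') =
            rv.filter fun l => l ∉ P'' ∧ l ∉ Q' := by
          refine List.filter_congr fun l hl => ?_
          have : l ≠ i := fun e => hrv.1 (e ▸ hl)
          simp [this]
        rw [List.filter_cons_of_pos (by simp), List.filter_cons_of_neg (by simpa using hiQ),
          List.filter_cons_of_neg (by simp), h1, h2, List.length_cons, pow_succ]
        simp only [List.cons.injEq, true_and]
        split_ifs <;> ring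
      · rw [bVal_eq_zero η _ j rv V (P ++ [i]) Q hPi hQ hj.2 fun P₁ Q₁ e => ?_, if_neg fun h => ?_]
        · ring
        · rw [List.filter_cons_of_pos (by simpa using hiP)] at h
          exact ha (List.cons.inj h.1).1
        · have h1 := (split_unique hnd e).1
          simp only [List.append_assoc, List.cons_append, List.nil_append,
            List.append_cancel_left_eq, List.cons.injEq] at h1
          exact ha h1.1.symm
    · rw [bVal_eq_zero η _ j rv V (P ++ [i]) Q hPi hQ hj.2 fun P₁ Q₁ e => ?_]
      swap
      · have h1 := (split_unique hnd e).1
        simp only [List.append_assoc, List.cons_append, List.nil_append,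
            List.append_cancel_left_eq] at h1
        exact hiP (by rw [h1]; simp)
      by_cases hiQ : i ∈ Q'
      · rw [if_neg fun h => ?_]
        swap
        · have : i ∈ rv.filter (· ∈ Q') := by rw [h.2]; exact List.mem_reverse.2 hiQ
          exact hrv.1 (List.mem_filter.1 this).1
        rcases List.eq_nil_or_concat' Q' with rfl | ⟨Q'', a, rfl⟩
        · simp at hiQ
        by_cases ha : i = a
        · subst ha
          have e2 : Q'' ++ [i] ++ Q = Q'' ++ (i :: Q) := by simp
          rw [e2] at hnd ⊢
          rw [ih V P P' Q'' (i :: Q) hnd hrv.2 hj.2]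
          have h1 : rv.filter (· ∈ Q'' ++ [i]) = rv.filter (· ∈ Q'') := by
            refine List.filter_congr fun l hl => ?_
            have : l ≠ i := fun e => hrv.1 (e ▸ hl)
            simp [this]
          have h2 : (rv.filter fun l => l ∉ P' ∧ l ∉ Q'' ++ [i]) =
              rv.filter fun l => l ∉ P' ∧ l ∉ Q'' := by
            refine List.filter_congr fun l hl => ?_
            have : l ≠ i := fun e => hrv.1 (e ▸ hl)
            simp [this]
          rw [List.filter_cons_of_neg (by simpa using hiP), List.filter_cons_of_pos (by simp),
            List.filter_cons_of_neg (by simp), h1, h2, List.reverse_append]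
          simp only [List.reverse_singleton, List.singleton_append, List.cons.injEq, true_and]
          ring
        · rw [bVal_eq_zero η _ j rv V P (i :: Q) hP hQi hj.2 fun P₁ Q₁ e => ?_, if_neg fun h => ?_]
          · ring
          · have h2 := h.2
            rw [List.filter_cons_of_pos (by simpa using hiQ), List.reverse_append] at h2
            exact ha (List.cons.inj h2).1
          · have h1 := (split_unique hnd e).2
            have e3 : Q₁ ++ i :: Q = (Q₁ ++ [i]) ++ Q := by simp
            rw [e3] at h1
            have h2 := List.append_cancel_right h1
            have h3 := List.append_inj_right' h2 rfl
            exact ha (List.cons.inj h3).1.symm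
      · rw [bVal_eq_zero η _ j rv V P (i :: Q) hP hQi hj.2 fun P₁ Q₁ e => ?_]
        · rw [List.filter_cons_of_neg (by simpa using hiP),
            List.filter_cons_of_neg (by simpa using hiQ),
            List.filter_cons_of_pos (by simp [hiP, hiQ])]
          simp
        · have h1 := (split_unique hnd e).2
          have e3 : Q₁ ++ i :: Q = (Q₁ ++ [i]) ++ Q := by simp
          rw [e3] at h1
          exact hiQ (by rw [List.append_cancel_right h1]; simp)

end Coefficients

/-! ### Colourings of the letters -/

section Colourings

variable {Λ : Type}

/-- The family of the subwords of `u` formed by the letters of a given colour.  Two words without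
repetitions have the same family if and only if they are shuffles of the same words, one for each
colour. -/
def key (α : Λ → ℕ) (u : List Λ) (s : ℕ) : List Λ := u.filter fun l => α l = s

theorem key_append (α : Λ → ℕ) (u v : List Λ) (s : ℕ) :
    key α (u ++ v) s = key α u s ++ key α v s := List.filter_append ..

theorem mem_key {α : Λ → ℕ} {u : List Λ} {s : ℕ} {l : Λ} : l ∈ key α u s ↔ l ∈ u ∧ α l = s := by
  simp [key]

theorem key_const (u : List Λ) : key (fun _ => 0) u 0 = u := by simp [key]

variable [DecidableEq Λ]

/-- Give the colour `0` to the letters in `T`, and shift all other colours by one. -/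
def recolour (T : List Λ) (α : Λ → ℕ) (l : Λ) : ℕ := if l ∈ T then 0 else α l + 1

theorem recolour_eq_succ {T : List Λ} {α : Λ → ℕ} {l : Λ} {s : ℕ} :
    recolour T α l = s + 1 ↔ l ∉ T ∧ α l = s := by
  unfold recolour; split_ifs with h <;> simp [h]

theorem recolour_eq_zero {T : List Λ} {α : Λ → ℕ} {l : Λ} : recolour T α l = 0 ↔ l ∈ T := by
  unfold recolour; split_ifs with h <;> simp [h]

theorem key_recolour_succ {T : List Λ} (α : Λ → ℕ) (u : List Λ) (s : ℕ) (h : ∀ l ∈ u, l ∉ T) :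
    key (recolour T α) u (s + 1) = key α u s :=
  List.filter_congr fun l hl => by simp [recolour_eq_succ, h l hl]

variable [Fintype Λ]

/-- The number of colours of the letters other than `j`. -/
def numColours (j : Λ) (α : Λ → ℕ) : ℕ := ((Finset.univ.erase j).image α).card

theorem numColours_lt {j j' : Λ} {α : Λ → ℕ} {T : List Λ} (hT : ∃ y ∈ T, y ≠ j')
    (h : ∀ l, l ≠ j → ∃ l', l' ≠ j' ∧ l' ∉ T ∧ α l' = α l) :
    numColours j α < numColours j' (recolour T α) := by
  have h1 : insert 0 (((Finset.univ.erase j).image α).image (· + 1)) ⊆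
      (Finset.univ.erase j').image (recolour T α) := by
    intro s hs
    rw [Finset.mem_insert] at hs
    rcases hs with rfl | hs
    · obtain ⟨y, hy, hj⟩ := hT
      exact Finset.mem_image.2 ⟨y, by simp [hj], recolour_eq_zero.2 hy⟩
    · obtain ⟨t, ht, rfl⟩ := Finset.mem_image.1 hs
      obtain ⟨l, hl, rfl⟩ := Finset.mem_image.1 ht
      obtain ⟨l', h1, h2, h3⟩ := h l (by simpa using hl)
      exact Finset.mem_image.2 ⟨l', by simp [h1], recolour_eq_succ.2 ⟨h2, h3⟩⟩
  have h2 := Finset.card_le_card h1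
  rw [Finset.card_insert_of_notMem (by simp),
    Finset.card_image_of_injective _ (add_left_injective 1)] at h2
  exact h2

theorem numColours_le {j x : Λ} {α : Λ → ℕ} {T : List Λ} (hT : ∃ y ∈ T, y ≠ x) (hx : x ≠ j)
    (h : ∀ l, l ≠ j → α l ≠ α x → l ∉ T) :
    numColours j α ≤ numColours x (recolour T α) := by
  have h1 : insert 0 ((((Finset.univ.erase j).image α).erase (α x)).image (· + 1)) ⊆
      (Finset.univ.erase x).image (recolour T α) := by
    intro s hs
    rw [Finset.mem_insert] at hs
    rcases hs with rfl | hs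
    · obtain ⟨y, hy, hj⟩ := hT
      exact Finset.mem_image.2 ⟨y, by simp [hj], recolour_eq_zero.2 hy⟩
    · obtain ⟨t, ht, rfl⟩ := Finset.mem_image.1 hs
      obtain ⟨htx, ht⟩ := Finset.mem_erase.1 ht
      obtain ⟨l, hl, rfl⟩ := Finset.mem_image.1 ht
      refine Finset.mem_image.2 ⟨l, ?_, recolour_eq_succ.2 ⟨h l (by simpa using hl) htx, rfl⟩⟩
      simp only [Finset.mem_erase, Finset.mem_univ, and_true]
      rintro rfl
      exact htx rfl
  have h2 := Finset.card_le_card h1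
  rw [Finset.card_insert_of_notMem (by simp),
    Finset.card_image_of_injective _ (add_left_injective 1),
    Finset.card_erase_add_one (Finset.mem_image.2 ⟨x, by simp [hx], rfl⟩)] at h2
  exact h2

theorem numColours_le_card (j : Λ) (α : Λ → ℕ) : numColours j α ≤ Fintype.card Λ :=
  Finset.card_image_le.trans (Finset.card_le_univ _)

end Colourings

/-! ### Functions on words which are invariant under reordering of colours -/

section Sums

theorem sum_eq_zero_of_mapDomain {K X Y : Type*} [Field K] (f : X →₀ K) (g : X → Y)
    (h : Finsupp.mapDomain g f = 0) (N : X → K)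
    (hN : ∀ x ∈ f.support, ∀ x' ∈ f.support, g x = g x' → N x = N x') :
    (f.sum fun x a => a * N x) = 0 := by
  classical
  let M : Y → K := fun y => if hy : ∃ x ∈ f.support, g x = y then N hy.choose else 0
  have h1 : (f.sum fun x a => a * N x) = f.sum fun x a => a * M (g x) := by
    refine Finset.sum_congr rfl fun x hx => ?_
    have hy : ∃ x' ∈ f.support, g x' = g x := ⟨x, hx, rfl⟩
    have h2 : M (g x) = N hy.choose := dif_pos hy
    dsimp only
    rw [h2, hN x hx _ hy.choose_spec.1 hy.choose_spec.2.symm]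
  have h2 := Finsupp.sum_mapDomain_index (f := g) (s := f) (h := fun y a => a * M y)
    (fun _ => zero_mul _) fun _ _ _ => add_mul _ _ _
  rw [h1, ← h2, h, Finsupp.sum_zero_index]

open Classical in
theorem mapDomain_apply_eq_sum {K X Y : Type*} [Field K] (f : X →₀ K) (g : X → Y) (y : Y) :
    Finsupp.mapDomain g f y = f.sum fun x a => a * if g x = y then 1 else 0 := by
  rw [Finsupp.mapDomain, Finsupp.sum_apply]
  refine Finset.sum_congr rfl fun x _ => ?_
  simp [Finsupp.single_apply]

end Sums

/-! ### The vanishing of the coefficients -/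

section Vanishing

variable {K : Type*} [Field K] {Λ : Type} [DecidableEq Λ]

/-- The equations satisfied by the coefficients of an element
`X = ∑ c j (u, v) u(a) v(b)` such that `X ⊗ 1 + 1 ⊗ X` commutes with `r`.  Here `c j` is supported
on pairs of words in which each letter except `j` occurs exactly once; the spare letter `j` is used
as the summation index of `r`. -/
structure IsCommuting [Fintype Λ] (c : Λ → (List Λ × List Λ) →₀ K) : Prop where
  nodup_fst : ∀ j, ∀ d ∈ (c j).support, d.1.Nodup
  mem_fst : ∀ j, ∀ d ∈ (c j).support, ∀ l, l ∈ d.1 ↔ l ≠ j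
  nodup_snd : ∀ j, ∀ d ∈ (c j).support, d.2.Nodup
  mem_snd : ∀ j, ∀ d ∈ (c j).support, ∀ l, l ∈ d.2 ↔ l ≠ j
  map_perm : ∀ (σ : Equiv.Perm Λ) j u v, c (σ j) (u.map σ, v.map σ) = c j (u, v)
  relation : ∀ (w η : List Λ → K) (Z₀ : List Λ), 2 ≤ Z₀.length →
    (η [] = 0 ∨ ∃ y, ∀ U U' : List Λ, U.filter (· ≠ y) = U'.filter (· ≠ y) → w U = w U') →
    ∑ j, (c j).sum (fun d a => a * aVal w η Z₀ j d.2.reverse d.1 [] [j]) = 0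

/-- The sums of the coefficients over all pairs of shuffles with respect to two colourings
vanish. -/
def Vanishes (c : Λ → (List Λ × List Λ) →₀ K) (j : Λ) (α β : Λ → ℕ) : Prop :=
  Finsupp.mapDomain (fun d => (key α d.1, key β d.2)) (c j) = 0

open Classical in
/-- The indicator function of the words which are, up to the position of `y`, shuffles of the same
words as `u₀`. -/
noncomputable def shuffleInd (K : Type*) [Field K] (y : Λ) (α : Λ → ℕ) (u₀ U : List Λ) : K :=
  if (fun s => key (recolour [y] α) U (s + 1)) = key α u₀ then 1 else 0

theorem shuffleInd_congr {y : Λ} {α : Λ → ℕ} {u₀ U U' : List Λ}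
    (h : ∀ s, key (recolour [y] α) U (s + 1) = key (recolour [y] α) U' (s + 1)) :
    shuffleInd K y α u₀ U = shuffleInd K y α u₀ U' := by
  rw [shuffleInd, shuffleInd, funext h]

theorem shuffleInd_filter {y : Λ} {α : Λ → ℕ} {u₀ U U' : List Λ}
    (h : U.filter (· ≠ y) = U'.filter (· ≠ y)) :
    shuffleInd K y α u₀ U = shuffleInd K y α u₀ U' := by
  refine shuffleInd_congr fun s => ?_
  have h1 : ∀ V : List Λ, key (recolour [y] α) V (s + 1) =
      key (recolour [y] α) (V.filter (· ≠ y)) (s + 1) := by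
    intro V
    rw [key, key, List.filter_filter]
    refine List.filter_congr fun l _ => ?_
    by_cases hl : l = y
    · subst hl; simp [recolour]
    · simp [hl]
  rw [h1 U, h1 U', h]

/-- A letter `j` which shares no colour with `i` may be inserted on either side of `i`. -/
theorem shuffleInd_lAfter_eq_lBefore {y : Λ} {α : Λ → ℕ} {u₀ u : List Λ} {i j : Λ}
    (h : i = y ∨ j = y ∨ α i ≠ α j) :
    shuffleInd K y α u₀ (lAfter i j u) = shuffleInd K y α u₀ (lBefore i j u) := by
  refine shuffleInd_congr fun s => filter_lAfter_eq_filter_lBefore _ _ ?_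
  simp only [decide_eq_true_eq, recolour_eq_succ, List.mem_singleton]
  rintro ⟨⟨h1, h2⟩, h3, h4⟩
  rcases h with h | h | h
  exacts [h1 h, h3 h, h (h2.trans h4.symm)]

theorem shuffleInd_append_congr {y : Λ} {α : Λ → ℕ} {u₀ u u' : List Λ} {j : Λ}
    (h : key (recolour [y] α) u = key (recolour [y] α) u') :
    shuffleInd K y α u₀ (u ++ [j]) = shuffleInd K y α u₀ (u' ++ [j]) :=
  shuffleInd_congr fun s => by rw [key_append, key_append, h]

theorem shuffleInd_sub_congr {y : Λ} {α : Λ → ℕ} {u₀ u u' : List Λ} {i j : Λ}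
    (h : key (recolour [y] α) u = key (recolour [y] α) u') :
    shuffleInd K y α u₀ (lAfter i j u) - shuffleInd K y α u₀ (lBefore i j u) =
      shuffleInd K y α u₀ (lAfter i j u') - shuffleInd K y α u₀ (lBefore i j u') := by
  by_cases hc : i = y ∨ j = y ∨ α i ≠ α j
  · rw [shuffleInd_lAfter_eq_lBefore hc, shuffleInd_lAfter_eq_lBefore hc, sub_self, sub_self]
  · have hc' : i ≠ y ∧ j ≠ y ∧ α i = α j := by
      simpa only [not_or, ne_eq, not_not] using hc
    have h1 : ∀ V s, key (recolour [y] α) (lAfter i j V) (s + 1) =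
        if α j = s then lAfter i j (key (recolour [y] α) V (s + 1))
        else key (recolour [y] α) V (s + 1) := by
      intro V s
      split_ifs with hs
      · exact filter_lAfter _ _ (by simp [recolour_eq_succ, hc', hs])
          (by simp [recolour_eq_succ, hc', hs])
      · exact filter_lAfter_of_not _ _ (by simp [recolour_eq_succ, hs])
    have h2 : ∀ V s, key (recolour [y] α) (lBefore i j V) (s + 1) =
        if α j = s then lBefore i j (key (recolour [y] α) V (s + 1))
        else key (recolour [y] α) V (s + 1) := by
      intro V s
      split_ifs with hs
      · exact filter_lBefore _ _ (by simp [recolour_eq_succ, hc', hs])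
          (by simp [recolour_eq_succ, hc', hs])
      · rw [key, ← filter_lAfter_eq_filter_lBefore _ _ (by simp [recolour_eq_succ, hs])]
        exact filter_lAfter_of_not _ _ (by simp [recolour_eq_succ, hs])
    congr 1
    · exact shuffleInd_congr fun s => by rw [h1, h1, h]
    · exact shuffleInd_congr fun s => by rw [h2, h2, h]

end Vanishing

theorem filter_eq_singleton {Λ : Type*} [DecidableEq Λ] {p : List Λ} {l₀ : Λ} (hp : p.Nodup)
    (hl : l₀ ∈ p) (q : Λ → Bool) (hq : ∀ l ∈ p, q l = true ↔ l = l₀) : p.filter q = [l₀] := by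
  have h1 : p.filter q = p.filter (· = l₀) :=
    List.filter_congr fun l hl => by rw [Bool.eq_iff_iff, hq l hl]; simp
  rw [h1, List.filter_eq, List.count_eq_one_of_mem hp hl]
  rfl

section Vanishing

variable {K : Type*} [Field K] {Λ : Type}

variable {c : Λ → (List Λ × List Λ) →₀ K}

theorem Vanishes.sum_eq_zero {j : Λ} {α β : Λ → ℕ} (h : Vanishes c j α β)
    (N : List Λ × List Λ → K)
    (hN : ∀ d ∈ (c j).support, ∀ d' ∈ (c j).support, key α d.1 = key α d'.1 →
      key β d.2 = key β d'.2 → N d = N d') :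
    ((c j).sum fun d a => a * N d) = 0 :=
  sum_eq_zero_of_mapDomain _ _ h N fun d hd d' hd' e =>
    hN d hd d' hd' (congrArg Prod.fst e) (congrArg Prod.snd e)

variable [DecidableEq Λ] [Fintype Λ]

/-- The sum of all coefficients `c y (u, v)` vanishes.  The equation used is the one for words in
which `z` precedes `y` in the first factor, and the second factor is `b_z b_y`. -/
theorem IsCommuting.sum_eq_zero (hc : IsCommuting c) (hcard : 3 ≤ Fintype.card Λ) (y : Λ) :
    ((c y).sum fun _ a => a) = 0 := by
  classical
  obtain ⟨z, hzy⟩ : ∃ z, z ≠ y := Fintype.exists_ne_of_one_lt_card (by omega) y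
  set w : List Λ → K := fun U => if U.filter (fun l => l = z ∨ l = y) = [z, y] then 1 else 0
    with hw
  set η : List Λ → K := fun V => if V = [] then 0 else 1 with hη
  have hrel := hc.relation w η [z, y] le_rfl (Or.inl (if_pos rfl))
  have hins : ∀ i j u, ¬ ((i = z ∨ i = y) ∧ (j = z ∨ j = y)) →
      w (lAfter i j u) = w (lBefore i j u) := by
    intro i j u h
    simp only [hw]
    rw [filter_lAfter_eq_filter_lBefore _ _ (by simpa only [decide_eq_true_eq] using h)]
  rw [Finset.sum_eq_single_of_mem y (Finset.mem_univ y)] at hrel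
  · rw [← neg_eq_zero, ← hrel, Finsupp.sum, Finsupp.sum, ← Finset.sum_neg_distrib]
    refine Finset.sum_congr rfl fun d hd => ?_
    have hmem := hc.mem_snd y d hd
    have hnd := hc.nodup_snd y d hd
    rw [aVal_eq_mul_bVal _ _ _ _ _ _ _ _ (List.nodup_reverse.2 hnd)]
    · have hb := bVal_split η y d.2.reverse [] [] [z] [] [] (by simp [hzy])
        (List.nodup_reverse.2 hnd) (by simp [hmem])
      simp only [List.nil_append, List.append_nil, List.singleton_append] at hb
      have h1 : d.2.reverse.filter (· ∈ [z]) = [z] :=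
        filter_eq_singleton (List.nodup_reverse.2 hnd) (by simp [hmem, hzy]) _ (by simp)
      have h2 : d.1.filter (fun l => l = z ∨ l = y) = [z] :=
        filter_eq_singleton (hc.nodup_fst y d hd) ((hc.mem_fst y d hd z).2 hzy) _ fun l hl => by
          simp [(hc.mem_fst y d hd l).1 hl]
      obtain ⟨x, hx⟩ : ∃ x, x ∉ ({z, y} : Finset Λ) := by
        by_contra! h
        have := Finset.card_le_card (fun x _ => h x : (Finset.univ : Finset Λ) ⊆ {z, y})
        rw [Finset.card_univ] at this
        have := this.trans Finset.card_le_two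
        omega
      simp only [Finset.mem_insert, Finset.mem_singleton, not_or] at hx
      have h3 : (d.2.reverse.filter fun l => l ∉ [z] ∧ l ∉ ([] : List Λ)).reverse ≠ [] := by
        refine List.ne_nil_of_mem (a := x) ?_
        simp [hmem, hx]
      rw [hb, if_pos ⟨h1, by simp⟩]
      simp only [hw, hη, if_neg h3, List.filter_append, h2]
      simp
    · intro i hi
      by_cases hiz : i = z
      · exact Or.inr ⟨by simp [hiz], by simp [hiz, hzy]⟩
      · have hiy : i ≠ y := (hmem i).1 (List.mem_reverse.1 hi)
        exact Or.inl (hins i y d.1 (by simp [hiz, hiy]))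
  -- For `j ≠ y` only `j = z` is possible, as `b_j` stays in the second factor; then `a_z` is put at
  -- the end of a word containing `y`, and `z` does not precede `y`.
  · intro j _ hjy
    refine Finset.sum_eq_zero fun d hd => ?_
    dsimp only
    by_cases hjz : j = z
    · subst hjz
      rw [aVal_eq_mul_bVal _ _ _ _ _ _ _ _ (List.nodup_reverse.2 (hc.nodup_snd j d hd))]
      · have h2 : d.1.filter (fun l => l = j ∨ l = y) = [y] :=
          filter_eq_singleton (hc.nodup_fst j d hd) ((hc.mem_fst j d hd y).2 hjy.symm) _
            fun l hl => by
            simp [(hc.mem_fst j d hd l).1 hl]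
        have h3 : w (d.1 ++ [j]) = 0 := by
          simp only [hw, List.filter_append, h2]
          simp [hjy.symm]
        rw [h3]; ring
      · intro i hi
        by_cases hiy : i = y
        · exact Or.inr ⟨by simp [hiy], by simp [hiy, hjy.symm]⟩
        · have hij : i ≠ j := (hc.mem_snd j d hd i).1 (List.mem_reverse.1 hi)
          exact Or.inl (hins i j d.1 (by simp [hij, hiy]))
    · rw [aVal_eq_zero_of_mem _ _ _ _ _ _ _ _ (by simp) (by simp [hjy, hjz]), mul_zero]

/-- If all letters have different colours in the first words, then the sums in question do not
depend on the second words, because of the symmetry under renaming. -/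
theorem IsCommuting.vanishes_of_injective [CharZero K] (hc : IsCommuting c)
    (hcard : 3 ≤ Fintype.card Λ) (y : Λ) (α β : Λ → ℕ)
    (hα : ∀ l l', l ≠ y → l' ≠ y → α l = α l' → l = l') : Vanishes c y α β := by
  classical
  -- For an injective colouring, all first words have the same key, so that only the sums `m v` of
  -- the coefficients over all first words matter.
  set m := Finsupp.mapDomain Prod.snd (c y) with hm
  have htot : (m.sum fun _ a => a) = 0 := by
    rw [hm, Finsupp.sum_mapDomain_index (fun _ => rfl) fun _ _ _ => rfl]
    exact hc.sum_eq_zero hcard y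
  have hperm : ∀ σ : Equiv.Perm Λ, σ y = y → ∀ v, m (v.map σ) = m v := by
    intro σ hσ v
    have hcσ : Finsupp.mapDomain (fun d : List Λ × List Λ => (d.1.map σ, d.2.map σ)) (c y) =
        c y := by
      ext d
      have hinj : Function.Injective
          fun d : List Λ × List Λ => (d.1.map σ, d.2.map σ) := fun d d' e => by
        simp only [Prod.mk.injEq, List.map_inj_right σ.injective] at e
        exact Prod.ext e.1 e.2
      have hd : d = ((d.1.map σ.symm).map σ, (d.2.map σ.symm).map σ) := by
        simp [List.map_map, Function.comp_def]
      have h1 := hc.map_perm σ y (d.1.map σ.symm) (d.2.map σ.symm)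
      rw [hσ, ← hd] at h1
      rw [h1]
      conv_lhs => rw [hd]
      exact Finsupp.mapDomain_apply hinj _ (d.1.map σ.symm, d.2.map σ.symm)
    have h2 : m = Finsupp.mapDomain (List.map σ) m := by
      conv_lhs => rw [hm, ← hcσ]
      rw [hm, ← Finsupp.mapDomain_comp, ← Finsupp.mapDomain_comp]
      rfl
    conv_lhs => rw [h2]
    exact Finsupp.mapDomain_apply (List.map_injective_iff.2 σ.injective) _ _
  have hsupp : ∀ v ∈ m.support, v.Nodup ∧ ∀ l, l ∈ v ↔ l ≠ y := by
    intro v hv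
    obtain ⟨d, hd, rfl⟩ := Finset.mem_image.1 (Finsupp.mapDomain_support hv)
    exact ⟨hc.nodup_snd y d hd, hc.mem_snd y d hd⟩
  -- Any two words in the support differ by a renaming that fixes `y`.
  have hconst : ∀ v ∈ m.support, ∀ v' ∈ m.support, m v = m v' := by
    intro v hv v' hv'
    obtain ⟨h1, h2⟩ := hsupp v hv
    obtain ⟨h3, h4⟩ := hsupp v' hv'
    have hy : y ∉ v := by simp [h2]
    have hy' : y ∉ v' := by simp [h4]
    have hlen : v.length = v'.length :=
      (List.Perm.length_eq ((List.perm_ext_iff_of_nodup h1 h3).2 fun l => by rw [h2, h4]))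
    have hall : ∀ l, l ∈ y :: v := fun l => by
      by_cases h : l = y <;> simp [h, h2]
    have hall' : ∀ l, l ∈ y :: v' := fun l => by
      by_cases h : l = y <;> simp [h, h4]
    let e := (List.Nodup.getEquivOfForallMemList (y :: v) (List.nodup_cons.2 ⟨hy, h1⟩) hall)
    let e' := (List.Nodup.getEquivOfForallMemList (y :: v') (List.nodup_cons.2 ⟨hy', h3⟩) hall')
    let σ : Equiv.Perm Λ := e.symm.trans ((finCongr (by simp [hlen])).trans e')
    have hσ : (y :: v).map σ = y :: v' := by
      refine List.ext_getElem (by simp [hlen]) fun n hn hn' => ?_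
      rw [List.getElem_map]
      have : (y :: v)[n]'(by simpa using hn) = e ⟨n, by simpa using hn⟩ := rfl
      rw [this]
      simp only [σ, Equiv.trans_apply, Equiv.symm_apply_apply]
      rfl
    rw [List.map_cons, List.cons.injEq] at hσ
    rw [← hσ.2, hperm σ hσ.1]
  have hm0 : m = 0 := by
    by_contra hne
    obtain ⟨v, hv⟩ := Finsupp.support_nonempty_iff.2 hne
    rw [Finsupp.sum, Finset.sum_congr rfl fun v' hv' => hconst v' hv' v hv, Finset.sum_const,
      nsmul_eq_mul] at htot
    rcases mul_eq_zero.1 htot with h | h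
    · exact Finset.card_ne_zero_of_mem hv (by exact_mod_cast h)
    · exact (Finsupp.mem_support_iff.1 hv) h
  refine Finsupp.ext fun κ => ?_
  rw [mapDomain_apply_eq_sum]
  refine sum_eq_zero_of_mapDomain (c y) Prod.snd hm0 _ fun d hd d' hd' e => ?_
  have hkey : key α d.1 = key α d'.1 := by
    have hk : ∀ d ∈ (c y).support, ∀ s, key α d.1 s =
        if h : ∃ l, l ≠ y ∧ α l = s then [h.choose] else [] := by
      intro d hd s
      split_ifs with h
      · refine filter_eq_singleton (hc.nodup_fst y d hd)
          ((hc.mem_fst y d hd _).2 h.choose_spec.1) _ fun l hl => ?_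
        have hl := (hc.mem_fst y d hd l).1 hl
        rw [decide_eq_true_eq]
        constructor
        · intro e; exact hα _ _ hl h.choose_spec.1 (e.trans h.choose_spec.2.symm)
        · intro e; rw [e]; exact h.choose_spec.2
      · refine List.filter_eq_nil_iff.2 fun l hl e => h ⟨l, (hc.mem_fst y d hd l).1 hl, ?_⟩
        simpa using e
    funext s
    rw [hk d hd, hk d' hd']
  rw [hkey, e]

/-- The inductive step, in the case where the class `γ z` of `z` in the second word ends with `z`,
and the colour of `z` in the first words is shared by another letter.  The equation used is the
one in which the first word is `u₀` with `y` inserted anywhere, and the second factor is the word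
`z γᵒᵖ y`.  Apart from the sum in question, it only involves sums for finer colourings: if the
letter playing the role of `y` is `x` and shares its colour in the first word, then `y` becomes an
additional class there; otherwise, `x` cuts the class `γ z` into two pieces. -/
theorem IsCommuting.sum_shuffles_eq_zero (hc : IsCommuting c) {y z z' : Λ} {α β : Λ → ℕ}
    {u₀ v₀ γ : List Λ} (hzz' : z' ≠ z) (hz'y : z' ≠ y) (hαz : α z' = α z)
    (hd₀ : (u₀, v₀) ∈ (c y).support) (hγ : key β v₀ (β z) = γ ++ [z])
    (ih : ∀ x α' β', numColours y α < numColours x α' ∨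
      (numColours y α ≤ numColours x α' ∧ numColours y β < numColours x β') →
        Vanishes c x α' β') :
    Finsupp.mapDomain (fun d => (key α d.1, key β d.2)) (c y) (key α u₀, key β v₀) = 0 := by
  classical
  set P : List Λ := z :: γ.reverse with hP
  have hPrev : P.reverse = key β v₀ (β z) := by rw [hγ, hP]; simp
  have hPnd : P.Nodup := by
    rw [← List.nodup_reverse, hPrev]; exact (hc.nodup_snd y _ hd₀).filter _
  have hmemP : ∀ l, l ∈ P ↔ l ≠ y ∧ β l = β z := fun l => by
    rw [← List.mem_reverse, hPrev, mem_key]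
    exact and_congr_left fun _ => hc.mem_snd y _ hd₀ l
  have hyP : y ∉ P := fun h => ((hmemP y).1 h).1 rfl
  have hPynd : (P ++ [y]).Nodup := by
    rw [List.nodup_append]
    refine ⟨hPnd, by simp, fun a ha b hb e => ?_⟩
    rw [List.mem_singleton] at hb
    exact hyP (hb ▸ e ▸ ha)
  set w : List Λ → K := shuffleInd K y α u₀ with hw
  set η : List Λ → K := fun V =>
    if key β V = fun s => if s = β z then [] else key β v₀ s then 1 else 0 with hη
  have hrel := hc.relation w η (P ++ [y]) (by simp [hP])
    (Or.inr ⟨y, fun U U' h => shuffleInd_filter h⟩)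
  rw [Finset.sum_eq_single_of_mem y (Finset.mem_univ y)] at hrel
  -- The summand for `y` is, up to sign, the sum in question.
  · have h1 : ((c y).sum fun d a => a * aVal w η (P ++ [y]) y d.2.reverse d.1 [] [y]) =
        (-1) ^ P.length * Finsupp.mapDomain (fun d => (key α d.1, key β d.2)) (c y)
          (key α u₀, key β v₀) := by
      rw [mapDomain_apply_eq_sum, Finsupp.mul_sum]
      refine Finset.sum_congr rfl fun d hd => ?_
      have hmem := hc.mem_snd y d hd
      have hnd := hc.nodup_snd y d hd
      have hb := bVal_split η y d.2.reverse [] [] P [] []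
        (by rw [List.nil_append, List.append_nil]; exact hPynd)
        (List.nodup_reverse.2 hnd) (by simp [hmem])
      simp only [List.nil_append, List.append_nil] at hb
      have hyu : ∀ l ∈ d.1, l ∉ [y] := fun l hl => by
        simpa using (hc.mem_fst y d hd l).1 hl
      have hwu : w (d.1 ++ [y]) = if key α d.1 = key α u₀ then 1 else 0 := by
        rw [hw, shuffleInd]
        refine if_congr ?_ rfl rfl
        have : (fun s => key (recolour [y] α) (d.1 ++ [y]) (s + 1)) = key α d.1 := by
          funext s
          rw [key_append, key_recolour_succ α d.1 s hyu]
          simp [key, recolour]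
        rw [this]
      have hf1 : d.2.reverse.filter (· ∈ P) = (key β d.2 (β z)).reverse := by
        rw [List.filter_reverse, key]
        congr 1
        exact List.filter_congr fun l hl => by simp [hmemP, (hmem l).1 hl]
      have hf2 : (d.2.reverse.filter fun l => l ∉ P ∧ l ∉ ([] : List Λ)).reverse =
          d.2.filter fun l => β l ≠ β z := by
        rw [List.filter_reverse, List.reverse_reverse]
        exact List.filter_congr fun l hl => by simp [hmemP, (hmem l).1 hl]
      have hk : key β (d.2.filter fun l => β l ≠ β z) =
          fun s => if s = β z then [] else key β d.2 s := by
        funext s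
        rw [key, List.filter_filter]
        split_ifs with hs
        · refine List.filter_eq_nil_iff.2 fun l _ => ?_
          simp [hs]
        · refine List.filter_congr fun l _ => ?_
          by_cases hl : β l = s <;> simp [hl, hs]
      have hiff : ((key β d.2 (β z)).reverse = P ∧
          (fun s => if s = β z then [] else key β d.2 s) =
            fun s => if s = β z then [] else key β v₀ s) ↔ key β d.2 = key β v₀ := by
        rw [List.reverse_eq_iff, hPrev]
        constructor
        · rintro ⟨h1, h2⟩
          funext s
          by_cases hs : s = β z
          · rw [hs, h1]
          · simpa [hs] using congrFun h2 s
        · intro h; rw [h]; exact ⟨rfl, rfl⟩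
      dsimp only
      rw [aVal_eq_mul_bVal w _ _ _ _ _ _ _ (List.nodup_reverse.2 hnd)
        fun i _ => Or.inl (shuffleInd_lAfter_eq_lBefore (Or.inr (Or.inl rfl))), hb, hwu, hf1, hf2]
      have h3 : (if (key β d.2 (β z)).reverse = P ∧
          d.2.reverse.filter (· ∈ ([] : List Λ)) = [].reverse then
          (-1) ^ P.length * η (d.2.filter fun l => β l ≠ β z) else 0) =
          (-1) ^ P.length * (if key β d.2 = key β v₀ then 1 else 0 : K) := by
        rw [← if_congr hiff rfl rfl]
        simp only [hη, hk]
        by_cases h4 : (key β d.2 (β z)).reverse = P <;> simp [h4]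
      rw [h3]
      simp only [Prod.mk.injEq]
      by_cases h5 : key α d.1 = key α u₀ <;> by_cases h6 : key β d.2 = key β v₀ <;>
        simp [h5, h6, mul_comm]
    rw [h1] at hrel
    exact (mul_eq_zero.1 hrel).resolve_left (pow_ne_zero _ (by simp))
  · intro x _ hxy
    by_cases hx : ∃ x', x' ≠ x ∧ x' ≠ y ∧ α x' = α x
    -- `x` shares its colour with `x'`: the values only depend on the finer key in which `y` has a
    -- colour of its own.
    · obtain ⟨x', hx'x, hx'y, hαx⟩ := hx
      have hv : Vanishes c x (recolour [y] α) fun _ => 0 := by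
        refine ih _ _ _ (Or.inl (numColours_lt ⟨y, by simp, hxy.symm⟩ fun l hl => ?_))
        by_cases hlx : l = x
        · exact ⟨x', hx'x, by simp [hx'y], by rw [hlx, hαx]⟩
        · exact ⟨l, hlx, by simp [hl], rfl⟩
      refine hv.sum_eq_zero _ fun d hd d' hd' h1 h2 => ?_
      have h3 : d.2 = d'.2 := by
        have := congrFun h2 0
        rwa [key_const, key_const] at this
      rw [h3]
      exact aVal_congr _ _ _ _ _ _ _ _ _ (shuffleInd_append_congr h1)
        fun i _ => shuffleInd_sub_congr h1
    · push Not at hx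
      -- `x` has a colour of its own, and nothing is absorbed: only the second words matter, through
      -- the letters `Pa` and `Pb` of `P` before and after `x`.
      by_cases hxP : x ∈ P
      · have hxz : x ≠ z := fun e => hx z' (e ▸ hzz') hz'y (e ▸ hαz)
        obtain ⟨Pa, Pb, hPab⟩ := List.append_of_mem hxP
        have hPa : ∃ Pa', Pa = z :: Pa' := by
          cases Pa with
          | nil => rw [hP, List.nil_append, List.cons.injEq] at hPab; exact absurd hPab.1.symm hxz
          | cons a Pa' =>
            rw [hP, List.cons_append, List.cons.injEq] at hPab
            exact ⟨Pa', by rw [hPab.1]⟩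
        obtain ⟨Pa', hPa⟩ := hPa
        have hZnd : (Pa ++ x :: (Pb ++ [y])).Nodup := by
          have : Pa ++ x :: (Pb ++ [y]) = P ++ [y] := by rw [hPab]; simp
          rw [this]
          exact hPynd
        have hsep : x ∉ Pa ∧ x ∉ Pb ∧ ∀ l ∈ Pa, l ∉ Pb ++ [y] := by
          simp only [List.nodup_append, List.nodup_cons, List.mem_append, List.mem_cons] at hZnd
          grind
        have hmemPa : ∀ l, l ≠ x → (l ∈ Pa ↔ l ∉ Pb ++ [y] ∧ β l = β z) := by
          intro l hl
          have h1 := hmemP l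
          rw [hPab, List.mem_append, List.mem_cons] at h1
          constructor
          · intro h
            exact ⟨hsep.2.2 l h, (h1.1 (Or.inl h)).2⟩
          · rintro ⟨h2, h3⟩
            rw [List.mem_append, not_or, List.mem_singleton] at h2
            rcases h1.2 ⟨h2.2, h3⟩ with h | h | h
            exacts [h, absurd h hl, absurd h h2.1]
        have hv : Vanishes c x (recolour [y] α) (recolour (Pb ++ [y]) β) := by
          refine ih _ _ _ (Or.inr ⟨numColours_le ⟨y, by simp, hxy.symm⟩ hxy fun l hl _ => by
            simpa using hl, numColours_lt ⟨y, by simp, hxy.symm⟩ fun l hl => ?_⟩)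
          by_cases hlz : β l = β z
          · exact ⟨z, hxz.symm, hsep.2.2 z (by simp [hPa]), hlz.symm⟩
          · refine ⟨l, ?_, ?_, rfl⟩
            · rintro rfl; exact hlz ((hmemP l).1 hxP).2
            · rw [List.mem_append, not_or, List.mem_singleton]
              refine ⟨fun h => hlz ((hmemP l).1 ?_).2, hl⟩
              rw [hPab]; simp [h]
        refine hv.sum_eq_zero _ fun d hd d' hd' h1 h2 => ?_
        have key1 : ∀ d ∈ (c x).support, aVal w η (P ++ [y]) x d.2.reverse d.1 [] [x] =
            w (d.1 ++ [x]) * if (key (recolour (Pb ++ [y]) β) d.2 (β z + 1)).reverse = Pa ∧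
              (key (recolour (Pb ++ [y]) β) d.2 0).reverse = (Pb ++ [y]).reverse then
              (-1) ^ Pa.length * (if (fun s => if s = β z then [] else
                key (recolour (Pb ++ [y]) β) d.2 (s + 1)) =
                  (fun s => if s = β z then [] else key β v₀ s) then 1 else 0 : K) else 0 := by
          intro d hd
          have hmem := hc.mem_snd x d hd
          have hnd := hc.nodup_snd x d hd
          rw [aVal_eq_mul_bVal _ _ _ _ _ _ _ _ (List.nodup_reverse.2 hnd) fun i hi => Or.inl ?_]
          swap
          · refine shuffleInd_lAfter_eq_lBefore ?_
            by_cases hiy : i = y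
            · exact Or.inl hiy
            · exact Or.inr (Or.inr (hx i ((hmem i).1 (List.mem_reverse.1 hi)) hiy))
          congr 1
          have hb := bVal_split η x d.2.reverse [] [] Pa (Pb ++ [y]) []
            (by rw [List.nil_append, List.append_nil]; exact hZnd)
            (List.nodup_reverse.2 hnd) (by simp [hmem])
          simp only [List.nil_append, List.append_nil] at hb
          have hZ : P ++ [y] = Pa ++ x :: (Pb ++ [y]) := by rw [hPab]; simp
          have hf1 : d.2.reverse.filter (· ∈ Pa) =
              (key (recolour (Pb ++ [y]) β) d.2 (β z + 1)).reverse := by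
            rw [List.filter_reverse, key]
            congr 1
            exact List.filter_congr fun l hl => by
              rw [decide_eq_decide, recolour_eq_succ, hmemPa l ((hmem l).1 hl)]
          have hf2 : d.2.reverse.filter (· ∈ Pb ++ [y]) =
              (key (recolour (Pb ++ [y]) β) d.2 0).reverse := by
            rw [List.filter_reverse, key]
            congr 1
            exact List.filter_congr fun l hl => by
              rw [decide_eq_decide, recolour_eq_zero]
          have hf3 : key β (d.2.reverse.filter fun l => l ∉ Pa ∧ l ∉ Pb ++ [y]).reverse =
              fun s => if s = β z then [] else key (recolour (Pb ++ [y]) β) d.2 (s + 1) := by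
            rw [List.filter_reverse, List.reverse_reverse]
            funext s
            rw [key, List.filter_filter]
            split_ifs with hs
            · refine List.filter_eq_nil_iff.2 fun l hl => ?_
              rw [Bool.and_eq_true, decide_eq_true_eq, decide_eq_true_eq,
                hmemPa l ((hmem l).1 hl), hs]
              tauto
            · refine List.filter_congr fun l hl => ?_
              rw [Bool.eq_iff_iff, Bool.and_eq_true, decide_eq_true_eq, decide_eq_true_eq,
                decide_eq_true_eq, hmemPa l ((hmem l).1 hl), recolour_eq_succ]
              constructor
              · rintro ⟨h1, h2, h3⟩; exact ⟨h3, h1⟩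
              · rintro ⟨h1, h2⟩; exact ⟨h2, fun h => hs (h2 ▸ h.2), h1⟩
          rw [hZ, hb, hf1, hf2]
          simp only [hη, hf3]
        rw [key1 d hd, key1 d' hd', hw, shuffleInd_append_congr h1, h2]
      · refine Finset.sum_eq_zero fun d hd => ?_
        dsimp only
        rw [aVal_eq_zero_of_mem _ _ _ _ _ _ _ _ (by simp) (by simp [hxP, hxy]), mul_zero]

/-- The inductive step in general, by induction on the number of letters which follow `z` in its
class.  Making these letters a class of their own expresses the sum in question through sums in
which fewer letters follow `z`. -/
theorem IsCommuting.sum_shuffles_eq_zero_of_append (hc : IsCommuting c) {y z z' : Λ} {α β : Λ → ℕ}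
    (hzy : z ≠ y) (hzz' : z' ≠ z) (hz'y : z' ≠ y) (hαz : α z' = α z)
    (ih : ∀ x α' β', numColours y α < numColours x α' ∨
      (numColours y α ≤ numColours x α' ∧ numColours y β < numColours x β') →
        Vanishes c x α' β')
    (m : ℕ) {u₀ v₀ γ δ : List Λ} (hd₀ : (u₀, v₀) ∈ (c y).support)
    (hγ : key β v₀ (β z) = γ ++ z :: δ) (hm : δ.length = m) :
    Finsupp.mapDomain (fun d => (key α d.1, key β d.2)) (c y) (key α u₀, key β v₀) = 0 := by
  classical
  induction m using Nat.strong_induction_on generalizing u₀ v₀ γ δ with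
  | _ m ihm =>
  by_cases hδ : δ = []
  · subst hδ
    exact hc.sum_shuffles_eq_zero hzz' hz'y hαz hd₀ hγ ih
  have hmem := hc.mem_snd y _ hd₀
  have hnd : (γ ++ z :: δ).Nodup := hγ ▸ (hc.nodup_snd y _ hd₀).filter _
  have hδy : ∀ l ∈ δ, l ≠ y ∧ β l = β z := fun l hl => by
    have : l ∈ key β v₀ (β z) := by rw [hγ]; simp [hl]
    rw [mem_key] at this
    exact ⟨(hmem l).1 this.1, this.2⟩
  have hsep : z ∉ δ ∧ z ∉ γ ∧ ∀ l ∈ γ, l ∉ δ := by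
    simp only [List.nodup_append, List.nodup_cons, List.mem_cons] at hnd
    grind
  have hv : Vanishes c y α (recolour δ β) := by
    obtain ⟨l₀, hl₀⟩ := List.exists_mem_of_ne_nil δ hδ
    refine ih _ _ _ (Or.inr ⟨le_rfl, numColours_lt ⟨l₀, hl₀, (hδy l₀ hl₀).1⟩ fun l hl => ?_⟩)
    by_cases hlz : β l = β z
    · exact ⟨z, hzy, hsep.1, hlz.symm⟩
    · exact ⟨l, hl, fun h => hlz (hδy l h).2, rfl⟩
  have hsum := hv.sum_eq_zero
    (fun d => if key α d.1 = key α u₀ ∧ key (recolour δ β) d.2 = key (recolour δ β) v₀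
      then 1 else 0) fun d _ d' _ h1 h2 => by simp only [h1, h2]
  -- The keys with respect to the finer colouring are functions of the keys with respect to `β`.
  have hfine : ∀ v : List Λ, (∀ l ∈ v, l ≠ y) → key (recolour δ β) v = fun s =>
      match s with
      | 0 => (key β v (β z)).filter (· ∈ δ)
      | s + 1 => (key β v s).filter (· ∉ δ) := by
    intro v hv
    funext s
    cases s with
    | zero =>
      simp only [key, List.filter_filter]
      refine List.filter_congr fun l hl => ?_
      rw [Bool.eq_iff_iff, Bool.and_eq_true, decide_eq_true_eq, decide_eq_true_eq,
        decide_eq_true_eq, recolour_eq_zero]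
      exact ⟨fun h => ⟨h, (hδy l h).2⟩, And.left⟩
    | succ s =>
      simp only [key, List.filter_filter]
      refine List.filter_congr fun l hl => ?_
      rw [Bool.eq_iff_iff, Bool.and_eq_true, decide_eq_true_eq, decide_eq_true_eq,
        decide_eq_true_eq, recolour_eq_succ]
  set F : (ℕ → List Λ) → (ℕ → List Λ) := fun κ s =>
      match s with
      | 0 => (κ (β z)).filter (· ∈ δ)
      | s + 1 => (κ s).filter (· ∉ δ) with hF
  set G := Finsupp.mapDomain (fun d => (key α d.1, key β d.2)) (c y) with hG
  have hsum2 : (G.sum fun κ a => a * if κ.1 = key α u₀ ∧ F κ.2 = F (key β v₀) then 1 else 0) =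
      0 := by
    rw [hG, Finsupp.sum_mapDomain_index (fun _ => zero_mul _) fun _ _ _ => add_mul _ _ _]
    refine Eq.trans ?_ hsum
    refine Finset.sum_congr rfl fun d hd => ?_
    have h1 := hfine d.2 fun l hl => (hc.mem_snd y d hd l).1 hl
    have h2 := hfine v₀ fun l hl => (hmem l).1 hl
    dsimp only
    rw [h1, h2]
  -- All other keys with the same image under `F` have fewer letters after `z`.
  have hzero : ∀ κ ∈ G.support, κ ≠ (key α u₀, key β v₀) →
      κ.1 = key α u₀ ∧ F κ.2 = F (key β v₀) → False := by
    intro κ hκ hne ⟨h1, h2⟩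
    obtain ⟨d, hd, rfl⟩ := Finset.mem_image.1 (Finsupp.mapDomain_support hκ)
    have h0 := congrFun h2 0
    simp only [hF, hγ] at h0
    have h3 := congrFun h2 (β z + 1)
    simp only [hF, hγ] at h3
    have hzd : z ∈ key β d.2 (β z) :=
      mem_key.2 ⟨(hc.mem_snd y d hd z).2 hzy, rfl⟩
    obtain ⟨γ', δ', hd'⟩ := List.append_of_mem hzd
    have hnd' : (γ' ++ z :: δ').Nodup := hd' ▸ (hc.nodup_snd y d hd).filter _
    rw [hd'] at h0 h3
    have hg : γ.filter (· ∉ δ) = γ := List.filter_eq_self.2 fun l hl => by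
      simpa using hsep.2.2 l hl
    have hg' : γ.filter (· ∈ δ) = [] := List.filter_eq_nil_iff.2 fun l hl => by
      simpa using hsep.2.2 l hl
    have hdd : δ.filter (· ∈ δ) = δ := List.filter_eq_self.2 fun l hl => by simpa using hl
    have hdd' : δ.filter (· ∉ δ) = [] := List.filter_eq_nil_iff.2 fun l hl => by simpa using hl
    rw [List.filter_append, List.filter_append, List.filter_cons_of_neg (by simpa using hsep.1),
      List.filter_cons_of_neg (by simpa using hsep.1), hg', hdd, List.nil_append] at h0
    rw [List.filter_append, List.filter_append, List.filter_cons_of_pos (by simpa using hsep.1),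
      List.filter_cons_of_pos (by simpa using hsep.1), hg, hdd'] at h3
    have hnd3 : (γ ++ z :: []).Nodup := by
      rw [← h3]
      refine List.Nodup.sublist ?_ hnd'
      exact List.Sublist.append List.filter_sublist (List.Sublist.cons_cons _ List.filter_sublist)
    obtain ⟨h4, h5⟩ := split_unique hnd3 h3.symm
    have hδ' : δ'.filter (· ∈ δ) = δ' := List.filter_eq_self.2 fun l hl => by
      have := List.filter_eq_nil_iff.1 h5.symm l hl
      simpa using this
    rw [hδ'] at h0
    by_cases hlen : δ'.length < m
    · have := ihm δ'.length hlen (u₀ := d.1) (v₀ := d.2) hd hd' rfl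
      exact (Finsupp.mem_support_iff.1 hκ) this
    · have h6 := congrArg List.length h0
      rw [List.length_append, hm] at h6
      have h7 : γ'.filter (· ∈ δ) = [] := List.length_eq_zero_iff.1 (by omega)
      have h8 : γ'.filter (· ∉ δ) = γ' := List.filter_eq_self.2 fun l hl => by
        have := List.filter_eq_nil_iff.1 h7 l hl
        simpa using this
      rw [h7, List.nil_append] at h0
      rw [h8] at h4
      refine hne (Prod.ext h1 (funext fun s => ?_))
      by_cases hs : s = β z
      · subst hs
        change key β d.2 (β z) = key β v₀ (β z)
        rw [hd', hγ, h4, h0]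
      · have h9 := congrFun h2 (s + 1)
        have h10 : ∀ v : List Λ, (key β v s).filter (· ∉ δ) = key β v s := fun v =>
          List.filter_eq_self.2 fun l hl => by
            have := (mem_key.1 hl).2
            simp only [decide_eq_true_eq]
            exact fun h => hs (this ▸ (hδy l h).2)
        simp only [hF, h10] at h9
        exact h9
  by_contra hne
  refine hne ?_
  rw [← hsum2, Finsupp.sum, Finset.sum_eq_single (key α u₀, key β v₀)]
  · simp
  · intro κ hκ hκne
    rw [if_neg fun h => hzero κ hκ hκne h, mul_zero]
  · intro h
    rw [Finsupp.notMem_support_iff.1 h, zero_mul]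

theorem IsCommuting.vanishes [CharZero K] (hc : IsCommuting c) (hcard : 3 ≤ Fintype.card Λ)
    (y : Λ) (α β : Λ → ℕ) : Vanishes c y α β := by
  classical
  -- Lexicographic induction: downwards on the numbers of colours.
  obtain ⟨m, hm⟩ : ∃ m, m = Fintype.card Λ - numColours y α := ⟨_, rfl⟩
  obtain ⟨n, hn⟩ : ∃ n, n = Fintype.card Λ - numColours y β := ⟨_, rfl⟩
  induction m using Nat.strong_induction_on generalizing y α β n with
  | _ m ihm =>
  induction n using Nat.strong_induction_on generalizing y α β with
  | _ n ihn =>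
  by_cases hα : ∀ l l', l ≠ y → l' ≠ y → α l = α l' → l = l'
  · exact hc.vanishes_of_injective hcard y α β hα
  push Not at hα
  obtain ⟨z, z', hzy, hz'y, hαz, hne⟩ := hα
  have ih : ∀ x α' β', numColours y α < numColours x α' ∨
      (numColours y α ≤ numColours x α' ∧ numColours y β < numColours x β') →
        Vanishes c x α' β' := by
    intro x α' β' h
    have h1 := numColours_le_card x α'
    have h2 := numColours_le_card x β'
    by_cases hlt : numColours y α < numColours x α'
    · exact ihm _ (by omega) x α' β' rfl _ rfl
    · exact ihn (Fintype.card Λ - numColours x β') (by omega) x α' β' (by omega) rfl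
  -- A nonzero sum would belong to some pair of words of the support.
  by_contra hv
  obtain ⟨κ, hκ⟩ := Finsupp.support_nonempty_iff.2 hv
  obtain ⟨d, hd, rfl⟩ := Finset.mem_image.1 (Finsupp.mapDomain_support hκ)
  have hz : z ∈ key β d.2 (β z) := mem_key.2 ⟨(hc.mem_snd y d hd z).2 hzy, rfl⟩
  obtain ⟨γ, δ, hγ⟩ := List.append_of_mem hz
  exact (Finsupp.mem_support_iff.1 hκ) (hc.sum_shuffles_eq_zero_of_append (u₀ := d.1) (v₀ := d.2)
    hzy hne.symm hz'y hαz.symm ih _ hd hγ rfl)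

theorem IsCommuting.eq_zero [CharZero K] (hc : IsCommuting c) (hcard : 3 ≤ Fintype.card Λ)
    (j : Λ) : c j = 0 := by
  have h := hc.vanishes hcard j (fun _ => 0) fun _ => 0
  have hinj : Function.Injective fun d : List Λ × List Λ =>
      (key (fun _ => 0) d.1, key (fun _ => 0) d.2) := by
    intro d d' e
    simp only [Prod.mk.injEq] at e
    have h1 := congrFun e.1 0
    have h2 := congrFun e.2 0
    rw [key_const, key_const] at h1 h2
    exact Prod.ext h1 h2
  exact Finsupp.mapDomain_injective hinj (h.trans Finsupp.mapDomain_zero.symm)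

end Vanishing

/-! ### Functionals on the graded components -/

section Functionals

variable (K : Type*) [Field K] {n : ℕ}

/-- The linear functional on the degree `N` component induced by a function `Φ` on pairs of tuples
of words: its value on the class of `d` is the sum of the values of `Φ` over all relabellings
of `d`. -/
noncomputable def symmFun {N : ℕ} (Φ : Words n (Fin N) × Words n (Fin N) → K) :
    Univ K n N →ₗ[K] K :=
  Representation.Coinvariants.lift _
    (Finsupp.linearCombination K fun d : Diag n N => ∑ σ : Equiv.Perm (Fin N), Φ (σ • d).1)
    fun τ => by
      refine Finsupp.lhom_ext' fun d => LinearMap.ext_ring ?_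
      change Finsupp.linearCombination K _ (relabelRep K n N τ (Finsupp.single d 1)) =
        Finsupp.linearCombination K _ (Finsupp.single d 1)
      rw [relabelRep_single, Finsupp.linearCombination_single, Finsupp.linearCombination_single]
      congr 1
      simp only [← mul_smul]
      exact Fintype.sum_equiv (Equiv.mulRight τ) _ _ fun _ => rfl

theorem symmFun_mk {N : ℕ} (Φ : Words n (Fin N) × Words n (Fin N) → K) (s : Diag n N →₀ K) :
    symmFun K Φ (Representation.Coinvariants.mk (relabelRep K n N) s) =
      Finsupp.linearCombination K (fun d : Diag n N => ∑ σ : Equiv.Perm (Fin N), Φ (σ • d).1) s :=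
  rfl

theorem symmFun_eq_zero {N : ℕ} {Φ : Words n (Fin N) × Words n (Fin N) → K}
    {P : Diag n N → Prop} (h : ∀ d, P d → ∀ σ : Equiv.Perm (Fin N), Φ (σ • d).1 = 0)
    {u : Univ K n N} (hu : u ∈ diagSpan K P) : symmFun K Φ u = 0 := by
  have h1 : diagSpan K P ≤ LinearMap.ker (symmFun K Φ) := diagSpan_le K fun d hd => by
    rw [LinearMap.mem_ker, Diag.toUniv, symmFun_mk, Finsupp.linearCombination_single,
      Finset.sum_eq_zero fun σ _ => h d hd σ, smul_zero]
  exact h1 hu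

theorem rename_comp {Λ Λ' Λ'' : Type} (f : Λ → Λ') (g : Λ' → Λ'') (w : Words n Λ) :
    rename g (rename f w) = rename (g ∘ f) w := by
  funext α; simp [rename]

theorem rename_injective {Λ Λ' : Type} {f : Λ → Λ'} (hf : Function.Injective f) :
    Function.Injective (rename (n := n) f) := fun _ _ h =>
  funext fun α => List.map_injective_iff.2 hf (congrFun h α)

/-- Simultaneous renaming of the letters in a pair of tuples of words. -/
def renamePair {Λ Λ' : Type} (f : Λ → Λ') (p : Words n Λ × Words n Λ) :
    Words n Λ' × Words n Λ' := (rename f p.1, rename f p.2)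

/-- Insertion into tensor factors on pairs of tuples of words. -/
noncomputable def placePair {m : ℕ} {Λ : Type} (f : Fin n ↪ Fin m)
    (p : Words n Λ × Words n Λ) : Words m Λ × Words m Λ :=
  (placeWords f p.1, placeWords f p.2)

theorem symmFun_gmul {p q N : ℕ} (h : p + q = N) (Φ : Words n (Fin N) × Words n (Fin N) → K)
    (x : Diag n p) (y : Diag n q) :
    symmFun K Φ (gmul K h (x.toUniv K) (y.toUniv K)) =
      ∑ σ : Equiv.Perm (Fin N), Finsupp.linearCombination K Φ
        (normalOrder K (renamePair (σ ∘ inL h) x.1) (renamePair (σ ∘ inR h) y.1)) := by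
  rw [gmul_toUniv, symmFun_mk, Finsupp.linearCombination_apply, Finsupp.sum]
  simp only [smul_eq_mul, Finset.mul_sum]
  rw [Finset.sum_comm]
  refine Finset.sum_congr rfl fun σ _ => ?_
  have h1 := normalOrder_rename K σ.injective
    (rename (inL h) x.1.1, rename (inL h) x.1.2) (rename (inR h) y.1.1, rename (inR h) y.1.2)
  simp only [rename_comp] at h1
  have h2 : normalOrder K (renamePair (σ ∘ inL h) x.1) (renamePair (σ ∘ inR h) y.1) = _ := h1
  rw [h2, ← mapDomain_mulDiag, ← Finsupp.mapDomain_comp, Finsupp.linearCombination_mapDomain,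
    Finsupp.linearCombination_apply, Finsupp.sum]
  rfl

/-- The sum of all relabellings of a combination of diagrams with `k` letters by the elements of
`Fin (k + 1)` other than `j`. -/
noncomputable def spread {k : ℕ} (s : Diag n k →₀ K) (j : Fin (k + 1)) :
    (Words n (Fin (k + 1)) × Words n (Fin (k + 1))) →₀ K :=
  ∑ σ : Equiv.Perm (Fin (k + 1)), if σ (Fin.last k) = j then
    Finsupp.mapDomain (fun d : Diag n k => renamePair (σ ∘ Fin.castSucc) d.1) s else 0

theorem exists_of_mem_support_spread {k : ℕ} {s : Diag n k →₀ K} {j : Fin (k + 1)}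
    {p : Words n (Fin (k + 1)) × Words n (Fin (k + 1))} (hp : p ∈ (spread K s j).support) :
    ∃ σ : Equiv.Perm (Fin (k + 1)), σ (Fin.last k) = j ∧
      ∃ d ∈ s.support, p = renamePair (σ ∘ Fin.castSucc) d.1 := by
  classical
  obtain ⟨σ, -, hσ⟩ := Finset.mem_biUnion.1 (Finsupp.support_finsetSum hp)
  split_ifs at hσ with h
  · obtain ⟨d, hd, e⟩ := Finset.mem_image.1 (Finsupp.mapDomain_support hσ)
    exact ⟨σ, h, d, hd, e.symm⟩
  · simp at hσ

theorem sum_spread {k : ℕ} (s : Diag n k →₀ K)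
    (F : Fin (k + 1) → Words n (Fin (k + 1)) × Words n (Fin (k + 1)) → K) :
    ∑ j, (spread K s j).sum (fun p a => a * F j p) =
      s.sum fun d a => a * ∑ σ : Equiv.Perm (Fin (k + 1)),
        F (σ (Fin.last k)) (renamePair (σ ∘ Fin.castSucc) d.1) := by
  have h1 : ∀ j, (spread K s j).sum (fun p a => a * F j p) =
      ∑ σ : Equiv.Perm (Fin (k + 1)), if σ (Fin.last k) = j then
        s.sum fun d a => a * F (σ (Fin.last k)) (renamePair (σ ∘ Fin.castSucc) d.1) else 0 := by
    intro j
    have h2 : ∀ f : (Words n (Fin (k + 1)) × Words n (Fin (k + 1))) →₀ K,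
        f.sum (fun p a => a * F j p) = Finsupp.linearCombination K (F j) f := fun f => by
      rw [Finsupp.linearCombination_apply]; rfl
    rw [h2, spread, map_sum]
    refine Finset.sum_congr rfl fun σ _ => ?_
    split_ifs with h
    · subst h
      rw [Finsupp.linearCombination_mapDomain, Finsupp.linearCombination_apply]
      rfl
    · exact map_zero _
  simp only [h1]
  rw [Finset.sum_comm]
  simp only [Finset.sum_ite_eq, Finset.mem_univ, if_true, Finsupp.sum, Finset.mul_sum]
  exact Finset.sum_comm

theorem spread_smul {k : ℕ} (s : Diag n k →₀ K) (τ : Equiv.Perm (Fin (k + 1)))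
    (j : Fin (k + 1)) :
    spread K s (τ j) = Finsupp.mapDomain (renamePair τ) (spread K s j) := by
  have h1 : ∀ f : (Words n (Fin (k + 1)) × Words n (Fin (k + 1))) →₀ K,
      Finsupp.mapDomain (renamePair τ) f = Finsupp.lmapDomain K K (renamePair τ) f := fun _ => rfl
  rw [h1, spread, spread, map_sum]
  refine Fintype.sum_equiv (Equiv.mulLeft τ⁻¹) _ _ fun σ => ?_
  have h2 : (Equiv.mulLeft τ⁻¹ σ) (Fin.last k) = j ↔ σ (Fin.last k) = τ j := by
    change τ⁻¹ (σ _) = j ↔ _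
    rw [Equiv.Perm.inv_eq_iff_eq]
  by_cases h : σ (Fin.last k) = τ j
  · rw [if_pos h, if_pos (h2.2 h), ← h1, ← Finsupp.mapDomain_comp]
    congr 1
    funext d
    simp only [Function.comp_apply, renamePair, rename_comp]
    have h3 : (τ ∘ (Equiv.mulLeft τ⁻¹ σ) ∘ Fin.castSucc) = σ ∘ Fin.castSucc := by
      funext i; simp
    rw [h3]
  · rw [if_neg h, if_neg fun h' => h (h2.1 h'), map_zero]

theorem mem_of_cnt {Λ : Type} [DecidableEq Λ] {w : Words n Λ} {l : Λ} (h : cnt w l = 1) :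
    ∃ α, l ∈ w α := by
  by_contra hc
  push Not at hc
  have : cnt w l = 0 := Finset.sum_eq_zero fun α _ => List.count_eq_zero.2 (hc α)
  omega

theorem exists_smul_eq {k : ℕ} {d e : Diag n k} {σ τ : Equiv.Perm (Fin (k + 1))}
    (h : renamePair (σ ∘ Fin.castSucc) d.1 = renamePair (τ ∘ Fin.castSucc) e.1) :
    ∃ ρ : Equiv.Perm (Fin k), d = ρ • e := by
  have h1 : ∀ i : Fin k, ∃ i' : Fin k, Fin.castSucc i' = σ⁻¹ (τ (Fin.castSucc i)) := by
    intro i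
    obtain ⟨α, hα⟩ := mem_of_cnt (e.2.1 i)
    have h2 : τ (Fin.castSucc i) ∈ (renamePair (σ ∘ Fin.castSucc) d.1).1 α := by
      rw [h]; exact List.mem_map.2 ⟨i, hα, rfl⟩
    obtain ⟨i', -, hi'⟩ := List.mem_map.1 h2
    exact ⟨i', by rw [← hi']; simp⟩
  choose ρ hρ using h1
  have hinj : Function.Injective ρ := fun a b hab => by
    have h2 := hρ a
    rw [hab, hρ b] at h2
    exact Fin.castSucc_injective _ (τ.injective (σ⁻¹.injective h2)).symm
  refine ⟨Equiv.ofBijective ρ (Finite.injective_iff_bijective.1 hinj), Subtype.ext ?_⟩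
  have h3 : (σ ∘ Fin.castSucc) ∘ ρ = τ ∘ Fin.castSucc := by
    funext i; simp [hρ]
  have h4 : Function.Injective (σ ∘ Fin.castSucc) :=
    σ.injective.comp (Fin.castSucc_injective _)
  rw [← h3] at h
  refine Prod.ext (rename_injective h4 ?_) (rename_injective h4 ?_)
  · exact (congrArg Prod.fst h).trans (rename_comp _ _ _).symm
  · exact (congrArg Prod.snd h).trans (rename_comp _ _ _).symm

/-- In characteristic `0` the class of `s` can be recovered from the relabellings of `s`. -/
theorem mk_eq_zero_of_spread [CharZero K] {k : ℕ} (s : Diag n k →₀ K)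
    (h : ∀ j, spread K s j = 0) :
    Representation.Coinvariants.mk (relabelRep K n k) s = 0 := by
  classical
  -- The map `g` sends each relabelling of a diagram back to the class of the diagram.
  let g : Words n (Fin (k + 1)) × Words n (Fin (k + 1)) → Univ K n k := fun p =>
    if hp : ∃ d : Diag n k, ∃ σ : Equiv.Perm (Fin (k + 1)),
      renamePair (σ ∘ Fin.castSucc) d.1 = p then hp.choose.toUniv K else 0
  have hg : ∀ (σ : Equiv.Perm (Fin (k + 1))) (d : Diag n k),
      g (renamePair (σ ∘ Fin.castSucc) d.1) = d.toUniv K := by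
    intro σ d
    have hp : ∃ e : Diag n k, ∃ τ : Equiv.Perm (Fin (k + 1)),
      renamePair (τ ∘ Fin.castSucc) e.1 = renamePair (σ ∘ Fin.castSucc) d.1 := ⟨d, σ, rfl⟩
    obtain ⟨τ, hτ⟩ := hp.choose_spec
    obtain ⟨ρ, hρ⟩ := exists_smul_eq hτ
    refine (dif_pos hp).trans ?_
    rw [hρ, Diag.toUniv, ← relabelRep_single, Representation.Coinvariants.mk_self_apply]
    rfl
  have h0 : ∑ j, Finsupp.linearCombination K g (spread K s j) = 0 :=
    Finset.sum_eq_zero fun j _ => by rw [h j, map_zero]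
  have h1 : ∑ j, Finsupp.linearCombination K g (spread K s j) =
      ∑ _σ : Equiv.Perm (Fin (k + 1)), Representation.Coinvariants.mk (relabelRep K n k) s := by
    simp only [spread, map_sum]
    rw [Finset.sum_comm]
    refine Finset.sum_congr rfl fun σ _ => ?_
    rw [Finset.sum_eq_single (σ (Fin.last k)) (fun j _ hj => by rw [if_neg (Ne.symm hj), map_zero])
      (by simp), if_pos rfl, Finsupp.linearCombination_mapDomain, mk_eq_sum,
      Finsupp.linearCombination_apply]
    exact Finset.sum_congr rfl fun d _ => by simp only [Function.comp_apply, hg]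
  rw [h1, Finset.sum_const, ← Nat.cast_smul_eq_nsmul K] at h0
  refine (smul_eq_zero.1 h0).resolve_left ?_
  simp [Fintype.card_perm, Nat.factorial_ne_zero]

end Functionals

/-! ### Products with diagrams of degree one -/

section DegreeOne

variable (K : Type*) [Field K] {n m k : ℕ}

theorem renamePair_placePair {Λ Λ' : Type} (f : Fin n ↪ Fin m) (g : Λ → Λ')
    (p : Words n Λ × Words n Λ) :
    renamePair g (placePair f p) = placePair f (renamePair g p) := by
  simp only [renamePair, placePair, rename_placeWords]

theorem symmFun_gmul_right (h : k + 1 = k + 1) (f : Fin n ↪ Fin m)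
    (Φ : Words m (Fin (k + 1)) × Words m (Fin (k + 1)) → K) (s : Diag n k →₀ K) (y : Diag m 1) :
    symmFun K Φ (gmul K h (place K f (Representation.Coinvariants.mk (relabelRep K n k) s))
      (y.toUniv K)) =
    ∑ j, (spread K s j).sum fun p a => a * Finsupp.linearCombination K Φ
      (normalOrder K (placePair f p) (renamePair (fun _ => j) y.1)) := by
  rw [sum_spread K s fun j p => Finsupp.linearCombination K Φ
      (normalOrder K (placePair f p) (renamePair (fun _ => j) y.1)), mk_eq_sum, Finsupp.sum,
    map_sum, map_sum, LinearMap.sum_apply, map_sum]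
  refine Finset.sum_congr rfl fun d _ => ?_
  rw [map_smul, map_smul, LinearMap.smul_apply, map_smul, place_toUniv, symmFun_gmul, smul_eq_mul]
  congr 1
  refine Finset.sum_congr rfl fun σ _ => ?_
  have e1 : (σ ∘ inL h) = σ ∘ Fin.castSucc := by funext i; rfl
  have e2 : (σ ∘ inR h) = fun _ : Fin 1 => σ (Fin.last k) := by
    funext i
    have : inR h i = Fin.last k := by apply Fin.ext; simp [inR]
    simp [this]
  rw [e1, e2, ← renamePair_placePair]
  rfl

theorem symmFun_gmul_left (h : 1 + k = k + 1) (f : Fin n ↪ Fin m)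
    (Φ : Words m (Fin (k + 1)) × Words m (Fin (k + 1)) → K) (s : Diag n k →₀ K) (y : Diag m 1) :
    symmFun K Φ (gmul K h (y.toUniv K)
      (place K f (Representation.Coinvariants.mk (relabelRep K n k) s))) =
    ∑ j, (spread K s j).sum fun p a => a * Finsupp.linearCombination K Φ
      (normalOrder K (renamePair (fun _ => j) y.1) (placePair f p)) := by
  rw [sum_spread K s fun j p => Finsupp.linearCombination K Φ
      (normalOrder K (renamePair (fun _ => j) y.1) (placePair f p)), mk_eq_sum, Finsupp.sum,
    map_sum, map_sum, map_sum]
  refine Finset.sum_congr rfl fun d _ => ?_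
  rw [map_smul, map_smul, map_smul, place_toUniv, symmFun_gmul, smul_eq_mul]
  congr 1
  -- the letter of `y` comes first in the product, and last in `spread`
  refine Fintype.sum_equiv (Equiv.mulRight (finRotate (k + 1))) _ _ fun σ => ?_
  have e1 : ((Equiv.mulRight (finRotate (k + 1)) σ) ∘ Fin.castSucc) = σ ∘ inR h := by
    funext i
    have : inR h i = i.succ := by apply Fin.ext; simp [inR]
    simp [this]
  have e2 : (σ ∘ inL h) = fun _ : Fin 1 =>
      (Equiv.mulRight (finRotate (k + 1)) σ) (Fin.last k) := by
    funext i
    have : inL h i = 0 := by apply Fin.ext; simp [inL]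
    simp [this]
  rw [← e1, e2, ← renamePair_placePair]
  rfl

end DegreeOne

/-! ### Normal orderings of products with `r` -/

section WordAt

variable {n : ℕ} {Λ : Type}

/-- The tuple of words with the word `w` in factor `β`, all other words being empty. -/
def wordAt (β : Fin n) (w : List Λ) : Words n Λ := Function.update (fun _ => []) β w

theorem wordAt_self (β : Fin n) (w : List Λ) : wordAt β w β = w := Function.update_self ..

theorem wordAt_of_ne {β γ : Fin n} (h : γ ≠ β) (w : List Λ) : wordAt β w γ = [] :=
  Function.update_of_ne h ..

theorem update_wordAt (β : Fin n) (w v : List Λ) :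
    Function.update (wordAt β w) β v = wordAt β v := Function.update_idem ..

theorem update_wordAt_nil {α β : Fin n} (h : α ≠ β) (w : List Λ) :
    Function.update (wordAt β w) α [] = wordAt β w := by
  rw [← wordAt_of_ne h w, Function.update_eq_self]

theorem wordAt_nil (β : Fin n) : wordAt β ([] : List Λ) = fun _ => [] :=
  Function.update_eq_self ..

theorem rename_wordAt {Λ' : Type} (f : Λ → Λ') (β : Fin n) (w : List Λ) :
    rename f (wordAt β w) = wordAt β (w.map f) := by
  rw [wordAt, rename_update, rename_elim]; rfl

theorem insAfter_update [DecidableEq Λ] (i j : Λ) (W : Words n Λ) (β : Fin n) (w : List Λ) :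
    insAfter i j (Function.update W β w) = Function.update (insAfter i j W) β (lAfter i j w) := by
  funext γ
  by_cases h : γ = β
  · subst h; simp [insAfter, lAfter]
  · simp [insAfter, h]

theorem insBefore_update [DecidableEq Λ] (i j : Λ) (W : Words n Λ) (β : Fin n) (w : List Λ) :
    insBefore i j (Function.update W β w) =
      Function.update (insBefore i j W) β (lBefore i j w) := by
  funext γ
  by_cases h : γ = β
  · subst h; simp [insBefore, lBefore]
  · simp [insBefore, h]

theorem insAfter_wordAt [DecidableEq Λ] (i j : Λ) (β : Fin n) (w : List Λ) :
    insAfter i j (wordAt β w) = wordAt β (lAfter i j w) := insAfter_update ..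

theorem insBefore_wordAt [DecidableEq Λ] (i j : Λ) (β : Fin n) (w : List Λ) :
    insBefore i j (wordAt β w) = wordAt β (lBefore i j w) := insBefore_update ..

theorem letters_wordAt (β : Fin n) (w : List Λ) :
    letters (wordAt β w) = w.map fun l => (β, l) := by
  have h : ∀ L : List (Fin n), L.Nodup → (L.flatMap fun γ => (wordAt β w γ).map fun l => (γ, l)) =
      if β ∈ L then w.map fun l => (β, l) else [] := by
    intro L hL
    induction L with
    | nil => rfl
    | cons γ L ih =>
      rw [List.nodup_cons] at hL
      rw [List.flatMap_cons, ih hL.2]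
      by_cases hγ : γ = β
      · subst hγ; simp [wordAt_self, hL.1]
      · simp [wordAt_of_ne hγ, Ne.symm hγ]
  exact (h _ (List.nodup_finRange n)).trans (if_pos (List.mem_finRange β))

theorem placeWords_eq_wordAt {m : ℕ} (f : Fin m ↪ Fin n) (π : Fin m) (W : Words m Λ)
    (h : ∀ π', π' ≠ π → W π' = []) : placeWords f W = wordAt (f π) (W π) := by
  funext β
  by_cases hβ : ∃ π', f π' = β
  · obtain ⟨π', rfl⟩ := hβ
    rw [placeWords, f.injective.extend_apply]
    by_cases e : π' = π
    · subst e; rw [wordAt_self]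
    · rw [wordAt_of_ne (fun e' => e (f.injective e')), h _ e]
  · rw [placeWords, Function.extend_apply' _ _ _ hβ, wordAt_of_ne]
    rintro rfl
    exact hβ ⟨π, rfl⟩

theorem renamePair_placeDiag_rDiag (f : Fin 2 ↪ Fin n) (j : Λ) :
    renamePair (fun _ => j) (placeDiag f rDiag).1 = (wordAt (f 0) [j], wordAt (f 1) [j]) := by
  change renamePair (fun _ => j) (placePair f rDiag.1) = _
  have h0 : placeWords f rDiag.1.1 = wordAt (f 0) (rDiag.1.1 0) :=
    placeWords_eq_wordAt f 0 _ fun π' h => by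
      have : π' = 1 := by omega
      subst this; rfl
  have h1 : placeWords f rDiag.1.2 = wordAt (f 1) (rDiag.1.2 1) :=
    placeWords_eq_wordAt f 1 _ fun π' h => by
      have : π' = 0 := by omega
      subst this; rfl
  rw [placePair, h0, h1, renamePair, rename_wordAt, rename_wordAt]
  rfl

end WordAt

section Pairing

variable (K : Type*) [Field K] {n : ℕ} {Λ : Type} [DecidableEq Λ]

/-- The value of a function on pairs of tuples of words on a state of the ordering process. -/
def stateFun (Φ : Words n Λ × Words n Λ → K) (s : State n Λ) : K :=
  Φ (fun α => s.1 α ++ s.2.1 α, s.2.2)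

theorem linearCombination_normalOrder (Φ : Words n Λ × Words n Λ → K)
    (x y : Words n Λ × Words n Λ) :
    Finsupp.linearCombination K Φ (normalOrder K x y) =
      Finsupp.linearCombination K (stateFun K Φ)
        ((letters x.2).foldr (fun p => moveB K p.1 p.2) (Finsupp.single (x.1, y.1, y.2) 1)) := by
  rw [normalOrder, Finsupp.linearCombination_mapDomain]
  rfl

theorem linearCombination_eq_zero {X : Type*} (Φ : X → K) (f : X →₀ K)
    (h : ∀ x ∈ f.support, Φ x = 0) : Finsupp.linearCombination K Φ f = 0 := by
  rw [Finsupp.linearCombination_apply]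
  exact Finset.sum_eq_zero fun x hx => by simp only [h x hx, smul_zero]

theorem foldr_moveB_sub (L : List (Fin n × Λ)) (f g : State n Λ →₀ K) :
    L.foldr (fun p => moveB K p.1 p.2) (f - g) =
      L.foldr (fun p => moveB K p.1 p.2) f - L.foldr (fun p => moveB K p.1 p.2) g := by
  induction L with
  | nil => rfl
  | cons p L ih => simp only [List.foldr_cons, ih, map_sub]

theorem moveB_single_of_eq_singleton (α : Fin n) (i j : Λ) (X A B : Words n Λ)
    (h : A α = [j]) :
    moveB K α i (Finsupp.single (X, A, B) 1) =
      Finsupp.single (X, A, Function.update B α (i :: B α)) 1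
      - (Finsupp.single (insAfter i j X, Function.update A α [],
            Function.update B α (i :: B α)) 1
        - Finsupp.single (insBefore i j X, Function.update A α [],
            Function.update B α (i :: B α)) 1)
      - (Finsupp.single (X, A, insBefore j i B) 1 - Finsupp.single (X, A, insAfter j i B) 1) := by
  have h2 : Function.update A α [j] = A := by rw [← h, Function.update_eq_self]
  simp [moveB, h, pushB, h2]

variable {K} in
/-- The function `w (U a) * η (V a) * [V b = Z₀]`, on pairs `(U, V)` of which all other components
are empty. -/
noncomputable def testFun (w η : List Λ → K) (Z₀ : List Λ) (a b : Fin n)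
    (p : Words n Λ × Words n Λ) : K :=
  open Classical in
  if (∀ β, β ≠ a → p.1 β = []) ∧ (∀ β, β ≠ a → β ≠ b → p.2 β = []) ∧ p.2 b = Z₀ then
    w (p.1 a) * η (p.2 a) else 0

variable {w η : List Λ → K} {Z₀ : List Λ} {a b : Fin n}

theorem stateFun_testFun_eq_ite (hab : a ≠ b) (u t V Z : List Λ) :
    stateFun K (testFun w η Z₀ a b) (wordAt a u, wordAt a t, Function.update (wordAt b Z) a V) =
      if Z = Z₀ then w (u ++ t) * η V else 0 := by
  rw [stateFun, testFun]
  refine if_congr ?_ ?_ rfl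
  · dsimp only
    rw [Function.update_of_ne (Ne.symm hab), wordAt_self]
    refine ⟨fun h => h.2.2, fun h => ⟨fun β hβ => ?_, fun β hβ hβ' => ?_, h⟩⟩
    · rw [wordAt_of_ne hβ, wordAt_of_ne hβ]; rfl
    · rw [Function.update_of_ne hβ, wordAt_of_ne hβ']
  · simp only [wordAt_self, Function.update_self]

/-- The process which orders `u(a) v(b) a_j ⊗ b_j` is described by `aVal`. -/
theorem foldr_moveB_eq_aVal (hab : a ≠ b) (j : Λ) (rv u V Z : List Λ) (hV : j ∉ V)
    (hrv : j ∉ rv) :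
    Finsupp.linearCombination K (stateFun K (testFun w η Z₀ a b))
      ((rv.reverse.map fun l => (a, l)).foldr (fun p => moveB K p.1 p.2)
        (Finsupp.single (wordAt a u, wordAt a [j], Function.update (wordAt b Z) a V) 1)) =
      aVal w η Z₀ j rv u V Z := by
  induction rv generalizing V Z with
  | nil =>
    rw [List.reverse_nil, List.map_nil, List.foldr_nil, Finsupp.linearCombination_single, one_smul,
      stateFun_testFun_eq_ite K hab, aVal]
  | cons i rv ih =>
    rw [List.mem_cons, not_or] at hrv
    have h0 : ∀ u', Finsupp.linearCombination K (stateFun K (testFun w η Z₀ a b))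
        ((rv.reverse.map fun l => (a, l)).foldr (fun p => moveB K p.1 p.2)
          (Finsupp.single (wordAt a u', wordAt a [],
            Function.update (wordAt b Z) a (i :: V)) 1)) =
        if Z = Z₀ then w u' * η (rv.reverse ++ i :: V) else 0 := by
      intro u'
      rw [foldr_moveB_of_eq_nil K _ _ _ _ fun p _ => by rw [wordAt_nil]]
      have h1 : (fun α => (((rv.reverse.map fun l => (a, l)).filter
          fun p => p.1 = α).map Prod.snd) ++
          Function.update (wordAt b Z) a (i :: V) α) =
          Function.update (wordAt b Z) a (rv.reverse ++ i :: V) := by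
        funext α
        by_cases hα : α = a
        · subst hα; simp [List.filter_map, Function.comp_def]
        · simp [List.filter_map, Function.comp_def, hα, Ne.symm hα]
      rw [h1, Finsupp.linearCombination_single, one_smul, stateFun_testFun_eq_ite K hab,
        List.append_nil]
    rw [List.reverse_cons, List.map_append, List.foldr_append]
    simp only [List.map_cons, List.map_nil, List.foldr_cons, List.foldr_nil]
    rw [moveB_single_of_eq_singleton K a i j _ _ _ (wordAt_self a [j])]
    simp only [foldr_moveB_sub, map_sub, Function.update_self, Function.update_idem,
      update_wordAt, insAfter_wordAt, insBefore_wordAt, insAfter_update, insBefore_update]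
    rw [lBefore_of_notMem hV, lAfter_of_notMem hV, ih _ _ (by simp [hV, hrv.1]) hrv.2,
      ih _ _ hV hrv.2, ih _ _ hV hrv.2, h0, h0, aVal]
    split_ifs <;> ring

theorem normalOrder_eq_aVal (hab : a ≠ b) (j : Λ) (u v : List Λ) (hv : j ∉ v) :
    Finsupp.linearCombination K (testFun w η Z₀ a b)
      (normalOrder K (wordAt a u, wordAt a v) (wordAt a [j], wordAt b [j])) =
      aVal w η Z₀ j v.reverse u [] [j] := by
  rw [linearCombination_normalOrder, letters_wordAt, ← foldr_moveB_eq_aVal K hab j v.reverse u []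
    [j] (by simp) (by simpa using hv), List.reverse_reverse]
  rw [update_wordAt_nil hab]

theorem testFun_normalOrder_left (hab : a ≠ b) (hZ₀ : 2 ≤ Z₀.length) (j : Λ) (u v : List Λ) :
    Finsupp.linearCombination K (testFun w η Z₀ a b)
      (normalOrder K (wordAt a [j], wordAt b [j]) (wordAt a u, wordAt a v)) = 0 := by
  rw [linearCombination_normalOrder, letters_wordAt]
  simp only [List.map_cons, List.map_nil, List.foldr_cons, List.foldr_nil]
  rw [moveB_single_of_eq_nil K b j _ _ _ (wordAt_of_ne (Ne.symm hab) u),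
    Finsupp.linearCombination_single, one_smul, stateFun, testFun]
  refine if_neg fun h => ?_
  have h1 := h.2.2
  dsimp only at h1
  rw [Function.update_self, wordAt_of_ne (Ne.symm hab)] at h1
  rw [← h1] at hZ₀
  simp at hZ₀

theorem testFun_normalOrder_right (hab : a ≠ b) (j : Λ) (u v : List Λ) (hu : u ≠ []) :
    Finsupp.linearCombination K (testFun w η Z₀ a b)
      (normalOrder K (wordAt b u, wordAt b v) (wordAt a [j], wordAt b [j])) = 0 := by
  refine linearCombination_eq_zero K _ _ fun d hd => if_neg fun h => ?_
  exact normalOrder_fst_ne_nil K _ _ b (Or.inl ((wordAt_self b u).trans_ne hu)) d hd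
    (h.1 b (Ne.symm hab))

variable {K} in
/-- The value of `w` on the result of letting all letters of `rest` be absorbed by the letter `j`
of the word `x`. -/
noncomputable def absorbVal (w : List Λ → K) (j : Λ) : (rest x : List Λ) → K
  | [], x => w x
  | l :: rest, x => -(absorbVal w j rest (lAfter j l x) - absorbVal w j rest (lBefore j l x))

theorem absorbVal_eq_of_filter {y j : Λ} (hy : j ≠ y)
    (hw : ∀ U U' : List Λ, U.filter (· ≠ y) = U'.filter (· ≠ y) → w U = w U')
    (rest x x' : List Λ) (h : x.filter (· ≠ y) = x'.filter (· ≠ y)) :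
    absorbVal w j rest x = absorbVal w j rest x' := by
  induction rest generalizing x x' with
  | nil => exact hw _ _ h
  | cons l rest ih =>
    rw [absorbVal, absorbVal]
    congr 2
    · refine ih _ _ ?_
      by_cases hl : l = y
      · rw [filter_lAfter_of_not _ _ (by simp [hl]), filter_lAfter_of_not _ _ (by simp [hl]), h]
      · rw [filter_lAfter _ _ (by simp [hy]) (by simp [hl]),
          filter_lAfter _ _ (by simp [hy]) (by simp [hl]), h]
    · refine ih _ _ ?_
      by_cases hl : l = y
      · rw [← filter_lAfter_eq_filter_lBefore _ _ (by simp [hl]),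
          ← filter_lAfter_eq_filter_lBefore _ _ (by simp [hl]),
          filter_lAfter_of_not _ _ (by simp [hl]), filter_lAfter_of_not _ _ (by simp [hl]), h]
      · rw [filter_lBefore _ _ (by simp [hy]) (by simp [hl]),
          filter_lBefore _ _ (by simp [hy]) (by simp [hl]), h]

/-- A commutator with a letter whose position does not matter vanishes. -/
theorem absorbVal_eq_zero {y j : Λ}
    (hw : ∀ U U' : List Λ, U.filter (· ≠ y) = U'.filter (· ≠ y) → w U = w U')
    (rest x : List Λ) (hr : rest ≠ []) (hy : y = j ∨ y ∈ rest) : absorbVal w j rest x = 0 := by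
  induction rest generalizing x with
  | nil => exact absurd rfl hr
  | cons l rest ih =>
    rw [absorbVal, neg_eq_zero, sub_eq_zero]
    by_cases hyj : y = j
    · by_cases hr' : rest = []
      · subst hr'
        exact hw _ _ (filter_lAfter_eq_filter_lBefore _ _ (by simp [hyj]))
      · rw [ih _ hr' (Or.inl hyj), ih _ hr' (Or.inl hyj)]
    · have h1 := hy.resolve_left hyj
      by_cases hl : y ∈ rest
      · have hr' := List.ne_nil_of_mem hl
        rw [ih _ hr' (Or.inr hl), ih _ hr' (Or.inr hl)]
      · have hly : l = y := by
          rcases List.mem_cons.1 h1 with h | h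
          exacts [h.symm, absurd h hl]
        exact absorbVal_eq_of_filter K (Ne.symm hyj) hw _ _ _
          (filter_lAfter_eq_filter_lBefore _ _ (by simp [hly]))

theorem pushB_eq_absorbVal (hab : a ≠ b) (j : Λ) (rest x u v : List Λ) :
    Finsupp.linearCombination K (stateFun K (testFun w η Z₀ a b))
      (pushB K b j (wordAt b u) (wordAt b v) (wordAt a x) [] rest) =
      absorbVal w j rest x * if j :: v = Z₀ then η [] else 0 := by
  have hzero : ∀ s : State n Λ, s.2.1 b ≠ [] → stateFun K (testFun w η Z₀ a b) s = 0 :=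
    fun s hs => if_neg fun h => hs (List.append_eq_nil_iff.1 (h.1 b (Ne.symm hab))).2
  induction rest generalizing x with
  | nil =>
    rw [pushB, Finsupp.linearCombination_single, one_smul, update_wordAt, update_wordAt,
      wordAt_self, wordAt_nil b, ← wordAt_nil a]
    rw [← update_wordAt_nil hab (j :: v), stateFun_testFun_eq_ite K hab, List.append_nil, absorbVal]
    split_ifs <;> ring
  | cons l rest ih =>
    have h1 : Finsupp.linearCombination K (stateFun K (testFun w η Z₀ a b))
        (pushB K b j (wordAt b u) (wordAt b v) (wordAt a x) ([] ++ [l]) rest) = 0 := by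
      refine linearCombination_eq_zero K _ _ fun s hs => hzero s ?_
      exact pushB_mem_supported K b j _ _ (fun _ pre _ => pre ≠ []) (fun s => s.2.1 b ≠ [])
        (fun X pre h => by simpa using h)
        (fun X pre l rest h => ⟨by simp, h, h, by simp, by simp⟩) _ _ _ (by simp) hs
    rw [pushB, map_sub, map_sub, map_sub, map_sub, h1, insAfter_wordAt, insBefore_wordAt, ih, ih,
      Finsupp.linearCombination_single, Finsupp.linearCombination_single, hzero _ (by simp),
      hzero _ (by simp), absorbVal]
    ring

theorem testFun_normalOrder_other (hab : a ≠ b) (j : Λ) (u v : List Λ) (hu : u ≠ [])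
    (h : η [] = 0 ∨ ∃ y, (y = j ∨ y ∈ u) ∧
      ∀ U U' : List Λ, U.filter (· ≠ y) = U'.filter (· ≠ y) → w U = w U') :
    Finsupp.linearCombination K (testFun w η Z₀ a b)
      (normalOrder K (wordAt a [j], wordAt b [j]) (wordAt b u, wordAt b v)) = 0 := by
  rw [linearCombination_normalOrder, letters_wordAt]
  simp only [List.map_cons, List.map_nil, List.foldr_cons, List.foldr_nil]
  rw [moveB, Finsupp.linearCombination_single, one_smul, pushB_eq_absorbVal K hab]
  dsimp only
  rw [wordAt_self]
  rcases h with h | ⟨y, hy, hw⟩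
  · simp [h]
  · rw [absorbVal_eq_zero K hw u [j] hu hy, zero_mul]

end Pairing

/-! ### Elements commuting with `r` -/

section Commutant

variable (K : Type*) [Field K] {n m k : ℕ}

theorem nodup_of_cnt {Λ : Type} [DecidableEq Λ] {w : Words n Λ} (h : ∀ l, cnt w l = 1)
    (α : Fin n) : (w α).Nodup := by
  refine List.nodup_iff_count_le_one.2 fun l => ?_
  rw [← h l]
  exact Finset.single_le_sum (f := fun α => (w α).count l) (fun _ _ => Nat.zero_le _)
    (Finset.mem_univ α)

theorem cnt_spread_aux {w : Words n (Fin k)} (hw : ∀ l, cnt w l = 1)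
    (σ : Equiv.Perm (Fin (k + 1))) (α : Fin n) :
    (rename (σ ∘ Fin.castSucc) w α).Nodup ∧
      σ (Fin.last k) ∉ rename (σ ∘ Fin.castSucc) w α := by
  refine ⟨(nodup_of_cnt hw α).map (σ.injective.comp (Fin.castSucc_injective k)), fun h => ?_⟩
  obtain ⟨i, -, hi⟩ := List.mem_map.1 h
  exact (Fin.castSucc_lt_last i).ne (σ.injective hi)

theorem exists_mem_spread_aux {w : Words n (Fin k)} (hw : ∀ l, cnt w l = 1)
    (σ : Equiv.Perm (Fin (k + 1))) {l : Fin (k + 1)} (hl : l ≠ σ (Fin.last k)) :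
    ∃ α, l ∈ rename (σ ∘ Fin.castSucc) w α := by
  obtain ⟨i, rfl⟩ := σ.surjective l
  obtain ⟨i, rfl⟩ | rfl := i.eq_castSucc_or_eq_last
  · obtain ⟨α, hα⟩ := mem_of_cnt (hw i)
    exact ⟨α, List.mem_map.2 ⟨i, hα, rfl⟩⟩
  · exact absurd rfl hl

variable {K}

/-- In each pair of tuples of words that occurs in `spread s j`, all letters except `j` occur
exactly once. -/
theorem spread_support {s : Diag n k →₀ K} {j : Fin (k + 1)}
    {p : Words n (Fin (k + 1)) × Words n (Fin (k + 1))} (hp : p ∈ (spread K s j).support) :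
    (∀ α, (p.1 α).Nodup ∧ (p.2 α).Nodup ∧ j ∉ p.1 α ∧ j ∉ p.2 α) ∧
      (∀ l, l ≠ j → (∃ α, l ∈ p.1 α) ∧ ∃ α, l ∈ p.2 α) := by
  obtain ⟨σ, rfl, d, -, rfl⟩ := exists_of_mem_support_spread K hp
  refine ⟨fun α => ?_, fun l hl => ?_⟩
  · have h1 := cnt_spread_aux d.2.1 σ α
    have h2 := cnt_spread_aux d.2.2 σ α
    exact ⟨h1.1, h2.1, h1.2, h2.2⟩
  · exact ⟨exists_mem_spread_aux d.2.1 σ hl, exists_mem_spread_aux d.2.2 σ hl⟩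

theorem spread_support_of_forall {s : Diag n k →₀ K}
    (Q : ∀ {Λ : Type}, Words n Λ × Words n Λ → Prop)
    (hQ : ∀ {Λ Λ' : Type} (f : Λ → Λ') p, Q p → Q (renamePair f p))
    (hs : ∀ d ∈ s.support, Q d.1) {j : Fin (k + 1)}
    {p : Words n (Fin (k + 1)) × Words n (Fin (k + 1))} (hp : p ∈ (spread K s j).support) :
    Q p := by
  obtain ⟨σ, -, d, hd, rfl⟩ := exists_of_mem_support_spread K hp
  exact hQ _ _ (hs d hd)

/-- The coefficients of an element concentrated in the tensor factor `π`. -/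
noncomputable def factorCoeff (s : Diag n k →₀ K) (π : Fin n) (j : Fin (k + 1)) :
    (List (Fin (k + 1)) × List (Fin (k + 1))) →₀ K :=
  Finsupp.mapDomain (fun p => (p.1 π, p.2 π)) (spread K s j)

theorem spread_eq_zero_of_factorCoeff {s : Diag n k →₀ K} {π : Fin n} {j : Fin (k + 1)}
    (hs : ∀ p ∈ (spread K s j).support, ∀ π', π' ≠ π → p.1 π' = [] ∧ p.2 π' = [])
    (h : factorCoeff s π j = 0) : spread K s j = 0 := by
  have h1 := Finsupp.mapDomain_injOn (M := K) (S := {p : Words n (Fin (k + 1)) ×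
    Words n (Fin (k + 1)) | ∀ π', π' ≠ π → p.1 π' = [] ∧ p.2 π' = []})
    (f := fun p => (p.1 π, p.2 π)) ?_
  · refine h1 (fun p hp => hs p hp) (fun p hp => ?_) ?_
    · simp at hp
    · rw [Finsupp.mapDomain_zero]; exact h
  · intro p hp q hq e
    rw [Prod.mk.injEq] at e
    refine Prod.ext (funext fun π' => ?_) (funext fun π' => ?_) <;> by_cases hπ : π' = π
    · rw [hπ]; exact e.1
    · rw [(hp _ hπ).1, (hq _ hπ).1]
    · rw [hπ]; exact e.2
    · rw [(hp _ hπ).2, (hq _ hπ).2]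

/-- For `k ≥ 2` there is no element `X ≠ 0` of degree `k`, concentrated in one tensor factor, such
that all terms of the commutator of `r` with `X ⊗ 1 + 1 ⊗ X` have letters in a third tensor
factor. -/
theorem mk_eq_zero_of_commutator [CharZero K] (hk : 2 ≤ k) {a b g : Fin m} (hab : a ≠ b)
    (hga : g ≠ a) (hgb : g ≠ b) (fa fb fr : Fin 2 ↪ Fin m) (π : Fin 2) (hfa : fa π = a)
    (hfb : fb π = b) (hr0 : fr 0 = a) (hr1 : fr 1 = b) (s : Diag 2 k →₀ K)
    (hs : ∀ d ∈ s.support, ∀ π', π' ≠ π → d.1.1 π' = [] ∧ d.1.2 π' = [])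
    (h : gmul K (add_comm 1 k) ((placeDiag fr rDiag).toUniv K)
        (place K fa (Representation.Coinvariants.mk (relabelRep K 2 k) s))
      - gmul K rfl (place K fa (Representation.Coinvariants.mk (relabelRep K 2 k) s))
        ((placeDiag fr rDiag).toUniv K)
      + (gmul K (add_comm 1 k) ((placeDiag fr rDiag).toUniv K)
        (place K fb (Representation.Coinvariants.mk (relabelRep K 2 k) s))
      - gmul K rfl (place K fb (Representation.Coinvariants.mk (relabelRep K 2 k) s))
        ((placeDiag fr rDiag).toUniv K)) ∈
      diagSpan K fun d : Diag m (k + 1) => d.1.1 g ≠ [] ∨ d.1.2 g ≠ []) :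
    Representation.Coinvariants.mk (relabelRep K 2 k) s = 0 := by
  have hs' : ∀ {j p}, p ∈ (spread K s j).support → ∀ π', π' ≠ π → p.1 π' = [] ∧ p.2 π' = [] := by
    intro j p hp
    refine spread_support_of_forall (fun p => ∀ π', π' ≠ π → p.1 π' = [] ∧ p.2 π' = [])
      (fun f p hp π' hπ => ?_) hs hp
    exact ⟨(rename_eq_nil _ _ _).2 (hp π' hπ).1, (rename_eq_nil _ _ _).2 (hp π' hπ).2⟩
  have hmem : ∀ {j p}, p ∈ (spread K s j).support → ∀ l, (l ∈ p.1 π ↔ l ≠ j) ∧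
      (l ∈ p.2 π ↔ l ≠ j) := by
    intro j p hp l
    have h1 := spread_support hp
    refine ⟨⟨fun hl e => (h1.1 π).2.2.1 (e ▸ hl), fun hl => ?_⟩,
      ⟨fun hl e => (h1.1 π).2.2.2 (e ▸ hl), fun hl => ?_⟩⟩
    · obtain ⟨π', hπ'⟩ := (h1.2 l hl).1
      by_cases e : π' = π
      · exact e ▸ hπ'
      · rw [(hs' hp π' e).1] at hπ'; simp at hπ'
    · obtain ⟨π', hπ'⟩ := (h1.2 l hl).2
      by_cases e : π' = π
      · exact e ▸ hπ'
      · rw [(hs' hp π' e).2] at hπ'; simp at hπ'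
  have hplace : ∀ (f : Fin 2 ↪ Fin m) {j p}, p ∈ (spread K s j).support →
      placePair f p = (wordAt (f π) (p.1 π), wordAt (f π) (p.2 π)) := fun f j p hp =>
    Prod.ext (placeWords_eq_wordAt f π _ fun π' e => (hs' hp π' e).1)
      (placeWords_eq_wordAt f π _ fun π' e => (hs' hp π' e).2)
  have hsupp : ∀ {j d}, d ∈ (factorCoeff s π j).support →
      ∃ p ∈ (spread K s j).support, (p.1 π, p.2 π) = d := fun hd =>
    Finset.mem_image.1 (Finsupp.mapDomain_support hd)
  have hc : IsCommuting (factorCoeff s π) := by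
    refine ⟨fun j d hd => ?_, fun j d hd => ?_, fun j d hd => ?_, fun j d hd => ?_,
      fun σ j u v => ?_, fun w η Z₀ hZ₀ hw => ?_⟩
    · obtain ⟨p, hp, rfl⟩ := hsupp hd
      exact ((spread_support hp).1 π).1
    · obtain ⟨p, hp, rfl⟩ := hsupp hd
      exact fun l => (hmem hp l).1
    · obtain ⟨p, hp, rfl⟩ := hsupp hd
      exact ((spread_support hp).1 π).2.1
    · obtain ⟨p, hp, rfl⟩ := hsupp hd
      exact fun l => (hmem hp l).2
    · have h1 : factorCoeff s π (σ j) = Finsupp.mapDomain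
          (Prod.map (List.map σ) (List.map σ)) (factorCoeff s π j) := by
        rw [factorCoeff, spread_smul, factorCoeff, ← Finsupp.mapDomain_comp,
          ← Finsupp.mapDomain_comp]
        rfl
      have hinj := List.map_injective_iff.2 σ.injective
      rw [h1]
      exact Finsupp.mapDomain_apply (hinj.prodMap hinj) _ (u, v)
    · have h0 := symmFun_eq_zero K (Φ := testFun w η Z₀ a b) (fun d hd σ => ?_) h
      swap
      · refine if_neg fun h1 => ?_
        rcases hd with hd | hd
        · exact hd ((rename_eq_nil σ _ _).1 (h1.1 g hga))
        · exact hd ((rename_eq_nil σ _ _).1 (h1.2.1 g hga hgb))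
      rw [map_add, map_sub, map_sub, symmFun_gmul_left, symmFun_gmul_right, symmFun_gmul_left,
        symmFun_gmul_right] at h0
      have hne : ∀ {j p}, p ∈ (spread K s j).support → p.1 π ≠ [] := by
        intro j p hp
        have : Nontrivial (Fin (k + 1)) := Fin.nontrivial_iff_two_le.2 (by omega)
        obtain ⟨l, hl⟩ := exists_ne j
        exact List.ne_nil_of_mem ((hmem hp l).1.2 hl)
      -- In `r X^a` the word of the factor `b` is the single letter `b_j`.
      have e1 : ∀ j, ((spread K s j).sum fun p c => c * Finsupp.linearCombination K
          (testFun w η Z₀ a b) (normalOrder K (renamePair (fun _ => j) (placeDiag fr rDiag).1)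
            (placePair fa p))) = 0 := fun j => Finset.sum_eq_zero fun p hp => by
        dsimp only
        rw [renamePair_placeDiag_rDiag, hplace _ hp, hr0, hr1, hfa,
          testFun_normalOrder_left K hab hZ₀, mul_zero]
      have e2 : ∀ j, ((spread K s j).sum fun p c => c * Finsupp.linearCombination K
          (testFun w η Z₀ a b) (normalOrder K (placePair fa p)
            (renamePair (fun _ => j) (placeDiag fr rDiag).1))) =
          (factorCoeff s π j).sum fun d c => c * aVal w η Z₀ j d.2.reverse d.1 [] [j] := by
        intro j
        rw [factorCoeff, Finsupp.sum_mapDomain_index (fun _ => zero_mul _)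
          fun _ _ _ => add_mul _ _ _]
        refine Finset.sum_congr rfl fun p hp => ?_
        dsimp only
        rw [renamePair_placeDiag_rDiag, hplace _ hp, hr0, hr1, hfa,
          normalOrder_eq_aVal K hab j _ _ ((spread_support hp).1 π).2.2.2]
      -- In `r X^b` all letters `a` of `X` would have to be absorbed by `a_j`.
      have e3 : ∀ j, ((spread K s j).sum fun p c => c * Finsupp.linearCombination K
          (testFun w η Z₀ a b) (normalOrder K (renamePair (fun _ => j) (placeDiag fr rDiag).1)
            (placePair fb p))) = 0 := fun j => Finset.sum_eq_zero fun p hp => by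
        dsimp only
        rw [renamePair_placeDiag_rDiag, hplace _ hp, hr0, hr1, hfb,
          testFun_normalOrder_other K hab j _ _ (hne hp), mul_zero]
        refine hw.imp_right fun ⟨y, hy⟩ => ⟨y, ?_, hy⟩
        by_cases e : y = j
        · exact Or.inl e
        · exact Or.inr ((hmem hp y).1.2 e)
      -- In `X^b r` the letters `a` of `X` remain in the factor `b`.
      have e4 : ∀ j, ((spread K s j).sum fun p c => c * Finsupp.linearCombination K
          (testFun w η Z₀ a b) (normalOrder K (placePair fb p)
            (renamePair (fun _ => j) (placeDiag fr rDiag).1))) = 0 := fun j =>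
          Finset.sum_eq_zero fun p hp => by
        dsimp only
        rw [renamePair_placeDiag_rDiag, hplace _ hp, hr0, hr1, hfb,
          testFun_normalOrder_right K hab j _ _ (hne hp), mul_zero]
      simp only [e1, e2, e3, e4, Finset.sum_const_zero, sub_zero, add_zero, zero_sub,
        neg_eq_zero] at h0
      exact h0
  refine mk_eq_zero_of_spread K s fun j => spread_eq_zero_of_factorCoeff (fun p hp => hs' hp) ?_
  exact hc.eq_zero (by simpa using hk) j

end Commutant

/-! ### Extraction of coefficients -/

section Extraction

variable (K : Type*) [Field K] {n : ℕ} {Λ : Type} [DecidableEq Λ]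

theorem filter_lBefore_of_not {i j : Λ} (p : Λ → Bool) (w : List Λ) (h' : ¬ p j = true) :
    (lBefore i j w).filter p = w.filter p := by
  rw [← filter_lAfter_eq_filter_lBefore p w fun h => h' h.2, filter_lAfter_of_not p w h']

/-- If `l₀` is the first letter of the word `P ++ l₀ :: Q` that lies in `L`, then the position of
`j` in `P ++ j :: l₀ :: Q` can only arise by putting `j` before `l₀`. -/
theorem sum_insert_eq_ite {j l₀ : Λ} {P Q L u : List Λ} (hL : L.Nodup) (hl₀ : l₀ ∈ L)
    (hP : ∀ l ∈ P, l ∉ L) (hnd : (P ++ l₀ :: Q).Nodup) (hj : j ∉ P ++ l₀ :: Q) (hju : j ∉ u)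
    (hLu : ∀ l ∈ L, l ∈ u) :
    (L.map fun l => (if lBefore l j u = P ++ j :: l₀ :: Q then (1 : K) else 0)
      - if lAfter l j u = P ++ j :: l₀ :: Q then 1 else 0).sum =
      if u = P ++ l₀ :: Q then 1 else 0 := by
  have hf : ∀ v : List Λ, j ∉ v → v.filter (· ≠ j) = v := fun v hv =>
    List.filter_eq_self.2 fun a ha => by
      have : a ≠ j := fun e => hv (e ▸ ha)
      simpa using this
  have hPQ : (P ++ j :: l₀ :: Q).filter (· ≠ j) = P ++ l₀ :: Q := by
    rw [List.filter_append, List.filter_cons_of_neg (by simp), ← List.filter_append, hf _ hj]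
  have hb : ∀ l, lBefore l j u = P ++ j :: l₀ :: Q → u = P ++ l₀ :: Q := fun l h => by
    rw [← hPQ, ← h, filter_lBefore_of_not _ _ (by simp), hf _ hju]
  have ha : ∀ l, lAfter l j u = P ++ j :: l₀ :: Q → u = P ++ l₀ :: Q := fun l h => by
    rw [← hPQ, ← h, filter_lAfter_of_not _ _ (by simp), hf _ hju]
  by_cases hu : u = P ++ l₀ :: Q
  · subst hu
    rw [if_pos rfl]
    have hndj : (P ++ j :: l₀ :: Q).Nodup :=
      (List.nodup_middle (l₁ := P)).2 (List.nodup_cons.2 ⟨hj, hnd⟩)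
    have h1 : ∀ l ∈ L, ((if lBefore l j (P ++ l₀ :: Q) = P ++ j :: l₀ :: Q then (1 : K) else 0)
        - if lAfter l j (P ++ l₀ :: Q) = P ++ j :: l₀ :: Q then 1 else 0) =
        if l = l₀ then 1 else 0 := by
      intro l hl
      obtain ⟨P', Q', e⟩ := List.append_of_mem (hLu l hl)
      have hnd' := hnd
      rw [e] at hnd'
      have hl' : l ∉ P' ∧ l ∉ Q' := by
        have := List.nodup_cons.1 ((List.nodup_middle (l₁ := P')).1 hnd')
        simpa using this.1
      have h2 : ¬ lAfter l j (P ++ l₀ :: Q) = P ++ j :: l₀ :: Q := by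
        rw [e, lAfter_split hl'.1 hl'.2]
        intro h
        have e2 : P' ++ l :: j :: Q' = (P' ++ [l]) ++ j :: Q' := by simp
        rw [e2] at h
        have h3 := (split_unique hndj h.symm).1
        exact hP l (by rw [h3]; simp) hl
      rw [if_neg h2, sub_zero]
      refine if_congr ?_ rfl rfl
      rw [e, lBefore_split hl'.1 hl'.2]
      refine ⟨fun h => ?_, ?_⟩
      · exact (List.cons.inj (split_unique hndj h.symm).2).1.symm
      · rintro rfl
        have := split_unique hnd e
        rw [this.1, this.2]
    rw [List.map_congr_left h1]
    clear h1 hLu hP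
    induction L with
    | nil => simp at hl₀
    | cons a L ih =>
      rw [List.nodup_cons] at hL
      rw [List.map_cons, List.sum_cons]
      by_cases h : a = l₀
      · subst h
        have h3 : ∀ l ∈ L, (if l = a then (1 : K) else 0) = 0 := fun l hl =>
          if_neg fun e : l = a => hL.1 (e ▸ hl)
        rw [List.map_congr_left h3]
        simp
      · rw [if_neg h, zero_add]
        exact ih hL.2 (by simpa [Ne.symm h] using hl₀)
  · rw [if_neg hu]
    refine List.sum_eq_zero fun x hx => ?_
    obtain ⟨l, -, rfl⟩ := List.mem_map.1 hx
    rw [if_neg fun h => hu (hb l h), if_neg fun h => hu (ha l h), sub_zero]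

theorem length_le_lAfter (i j : Λ) (w : List Λ) : w.length ≤ (lAfter i j w).length := by
  induction w with
  | nil => exact Nat.le_refl _
  | cons a w ih =>
    rw [lAfter_cons, List.length_append, List.length_cons]
    split_ifs <;> simp only [List.length_cons, List.length_nil] <;> omega

theorem length_le_lBefore (i j : Λ) (w : List Λ) : w.length ≤ (lBefore i j w).length := by
  induction w with
  | nil => exact Nat.le_refl _
  | cons a w ih =>
    rw [lBefore_cons, List.length_append, List.length_cons]
    split_ifs <;> simp only [List.length_cons, List.length_nil] <;> omega

/-- If neither `a_j` is changed nor `b_j` is left over in factor `α`, then `b_j` has been absorbed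
by one of the letters that it met. -/
theorem normalOrder_left_eq_sum {α β : Fin n} (j : Λ) (A B : Words n Λ)
    (Φ : Words n Λ × Words n Λ → K) (h1 : ∀ U V, 2 ≤ (U β).length → Φ (U, V) = 0)
    (h2 : ∀ U V, V α ≠ [] → Φ (U, V) = 0) :
    Finsupp.linearCombination K Φ (normalOrder K (wordAt β [j], wordAt α [j]) (A, B)) =
      -((A α).map fun l => Φ (fun γ => wordAt β [j] γ ++ A γ, insBefore l j B)
        - Φ (fun γ => wordAt β [j] γ ++ A γ, insAfter l j B)).sum := by
  have key : ∀ rest pre, Finsupp.linearCombination K (stateFun K Φ)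
      (pushB K α j A B (wordAt β [j]) pre rest) =
      -(rest.map fun l => Φ (fun γ => wordAt β [j] γ ++
          Function.update A α (pre ++ rest) γ, insBefore l j B)
        - Φ (fun γ => wordAt β [j] γ ++
          Function.update A α (pre ++ rest) γ, insAfter l j B)).sum := by
    intro rest
    induction rest with
    | nil =>
      intro pre
      rw [pushB, Finsupp.linearCombination_single, one_smul, stateFun, h2 _ _ (by simp)]
      simp
    | cons l rest ih =>
      intro pre
      have h3 : ∀ X : Words n Λ, 2 ≤ (X β).length → Finsupp.linearCombination K (stateFun K Φ)
          (pushB K α j A B X pre rest) = 0 := by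
        intro X hX
        refine linearCombination_eq_zero K _ _ fun s hs => h1 _ _ ?_
        have h4 : 2 ≤ (s.1 β).length := pushB_mem_supported K α j A B
          (fun X _ _ => 2 ≤ (X β).length) (fun s => 2 ≤ (s.1 β).length) (fun X pre h => h)
          (fun X pre l rest h => ⟨h, h.trans (length_le_lAfter _ _ _),
            h.trans (length_le_lBefore _ _ _), h, h⟩) X pre rest hX hs
        rw [List.length_append]
        omega
      have e : pre ++ [l] ++ rest = pre ++ l :: rest := by simp
      rw [pushB, map_sub, map_sub, map_sub, map_sub, ih, h3, h3, e,
        Finsupp.linearCombination_single, Finsupp.linearCombination_single, List.map_cons,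
        List.sum_cons, stateFun, stateFun]
      · simp only [one_smul]
        ring
      · rw [insBefore_wordAt, wordAt_self]; simp [lBefore]
      · rw [insAfter_wordAt, wordAt_self]; simp [lAfter]
  rw [linearCombination_normalOrder, letters_wordAt]
  simp only [List.map_cons, List.map_nil, List.foldr_cons, List.foldr_nil]
  rw [moveB, Finsupp.linearCombination_single, one_smul]
  dsimp only
  rw [key, List.nil_append, Function.update_eq_self]

/-- If neither `b_j` is changed nor `a_j` is left over in factor `α`, then `a_j` has been absorbed
by one of the partners of the letters that it met. -/
theorem normalOrder_right_eq_sum {α β : Fin n} (hαβ : α ≠ β) (j : Λ) (X B : Words n Λ)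
    (hB : B β = []) (Φ : Words n Λ × Words n Λ → K) (h1 : ∀ U V, 2 ≤ (V β).length → Φ (U, V) = 0)
    (h2 : ∀ U V, U α ≠ [] → Φ (U, V) = 0) :
    Finsupp.linearCombination K Φ (normalOrder K (X, B) (wordAt α [j], wordAt β [j])) =
      -((B α).map fun l => Φ (insAfter l j X, fun γ => B γ ++ wordAt β [j] γ)
        - Φ (insBefore l j X, fun γ => B γ ++ wordAt β [j] γ)).sum := by
  have hzero : ∀ (L : List (Fin n × Λ)) (s : State n Λ), 2 ≤ (s.2.2 β).length →
      Finsupp.linearCombination K (stateFun K Φ)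
        (L.foldr (fun p => moveB K p.1 p.2) (Finsupp.single s 1)) = 0 := by
    intro L s hs
    refine linearCombination_eq_zero K _ _ fun t ht => h1 _ _ ?_
    refine foldr_moveB_mem_supported K (fun _ s => 2 ≤ (s.2.2 β).length) (fun p L s hs => ?_)
      L [] s hs ht
    refine pushB_mem_supported K _ _ _ _ (fun _ _ _ => True) _ (fun X pre _ => ?_)
      (fun X pre l rest _ => ⟨trivial, trivial, trivial, hs.trans (length_le_lBefore _ _ _),
        hs.trans (length_le_lAfter _ _ _)⟩) _ _ _ trivial
    dsimp only
    by_cases hβ : β = p.1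
    · subst hβ
      rw [Function.update_self, List.length_cons]
      omega
    · rwa [Function.update_of_ne hβ]
  have key : ∀ (L : List (Fin n × Λ)), (∀ p ∈ L, p.1 ≠ β) → ∀ B' : Words n Λ, B' β = [j] →
      Finsupp.linearCombination K (stateFun K Φ)
        (L.foldr (fun p => moveB K p.1 p.2) (Finsupp.single (X, wordAt α [j], B') 1)) =
      -(((L.filter fun p => p.1 = α).map Prod.snd).map fun l =>
        Φ (insAfter l j X, fun γ => (L.filter fun p => p.1 = γ).map Prod.snd ++ B' γ)
        - Φ (insBefore l j X, fun γ => (L.filter fun p => p.1 = γ).map Prod.snd ++ B' γ)).sum := by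
    intro L
    induction L using List.reverseRecOn with
    | nil =>
      intro _ B' _
      rw [List.foldr_nil, Finsupp.linearCombination_single, one_smul, stateFun, h2 _ _ (by
        dsimp only; rw [wordAt_self]; simp)]
      simp
    | append_singleton L p ih =>
      intro hL B' hB'
      have hL' : ∀ q ∈ L, q.1 ≠ β := fun q hq => hL q (by simp [hq])
      have hp : β ≠ p.1 := Ne.symm (hL p (by simp))
      have hup : Function.update B' p.1 (p.2 :: B' p.1) β = [j] := by
        rw [Function.update_of_ne hp, hB']
      have hV : (fun γ => ((L ++ [p]).filter fun q => q.1 = γ).map Prod.snd ++ B' γ) =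
          fun γ => (L.filter fun q => q.1 = γ).map Prod.snd ++
            Function.update B' p.1 (p.2 :: B' p.1) γ := by
        funext γ
        by_cases hγ : p.1 = γ
        · subst hγ; simp
        · simp [hγ, Function.update_of_ne (Ne.symm hγ)]
      rw [List.foldr_append, List.foldr_cons, List.foldr_nil, hV]
      by_cases hα : p.1 = α
      · rw [moveB_single_of_eq_singleton K p.1 p.2 j _ _ _ (by rw [hα, wordAt_self])]
        have h3 : 2 ≤ (insBefore j p.2 B' β).length := by simp [insBefore, hB']
        have h4 : 2 ≤ (insAfter j p.2 B' β).length := by simp [insAfter, hB']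
        simp only [foldr_moveB_sub, map_sub]
        rw [hzero L (X, _, insBefore j p.2 B') h3, hzero L (X, _, insAfter j p.2 B') h4,
          ih hL' _ hup]
        have h5 : Function.update (wordAt α [j]) p.1 [] = fun _ => [] := by
          rw [hα, update_wordAt, wordAt_nil]
        rw [h5, foldr_moveB_of_eq_nil K _ _ _ _ fun _ _ => rfl,
          foldr_moveB_of_eq_nil K _ _ _ _ fun _ _ => rfl,
          Finsupp.linearCombination_single, Finsupp.linearCombination_single, stateFun, stateFun]
        simp only [List.append_nil, one_smul, List.filter_append, List.map_append]
        rw [List.filter_cons_of_pos (by simpa using hα)]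
        simp only [List.filter_nil, List.map_cons, List.map_nil, List.sum_append, List.sum_cons,
          List.sum_nil]
        ring
      · rw [moveB_single_of_eq_nil K _ _ _ _ _ (wordAt_of_ne hα _), ih hL' _ hup,
          List.filter_append, List.filter_cons_of_neg (by simpa using hα), List.filter_nil,
          List.append_nil]
  rw [linearCombination_normalOrder]
  dsimp only
  rw [key _ (fun p hp e => ?_) _ (wordAt_self _ _)]
  · simp only [map_snd_filter_letters]
  · have := (mem_letters _ _).1 hp
    rw [e, hB] at this
    simp at this

end Extraction

section Coefficients

variable (K : Type*) [Field K] {n m k : ℕ}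

theorem spread_add (s t : Diag n k →₀ K) (j : Fin (k + 1)) :
    spread K (s + t) j = spread K s j + spread K t j := by
  rw [spread, spread, spread, ← Finset.sum_add_distrib]
  refine Finset.sum_congr rfl fun σ _ => ?_
  split_ifs
  · exact Finsupp.mapDomain_add
  · exact (add_zero 0).symm

/-- Diagrams whose relabellings do not occur in `spread` do not contribute to the class of `s`. -/
theorem mk_filter_eq [CharZero K] (s : Diag n k →₀ K)
    (Q : ∀ {Λ : Type}, Words n Λ × Words n Λ → Prop)
    (hQ : ∀ {Λ Λ' : Type} (f : Λ → Λ') p, Q (renamePair f p) ↔ Q p)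
    [DecidablePred fun d : Diag n k => Q d.1] (h : ∀ j, ∀ p ∈ (spread K s j).support, Q p) :
    Representation.Coinvariants.mk (relabelRep K n k) (s.filter fun d => Q d.1) =
      Representation.Coinvariants.mk (relabelRep K n k) s := by
  conv_rhs => rw [← Finsupp.filter_add_filter_not s fun d => Q d.1]
  rw [map_add, mk_eq_zero_of_spread K (s.filter fun d => ¬ Q d.1), add_zero]
  intro j
  ext p
  rw [Finsupp.zero_apply]
  by_cases hp : Q p
  · by_contra hne
    refine spread_support_of_forall (K := K) (fun p => ¬ Q p) (fun f p hp => ?_) (fun d hd => ?_)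
      (Finsupp.mem_support_iff.2 hne) hp
    · rwa [hQ]
    · rw [Finsupp.support_filter, Finset.mem_filter] at hd
      exact hd.2
  · have h1 : spread K s j p = 0 := by
      by_contra hne
      exact hp (h j p (Finsupp.mem_support_iff.2 hne))
    have h2 : spread K (s.filter fun d => Q d.1) j p = 0 := by
      by_contra hne
      refine hp (spread_support_of_forall (K := K) (fun p => Q p) (fun f p hp => ?_)
        (fun d hd => ?_) (Finsupp.mem_support_iff.2 hne))
      · rwa [hQ]
      · rw [Finsupp.support_filter, Finset.mem_filter] at hd
        exact hd.2
    rw [← Finsupp.filter_add_filter_not s fun d => Q d.1, spread_add, Finsupp.add_apply, h2,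
      zero_add] at h1
    exact h1

open Classical in
theorem sum_spread_ite (s : Diag n k →₀ K) (j₀ : Fin (k + 1))
    (p₀ : Words n (Fin (k + 1)) × Words n (Fin (k + 1))) :
    ∑ j, (spread K s j).sum (fun p c => c * if j = j₀ ∧ p = p₀ then 1 else 0) =
      spread K s j₀ p₀ := by
  rw [Finset.sum_eq_single j₀]
  · simp [eq_comm]
  · intro j _ hj
    simp [hj]
  · simp

theorem exists_first_mem {Λ : Type} (L u : List Λ) (h : ∃ l ∈ u, l ∈ L) :
    ∃ P l₀ Q, u = P ++ l₀ :: Q ∧ l₀ ∈ L ∧ ∀ l ∈ P, l ∉ L := by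
  induction u with
  | nil => simp at h
  | cons a u ih =>
    by_cases ha : a ∈ L
    · exact ⟨[], a, u, rfl, ha, by simp⟩
    · obtain ⟨l, hl, hL⟩ := h
      have hl' : l ∈ u := by
        rcases List.mem_cons.1 hl with rfl | h
        exacts [absurd hL ha, h]
      obtain ⟨P, l₀, Q, e, h1, h2⟩ := ih ⟨l, hl', hL⟩
      refine ⟨a :: P, l₀, Q, by rw [e]; rfl, h1, fun x hx => ?_⟩
      rcases List.mem_cons.1 hx with rfl | hx
      exacts [ha, h2 x hx]

theorem placeWords_apply {Λ : Type} (f : Fin n ↪ Fin m) (W : Words n Λ) (α : Fin n) :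
    placeWords f W (f α) = W α := f.injective.extend_apply ..

theorem placeWords_of_notMem {Λ : Type} (f : Fin n ↪ Fin m) (W : Words n Λ) {β : Fin m}
    (hβ : ∀ α, f α ≠ β) : placeWords f W β = [] :=
  Function.extend_apply' _ _ _ fun ⟨α, h⟩ => hβ α h

/-- If all letters `b` of `X` stand in the first factor, and `r^{2,3} X^{1,3}` has only terms with
letters `b` outside of the first factor, then no letter `a` of `X` stands in the second
factor. -/
theorem fst_one_eq_nil_of_mem {f fr : Fin 2 ↪ Fin m} {β : Fin m} (hβ : ∀ α, f α ≠ β)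
    (hr0 : fr 0 = β) (hr1 : fr 1 = f 1) (s : Diag 2 k →₀ K)
    (hs : ∀ d ∈ s.support, d.1.2 1 = [])
    (h : gmul K (add_comm 1 k) ((placeDiag fr rDiag).toUniv K)
        (place K f (Representation.Coinvariants.mk (relabelRep K 2 k) s)) ∈
      diagSpan K fun d : Diag m (k + 1) => d.1.2 β ≠ [] ∨ d.1.2 (f 1) ≠ [])
    (j₀ : Fin (k + 1)) (p₀ : Words 2 (Fin (k + 1)) × Words 2 (Fin (k + 1)))
    (hp₀ : p₀ ∈ (spread K s j₀).support) : p₀.1 1 = [] := by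
  classical
  by_contra hne
  have hs' : ∀ {j p}, p ∈ (spread K s j).support → p.2 1 = [] := fun hp =>
    spread_support_of_forall (K := K) (fun p => p.2 1 = [])
      (fun f p hp => (rename_eq_nil _ _ _).2 hp) hs hp
  have hmem : ∀ {j p}, p ∈ (spread K s j).support → ∀ l, l ≠ j → l ∈ p.2 0 := by
    intro j p hp l hl
    obtain ⟨α, hα⟩ := ((spread_support hp).2 l hl).2
    obtain rfl | rfl : α = 0 ∨ α = 1 := by omega
    · exact hα
    · rw [hs' hp] at hα; simp at hα
  have h01 : f 1 ≠ f 0 := fun e => by simpa using f.injective e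
  obtain ⟨l, hl⟩ := List.exists_mem_of_ne_nil _ hne
  obtain ⟨P, l₀, Q, e, hl₀, hP⟩ := exists_first_mem (p₀.1 1) (p₀.2 0)
    ⟨l, hmem hp₀ l (fun e => ((spread_support hp₀).1 1).2.2.1 (e ▸ hl)), hl⟩
  -- Let `b_{j₀}` be absorbed by `b_{l₀}`, `l₀` being the first letter of `p₀.2 0` whose partner `a`
  -- stands in the second factor.
  let Φ : Words m (Fin (k + 1)) × Words m (Fin (k + 1)) → K := fun d =>
    if d.1 = (fun γ => wordAt β [j₀] γ ++ placeWords f p₀.1 γ) ∧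
      d.2 = wordAt (f 0) (P ++ j₀ :: l₀ :: Q) then 1 else 0
  have h1 : ∀ U V, 2 ≤ (U β).length → Φ (U, V) = 0 := fun U V hU => if_neg fun h => by
    have h2 : U = _ := h.1
    rw [h2] at hU
    dsimp only at hU
    rw [wordAt_self, placeWords_of_notMem f _ hβ] at hU
    simp at hU
  have h2 : ∀ U V, V (f 1) ≠ [] → Φ (U, V) = 0 := fun U V hV => if_neg fun h => by
    have h2 : V = _ := h.2
    rw [h2, wordAt_of_ne h01] at hV
    exact hV rfl
  have h3 := symmFun_eq_zero K (Φ := Φ) (fun d hd σ => ?_) h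
  swap
  · rcases hd with hd | hd
    · refine if_neg fun h => hd ?_
      have h2 : (σ • d).1.2 = _ := h.2
      rw [← rename_eq_nil σ]
      change (σ • d).1.2 β = []
      rw [h2, wordAt_of_ne (Ne.symm (hβ 0))]
    · exact h2 _ _ (by simpa only [ne_eq, rename_eq_nil] using hd)
  rw [symmFun_gmul_left] at h3
  have h4 : ∀ j, ((spread K s j).sum fun p c => c * Finsupp.linearCombination K Φ
      (normalOrder K (renamePair (fun _ => j) (placeDiag fr rDiag).1) (placePair f p))) =
      -(spread K s j).sum fun p c => c * if j = j₀ ∧ p = p₀ then 1 else 0 := by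
    intro j
    rw [Finsupp.sum, Finsupp.sum, ← Finset.sum_neg_distrib]
    refine Finset.sum_congr rfl fun p hp => ?_
    have hB : placeWords f p.2 = wordAt (f 0) (p.2 0) :=
      placeWords_eq_wordAt f 0 _ fun π' hπ => by
        obtain rfl : π' = 1 := by omega
        exact hs' hp
    rw [renamePair_placeDiag_rDiag, placePair, hr0, hr1, normalOrder_left_eq_sum K j _ _ Φ h1 h2,
      placeWords_apply, hB, ← mul_neg]
    congr 2
    simp only [insAfter_wordAt, insBefore_wordAt]
    have hw : ∀ w w' : List (Fin (k + 1)), wordAt (f 0) w = wordAt (f 0) w' ↔ w = w' :=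
      fun w w' => ⟨fun h => by rw [← wordAt_self (f 0) w, h, wordAt_self], fun h => by rw [h]⟩
    by_cases hU : j = j₀ ∧ p.1 = p₀.1
    · obtain ⟨rfl, hp1⟩ := hU
      have h5 : ∀ w, Φ (fun γ => wordAt β [j] γ ++ placeWords f p.1 γ, wordAt (f 0) w) =
          if w = P ++ j :: l₀ :: Q then 1 else 0 := fun w => by
        simp only [Φ, hp1, hw, true_and]
      simp only [h5]
      have hsp := (spread_support hp).1
      have hsp₀ := (spread_support hp₀).1 0
      rw [e] at hsp₀
      rw [hp1, sum_insert_eq_ite K (hp1 ▸ (hsp 1).1) hl₀ hP hsp₀.2.1 hsp₀.2.2.2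
        (hsp 0).2.2.2 (fun l hl => hmem hp l fun e => (hsp 1).2.2.1 (e ▸ hp1 ▸ hl))]
      refine if_congr ⟨fun h => ⟨trivial, Prod.ext hp1 (funext fun α => ?_)⟩, ?_⟩ rfl rfl
      · obtain rfl | rfl : α = 0 ∨ α = 1 := by omega
        · rw [h, e]
        · rw [hs' hp, hs' hp₀]
      · rintro ⟨-, rfl⟩
        exact e
    · have h5 : ∀ w, Φ (fun γ => wordAt β [j] γ ++ placeWords f p.1 γ, wordAt (f 0) w) = 0 := by
        refine fun w => if_neg fun h => hU ⟨?_, funext fun α => ?_⟩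
        · have h6 := congrFun h.1 β
          dsimp only at h6
          rw [wordAt_self, wordAt_self, placeWords_of_notMem f _ hβ,
            placeWords_of_notMem f _ hβ] at h6
          simpa using h6
        · have h6 := congrFun h.1 (f α)
          dsimp only at h6
          rwa [wordAt_of_ne (hβ α), wordAt_of_ne (hβ α), placeWords_apply,
            placeWords_apply] at h6
      rw [if_neg fun h => hU ⟨h.1, by rw [h.2]⟩]
      simp [h5]
  simp only [h4, Finset.sum_neg_distrib, sum_spread_ite, neg_eq_zero] at h3
  exact Finsupp.mem_support_iff.1 hp₀ h3

/-- If all letters `a` of `X` stand in the second factor, and `X^{1,3} r^{1,2}` has only terms with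
letters `a` outside of the third factor, then no letter `b` of `X` stands in the first
factor. -/
theorem snd_zero_eq_nil_of_mem {f fr : Fin 2 ↪ Fin m} {β : Fin m} (hβ : ∀ α, f α ≠ β)
    (hr0 : fr 0 = f 0) (hr1 : fr 1 = β) (s : Diag 2 k →₀ K)
    (hs : ∀ d ∈ s.support, d.1.1 0 = [])
    (h : gmul K rfl (place K f (Representation.Coinvariants.mk (relabelRep K 2 k) s))
        ((placeDiag fr rDiag).toUniv K) ∈
      diagSpan K fun d : Diag m (k + 1) => d.1.1 (f 0) ≠ [] ∨ d.1.1 β ≠ [])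
    (j₀ : Fin (k + 1)) (p₀ : Words 2 (Fin (k + 1)) × Words 2 (Fin (k + 1)))
    (hp₀ : p₀ ∈ (spread K s j₀).support) : p₀.2 0 = [] := by
  classical
  by_contra hne
  have hs' : ∀ {j p}, p ∈ (spread K s j).support → p.1 0 = [] := fun hp =>
    spread_support_of_forall (K := K) (fun p => p.1 0 = [])
      (fun f p hp => (rename_eq_nil _ _ _).2 hp) hs hp
  have hmem : ∀ {j p}, p ∈ (spread K s j).support → ∀ l, l ≠ j → l ∈ p.1 1 := by
    intro j p hp l hl
    obtain ⟨α, hα⟩ := ((spread_support hp).2 l hl).1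
    obtain rfl | rfl : α = 0 ∨ α = 1 := by omega
    · rw [hs' hp] at hα; simp at hα
    · exact hα
  have h01 : f 0 ≠ f 1 := fun e => by simpa using f.injective e
  obtain ⟨l, hl⟩ := List.exists_mem_of_ne_nil _ hne
  obtain ⟨P, l₀, Q, e, hl₀, hP⟩ := exists_first_mem (p₀.2 0) (p₀.1 1)
    ⟨l, hmem hp₀ l (fun e => ((spread_support hp₀).1 0).2.2.2 (e ▸ hl)), hl⟩
  -- Let `a_{j₀}` be absorbed by `a_{l₀}`, `l₀` being the first letter of `p₀.1 1` whose partner `b`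
  -- stands in the first factor.
  let Φ : Words m (Fin (k + 1)) × Words m (Fin (k + 1)) → K := fun d =>
    if d.2 = (fun γ => placeWords f p₀.2 γ ++ wordAt β [j₀] γ) ∧
      d.1 = wordAt (f 1) (P ++ j₀ :: l₀ :: Q) then 1 else 0
  have h1 : ∀ U V, 2 ≤ (V β).length → Φ (U, V) = 0 := fun U V hV => if_neg fun h => by
    have h2 : V = _ := h.1
    rw [h2] at hV
    dsimp only at hV
    rw [wordAt_self, placeWords_of_notMem f _ hβ] at hV
    simp at hV
  have h2 : ∀ U V, U (f 0) ≠ [] → Φ (U, V) = 0 := fun U V hU => if_neg fun h => by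
    have h2 : U = _ := h.2
    rw [h2, wordAt_of_ne h01] at hU
    exact hU rfl
  have h3 := symmFun_eq_zero K (Φ := Φ) (fun d hd σ => ?_) h
  swap
  · rcases hd with hd | hd
    · exact h2 _ _ (by simpa only [ne_eq, rename_eq_nil] using hd)
    · refine if_neg fun h => hd ?_
      have h2 : (σ • d).1.1 = _ := h.2
      rw [← rename_eq_nil σ]
      change (σ • d).1.1 β = []
      rw [h2, wordAt_of_ne (Ne.symm (hβ 1))]
  rw [symmFun_gmul_right] at h3
  have h4 : ∀ j, ((spread K s j).sum fun p c => c * Finsupp.linearCombination K Φ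
      (normalOrder K (placePair f p) (renamePair (fun _ => j) (placeDiag fr rDiag).1))) =
      (spread K s j).sum fun p c => c * if j = j₀ ∧ p = p₀ then 1 else 0 := by
    intro j
    refine Finset.sum_congr rfl fun p hp => ?_
    have hA : placeWords f p.1 = wordAt (f 1) (p.1 1) :=
      placeWords_eq_wordAt f 1 _ fun π' hπ => by
        obtain rfl : π' = 0 := by omega
        exact hs' hp
    dsimp only
    rw [renamePair_placeDiag_rDiag, placePair, hr0, hr1, normalOrder_right_eq_sum K (hβ 0) j _ _
      (placeWords_of_notMem f _ hβ) Φ h1 h2, placeWords_apply, hA, List.sum_neg]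
    congr 1
    simp only [List.map_map, Function.comp_def, neg_sub, insAfter_wordAt, insBefore_wordAt]
    have hw : ∀ w w' : List (Fin (k + 1)), wordAt (f 1) w = wordAt (f 1) w' ↔ w = w' :=
      fun w w' => ⟨fun h => by rw [← wordAt_self (f 1) w, h, wordAt_self], fun h => by rw [h]⟩
    by_cases hU : j = j₀ ∧ p.2 = p₀.2
    · obtain ⟨rfl, hp1⟩ := hU
      have h5 : ∀ w, Φ (wordAt (f 1) w, fun γ => placeWords f p.2 γ ++ wordAt β [j] γ) =
          if w = P ++ j :: l₀ :: Q then 1 else 0 := fun w => by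
        simp only [Φ, hp1, hw, true_and]
      simp only [h5]
      have hsp := (spread_support hp).1
      have hsp₀ := (spread_support hp₀).1 1
      rw [e] at hsp₀
      rw [hp1, sum_insert_eq_ite K (hp1 ▸ (hsp 0).2.1) hl₀ hP hsp₀.1 hsp₀.2.2.1
        (hsp 1).2.2.1 (fun l hl => hmem hp l fun e => (hsp 0).2.2.2 (e ▸ hp1 ▸ hl))]
      refine if_congr ⟨fun h => ⟨trivial, Prod.ext (funext fun α => ?_) hp1⟩, ?_⟩ rfl rfl
      · obtain rfl | rfl : α = 0 ∨ α = 1 := by omega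
        · rw [hs' hp, hs' hp₀]
        · rw [h, e]
      · rintro ⟨-, rfl⟩
        exact e
    · have h5 : ∀ w, Φ (wordAt (f 1) w, fun γ => placeWords f p.2 γ ++ wordAt β [j] γ) = 0 := by
        refine fun w => if_neg fun h => hU ⟨?_, funext fun α => ?_⟩
        · have h6 := congrFun h.1 β
          dsimp only at h6
          rw [wordAt_self, wordAt_self, placeWords_of_notMem f _ hβ,
            placeWords_of_notMem f _ hβ] at h6
          simpa using h6
        · have h6 := congrFun h.1 (f α)
          dsimp only at h6
          rwa [wordAt_of_ne (hβ α), wordAt_of_ne (hβ α), placeWords_apply,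
            placeWords_apply, List.append_nil, List.append_nil] at h6
      rw [if_neg fun h => hU ⟨h.1, by rw [h.2]⟩]
      simp [h5]
  simp only [h4, sum_spread_ite] at h3
  exact Finsupp.mem_support_iff.1 hp₀ h3

end Coefficients

/-! ### The quantum Yang-Baxter equation to first order -/

section QYBE

variable {K : Type*} [Field K] {m k : ℕ}

/-- The embedding of tensor factors underlying `x ↦ x^{i,j}`. -/
def legEmb (i j : Fin m) (h : i ≠ j) : Fin 2 ↪ Fin m := ⟨![i, j], by
  intro a b hab
  fin_cases a <;> fin_cases b <;> simp_all⟩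

theorem legEmb_ne {i j l : Fin m} (h : i ≠ j) (hi : i ≠ l) (hj : j ≠ l) (α : Fin 2) :
    legEmb i j h α ≠ l := by
  obtain rfl | rfl : α = 0 ∨ α = 1 := by omega
  · exact hi
  · exact hj

theorem leg_apply {i j : Fin m} (h : i ≠ j) (x : UnivHat K 2) (N : ℕ) :
    leg i j h x N = place K (legEmb i j h) (x N) := rfl

theorem place_mem_spanB {n N : ℕ} (f : Fin n ↪ Fin m) {α : Fin n} {β : Fin m} (h : f α = β)
    {u : Univ K n N} (hu : u ∈ spanB K α) : place K f u ∈ spanB K β := by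
  subst h
  exact place_mem_diagSpan K f (fun d hd => (placeWords_apply f d.1.2 α).trans_ne hd) hu

theorem place_mem_spanA {n N : ℕ} (f : Fin n ↪ Fin m) {α : Fin n} {β : Fin m} (h : f α = β)
    {u : Univ K n N} (hu : u ∈ spanA K α) : place K f u ∈ spanA K β := by
  subst h
  exact place_mem_diagSpan K f (fun d hd => (placeWords_apply f d.1.1 α).trans_ne hd) hu

theorem place_mem_fst_nil {n N : ℕ} (f : Fin n ↪ Fin m) {β : Fin m} (hβ : ∀ α, f α ≠ β)
    (u : Univ K n N) : place K f u ∈ diagSpan K fun d => d.1.1 β = [] :=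
  place_mem_diagSpan K f (fun d _ => placeWords_of_notMem f d.1.1 hβ) (diagSpan_true K u)

theorem place_mem_snd_nil {n N : ℕ} (f : Fin n ↪ Fin m) {β : Fin m} (hβ : ∀ α, f α ≠ β)
    (u : Univ K n N) : place K f u ∈ diagSpan K fun d => d.1.2 β = [] :=
  place_mem_diagSpan K f (fun d _ => placeWords_of_notMem f d.1.2 hβ) (diagSpan_true K u)

theorem place_mk_mem_fst_nil {n N : ℕ} (f : Fin n ↪ Fin m) {α : Fin n} {β : Fin m}
    (h : f α = β) (s : Diag n N →₀ K) (hs : ∀ d ∈ s.support, d.1.1 α = []) :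
    place K f (Representation.Coinvariants.mk (relabelRep K n N) s) ∈
      diagSpan K fun d => d.1.1 β = [] := by
  subst h
  exact place_mem_diagSpan K f (fun d hd => (placeWords_apply f d.1.1 α).trans hd)
    (mk_mem_diagSpan K s hs)

theorem place_mk_mem_snd_nil {n N : ℕ} (f : Fin n ↪ Fin m) {α : Fin n} {β : Fin m}
    (h : f α = β) (s : Diag n N →₀ K) (hs : ∀ d ∈ s.support, d.1.2 α = []) :
    place K f (Representation.Coinvariants.mk (relabelRep K n N) s) ∈
      diagSpan K fun d => d.1.2 β = [] := by
  subst h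
  exact place_mem_diagSpan K f (fun d hd => (placeWords_apply f d.1.2 α).trans hd)
    (mk_mem_diagSpan K s hs)

theorem rDiag_mem_spanB (f : Fin 2 ↪ Fin m) {β : Fin m} (h : f 1 = β) :
    (placeDiag f rDiag).toUniv K ∈ spanB K β := by
  subst h
  exact toUniv_mem_diagSpan K
    ((placeWords_apply f rDiag.1.2 1).trans_ne (List.cons_ne_nil 0 []))

theorem rDiag_mem_spanA (f : Fin 2 ↪ Fin m) {β : Fin m} (h : f 0 = β) :
    (placeDiag f rDiag).toUniv K ∈ spanA K β := by
  subst h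
  exact toUniv_mem_diagSpan K
    ((placeWords_apply f rDiag.1.1 0).trans_ne (List.cons_ne_nil 0 []))

theorem place_emptyDiag {n : ℕ} (f : Fin n ↪ Fin m) :
    place K f ((emptyDiag n).toUniv K) = (emptyDiag m).toUniv K := by
  rw [place_toUniv]
  congr 1
  refine Subtype.ext (Prod.ext (funext fun β => ?_) (funext fun β => ?_)) <;>
  · by_cases h : ∃ α, f α = β
    · obtain ⟨α, rfl⟩ := h
      exact placeWords_apply f _ α
    · exact placeWords_of_notMem f _ fun α e => h ⟨α, e⟩

theorem exists_pos_of_mem_diagSpan {n : ℕ} {P : Diag n k → Prop} (Q : Diag n k → Prop)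
    (u : Univ K n k) (h : ∀ d, P d ∨ Q d) :
    ∃ s : Diag n k →₀ K, (∀ d ∈ s.support, P d) ∧
      u - Representation.Coinvariants.mk (relabelRep K n k) s ∈ diagSpan K Q := by
  classical
  obtain ⟨t, rfl⟩ := Representation.Coinvariants.mk_surjective (relabelRep K n k) u
  refine ⟨t.filter P, fun d hd => ?_, ?_⟩
  · rw [Finsupp.support_filter, Finset.mem_filter] at hd
    exact hd.2
  · rw [← map_sub]
    have h1 : t - t.filter P = t.filter fun d => ¬ P d := by
      rw [sub_eq_iff_eq_add, add_comm, Finsupp.filter_add_filter_not]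
    rw [h1]
    refine mk_mem_diagSpan K _ fun d hd => ?_
    rw [Finsupp.support_filter, Finset.mem_filter] at hd
    exact (h d).resolve_left hd.2

/-- The product of an element of degree `1` and one of degree `k`. -/
noncomputable abbrev mulL (K : Type*) [Field K] {m k : ℕ} (u : Univ K m 1) (v : Univ K m k) :
    Univ K m (k + 1) := gmul K (add_comm 1 k) u v

/-- The product of an element of degree `k` and one of degree `1`. -/
noncomputable abbrev mulR (K : Type*) [Field K] {m k : ℕ} (u : Univ K m k) (v : Univ K m 1) :
    Univ K m (k + 1) := gmul K rfl u v

/-- The first order part of the equation `x y z = z y x` in degree `k + 1`. -/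
theorem commutator_mem_of_mul_mul_eq (hk : 2 ≤ k) (x y z : UnivHat K m)
    (hxyz : x * y * z = z * y * x)
    (hx : x 0 = (emptyDiag m).toUniv K) (hy : y 0 = (emptyDiag m).toUniv K)
    (hz : z 0 = (emptyDiag m).toUniv K) (D : Submodule K (Univ K m (k + 1)))
    (hD : ∀ p q r m' (hm : p + q = m') (h : m' + r = k + 1), p < k → q < k → r < k →
      gmul K h (gmul K hm (x p) (y q)) (z r) ∈ D)
    (hD' : ∀ p q r m' (hm : p + q = m') (h : m' + r = k + 1), p < k → q < k → r < k →
      gmul K h (gmul K hm (z p) (y q)) (x r) ∈ D) :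
    (mulL K (x 1) (y k) + mulR K (x k) (y 1) + mulL K (x 1) (z k) + mulR K (x k) (z 1)
      + mulL K (y 1) (z k) + mulR K (y k) (z 1))
    - (mulL K (z 1) (y k) + mulR K (z k) (y 1) + mulL K (z 1) (x k) + mulR K (z k) (x 1)
      + mulL K (y 1) (x k) + mulR K (y k) (x 1)) ∈ D := by
  have h1 := mul_mul_linear k hk x y z hx hy hz D hD
  have h2 := mul_mul_linear k hk z y x hz hy hx D hD'
  rw [hxyz] at h1
  have h3 := D.sub_mem h2 h1
  refine (congrArg (· ∈ D) ?_).mp h3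
  simp only [mulL, mulR]
  abel

theorem homComp_apply_self {n : ℕ} (N : ℕ) (x : UnivHat K n) : homComp K N x N = x N :=
  Pi.single_eq_same (M := fun N => Univ K n N) N (x N)

theorem homComp_apply_of_ne {n N M : ℕ} (h : M ≠ N) (x : UnivHat K n) : homComp K N x M = 0 :=
  Pi.single_eq_of_ne (M := fun N => Univ K n N) h (x N)

variable [CharZero K] {R : UnivHat K 2}

/-- The induction step for the second tensor factor. -/
theorem mem_spanB_of_forall_lt (hR : IsQYBESolution R) (hR0 : R 0 = (emptyDiag 2).toUniv K)
    (hR1 : R 1 = rDiag.toUniv K) (hk : 2 ≤ k)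
    (ih : ∀ p, 1 ≤ p → p < k → R p ∈ spanB K (1 : Fin 2)) : R k ∈ spanB K (1 : Fin 2) := by
  set f01 : Fin 2 ↪ Fin 3 := legEmb 0 1 (by decide) with hf01
  set f02 : Fin 2 ↪ Fin 3 := legEmb 0 2 (by decide) with hf02
  set f12 : Fin 2 ↪ Fin 3 := legEmb 1 2 (by decide) with hf12
  have n01 : ∀ α, f01 α ≠ 2 := legEmb_ne _ (by decide) (by decide)
  have n02 : ∀ α, f02 α ≠ 1 := legEmb_ne _ (by decide) (by decide)
  have hy : ∀ p, 1 ≤ p → p < k → place K f02 (R p) ∈ spanB K (2 : Fin 3) := fun p h h' =>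
    place_mem_spanB f02 (α := 1) rfl (ih p h h')
  have hz : ∀ p, 1 ≤ p → p < k → place K f12 (R p) ∈ spanB K (2 : Fin 3) := fun p h h' =>
    place_mem_spanB f12 (α := 1) rfl (ih p h h')
  have he : ∀ (f : Fin 2 ↪ Fin 3), place K f (R 0) ∈ diagSpan K fun d => d.1.1 2 = [] := by
    intro f
    rw [hR0, place_emptyDiag]
    exact toUniv_mem_diagSpan K rfl
  have h1 := commutator_mem_of_mul_mul_eq (k := k) hk _ _ _ hR
    (by rw [leg_apply, hR0, place_emptyDiag]) (by rw [leg_apply, hR0, place_emptyDiag])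
    (by rw [leg_apply, hR0, place_emptyDiag]) (spanB K (2 : Fin 3))
    (fun p q r m hm h hp hq hr => by
      by_cases hr0 : r = 0
      · subst hr0
        exact gmul_mem_spanB_left K h
          (gmul_mem_spanB_right K hm _ (hy q (by omega) hq)) (he f12)
      · exact gmul_mem_spanB_right K h _ (hz r (by omega) hr))
    (fun p q r m hm h hp hq hr => by
      refine gmul_mem_spanB_left K h ?_ (place_mem_fst_nil f01 n01 _)
      by_cases hq0 : q = 0
      · subst hq0
        exact gmul_mem_spanB_left K hm (hz p (by omega) hp) (he f02)
      · exact gmul_mem_spanB_right K hm _ (hy q (by omega) hq))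
  simp only [leg_apply, hR1, place_toUniv] at h1
  change _ - (mulL K ((placeDiag f12 rDiag).toUniv K) (place K f02 (R k)) + _ + _ + _ + _ + _) ∈ _
    at h1
  obtain ⟨s, hs, hsR⟩ := exists_pos_of_mem_diagSpan (P := fun d : Diag 2 k => d.1.2 1 = [])
    (fun d : Diag 2 k => d.1.2 1 ≠ []) (R k) fun d => em _
  set S := Representation.Coinvariants.mk (relabelRep K 2 k) s with hS
  suffices hS0 : S = 0 by rwa [hS0, sub_zero] at hsR
  obtain ⟨T, hT⟩ : ∃ T, T = R k - S := ⟨_, rfl⟩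
  rw [← hT] at hsR
  have hRk : R k = S + T := by rw [hT]; abel
  set r01 := (placeDiag f01 rDiag).toUniv K with hr01
  set r02 := (placeDiag f02 rDiag).toUniv K with hr02
  set r12 := (placeDiag f12 rDiag).toUniv K with hr12
  have b01 : r01 ∈ spanB K (1 : Fin 3) := rDiag_mem_spanB f01 rfl
  have b02 : r02 ∈ spanB K (2 : Fin 3) := rDiag_mem_spanB f02 rfl
  have b12 : r12 ∈ spanB K (2 : Fin 3) := rDiag_mem_spanB f12 rfl
  have a01 : r01 ∈ diagSpan K fun d => d.1.1 2 = [] :=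
    toUniv_mem_diagSpan K (placeWords_of_notMem f01 rDiag.1.1 n01)
  have T02 : place K f02 T ∈ spanB K (2 : Fin 3) := place_mem_spanB f02 (α := 1) rfl hsR
  have T12 : place K f12 T ∈ spanB K (2 : Fin 3) := place_mem_spanB f12 (α := 1) rfl hsR
  -- the part of the equation which does not lie in the span for trivial reasons
  have h2 : mulL K r01 (place K f02 S) + mulL K r01 (place K f12 S) + mulL K r02 (place K f12 S)
      - (mulL K r12 (place K f02 S) + mulR K (place K f12 S) r01 + mulR K (place K f02 S) r01) ∈
      spanB K (2 : Fin 3) := by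
    have e : mulL K r01 (place K f02 S) + mulL K r01 (place K f12 S) + mulL K r02 (place K f12 S)
      - (mulL K r12 (place K f02 S) + mulR K (place K f12 S) r01 + mulR K (place K f02 S) r01) =
      ((mulL K r01 (place K f02 (R k)) + mulR K (place K f01 (R k)) r02
        + mulL K r01 (place K f12 (R k)) + mulR K (place K f01 (R k)) r12
        + mulL K r02 (place K f12 (R k)) + mulR K (place K f02 (R k)) r12)
      - (mulL K r12 (place K f02 (R k)) + mulR K (place K f12 (R k)) r02
        + mulL K r12 (place K f01 (R k)) + mulR K (place K f12 (R k)) r01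
        + mulL K r02 (place K f01 (R k)) + mulR K (place K f02 (R k)) r01))
      - (mulL K r01 (place K f02 T) + mulR K (place K f01 (R k)) r02
        + mulL K r01 (place K f12 T) + mulR K (place K f01 (R k)) r12
        + mulL K r02 (place K f12 T) + mulR K (place K f02 (R k)) r12)
      + (mulL K r12 (place K f02 T) + mulR K (place K f12 (R k)) r02
        + mulL K r12 (place K f01 (R k)) + mulR K (place K f12 T) r01
        + mulL K r02 (place K f01 (R k)) + mulR K (place K f02 T) r01) := by
      simp only [mulL, mulR, hRk, map_add, LinearMap.add_apply]
      abel
    rw [e]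
    refine Submodule.add_mem _ (Submodule.sub_mem _ h1 ?_) ?_
    · refine Submodule.add_mem _ (Submodule.add_mem _ (Submodule.add_mem _ (Submodule.add_mem _
        (Submodule.add_mem _ ?_ ?_) ?_) ?_) ?_) ?_
      · exact gmul_mem_spanB_right K _ _ T02
      · exact gmul_mem_spanB_right K _ _ b02
      · exact gmul_mem_spanB_right K _ _ T12
      · exact gmul_mem_spanB_right K _ _ b12
      · exact gmul_mem_spanB_right K _ _ T12
      · exact gmul_mem_spanB_right K _ _ b12
    · refine Submodule.add_mem _ (Submodule.add_mem _ (Submodule.add_mem _ (Submodule.add_mem _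
        (Submodule.add_mem _ ?_ ?_) ?_) ?_) ?_) ?_
      · exact gmul_mem_spanB_right K _ _ T02
      · exact gmul_mem_spanB_right K _ _ b02
      · exact gmul_mem_spanB_left K _ b12 (place_mem_fst_nil f01 n01 _)
      · exact gmul_mem_spanB_left K _ T12 a01
      · exact gmul_mem_spanB_left K _ b02 (place_mem_fst_nil f01 n01 _)
      · exact gmul_mem_spanB_left K _ T02 a01
  -- no letter `a` of `S` stands in the second factor
  set W : Submodule K (Univ K 3 (k + 1)) :=
    diagSpan K fun d : Diag 3 (k + 1) => d.1.2 1 ≠ [] ∨ d.1.2 2 ≠ [] with hW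
  have hW1 : spanB K (1 : Fin 3) ≤ W := diagSpan_le K fun d hd => toUniv_mem_diagSpan K (Or.inl hd)
  have hW2 : spanB K (2 : Fin 3) ≤ W := diagSpan_le K fun d hd => toUniv_mem_diagSpan K (Or.inr hd)
  -- as `S` has letters `b` only in its first factor, and has at least one of them
  have S12 : place K f12 S ∈ spanB K (1 : Fin 3) := by
    refine place_mem_spanB f12 (α := 0) rfl (mk_mem_diagSpan K s fun d hd h0 => ?_)
    obtain ⟨α, hα⟩ := mem_of_cnt (d.2.2 ⟨0, by omega⟩)
    obtain rfl | rfl : α = 0 ∨ α = 1 := by omega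
    · rw [h0] at hα; simp at hα
    · rw [hs d hd] at hα; simp at hα
  have h3 : mulL K r12 (place K f02 S) ∈ W := by
    have e : mulL K r12 (place K f02 S) = mulL K r01 (place K f02 S) + mulL K r01 (place K f12 S)
        + mulL K r02 (place K f12 S) - mulR K (place K f12 S) r01 - mulR K (place K f02 S) r01
        - (mulL K r01 (place K f02 S) + mulL K r01 (place K f12 S) + mulL K r02 (place K f12 S)
        - (mulL K r12 (place K f02 S) + mulR K (place K f12 S) r01
          + mulR K (place K f02 S) r01)) := by abel
    rw [e]
    refine Submodule.sub_mem _ (hW1 ?_) (hW2 h2)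
    refine Submodule.sub_mem _ (Submodule.sub_mem _ (Submodule.add_mem _ (Submodule.add_mem _
      ?_ ?_) ?_) ?_) ?_
    · exact gmul_mem_spanB_left K _ b01 (place_mem_fst_nil f02 n02 _)
    · exact gmul_mem_spanB_right K _ _ S12
    · exact gmul_mem_spanB_right K _ _ S12
    · exact gmul_mem_spanB_right K _ _ b01
    · exact gmul_mem_spanB_right K _ _ b01
  have h4 := fst_one_eq_nil_of_mem K (f := f02) (fr := f12) (β := 1) n02 rfl rfl s hs h3
  have h5 := mk_filter_eq K s (fun p => p.1 1 = []) (fun f p => rename_eq_nil f _ _) h4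
  set s' := s.filter fun d => d.1.1 1 = [] with hs'
  have hs1 : ∀ d ∈ s'.support, d.1.1 1 = [] ∧ d.1.2 1 = [] := fun d hd => by
    rw [Finsupp.support_filter, Finset.mem_filter] at hd
    exact ⟨hd.2, hs d hd.1⟩
  rw [← hS] at h5
  rw [← h5]
  rw [← h5] at h2
  have hS0 : ∀ (f : Fin 2 ↪ Fin 3), f 1 = 2 →
      place K f (Representation.Coinvariants.mk (relabelRep K 2 k) s') ∈
        diagSpan K fun d => d.1.1 2 = [] := fun f hf =>
    place_mk_mem_fst_nil f hf s' fun d hd => (hs1 d hd).1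
  refine mk_eq_zero_of_commutator (a := 0) (b := 1) (g := (2 : Fin 3)) hk (by decide)
    (by decide) (by decide) f02 f12 f01 0 rfl rfl rfl rfl s' (fun d hd π' hπ => ?_)
    (diagSpan_le K (fun d hd => toUniv_mem_diagSpan K (Or.inr hd)) (?_ : _ ∈ spanB K (2 : Fin 3)))
  · obtain rfl : π' = 1 := by omega
    exact hs1 d hd
  · set S' := Representation.Coinvariants.mk (relabelRep K 2 k) s'
    have e : mulL K r01 (place K f02 S') - mulR K (place K f02 S') r01
        + (mulL K r01 (place K f12 S') - mulR K (place K f12 S') r01) =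
        mulL K r01 (place K f02 S') + mulL K r01 (place K f12 S') + mulL K r02 (place K f12 S')
        - (mulL K r12 (place K f02 S') + mulR K (place K f12 S') r01
          + mulR K (place K f02 S') r01)
        - mulL K r02 (place K f12 S') + mulL K r12 (place K f02 S') := by abel
    refine (congrArg (· ∈ spanB K (2 : Fin 3)) e).mpr ?_
    refine Submodule.add_mem _ (Submodule.sub_mem _ h2 ?_) ?_
    · exact gmul_mem_spanB_left K _ b02 (hS0 f12 rfl)
    · exact gmul_mem_spanB_left K _ b12 (hS0 f02 rfl)

/-- The induction step for the first tensor factor. -/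
theorem mem_spanA_of_forall_lt (hR : IsQYBESolution R) (hR0 : R 0 = (emptyDiag 2).toUniv K)
    (hR1 : R 1 = rDiag.toUniv K) (hk : 2 ≤ k)
    (ih : ∀ p, 1 ≤ p → p < k → R p ∈ spanA K (0 : Fin 2)) : R k ∈ spanA K (0 : Fin 2) := by
  set f01 : Fin 2 ↪ Fin 3 := legEmb 0 1 (by decide) with hf01
  set f02 : Fin 2 ↪ Fin 3 := legEmb 0 2 (by decide) with hf02
  set f12 : Fin 2 ↪ Fin 3 := legEmb 1 2 (by decide) with hf12
  have n02 : ∀ α, f02 α ≠ 1 := legEmb_ne _ (by decide) (by decide)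
  have n12 : ∀ α, f12 α ≠ 0 := legEmb_ne _ (by decide) (by decide)
  have hx : ∀ p, 1 ≤ p → p < k → place K f01 (R p) ∈ spanA K (0 : Fin 3) := fun p h h' =>
    place_mem_spanA f01 (α := 0) rfl (ih p h h')
  have hy : ∀ p, 1 ≤ p → p < k → place K f02 (R p) ∈ spanA K (0 : Fin 3) := fun p h h' =>
    place_mem_spanA f02 (α := 0) rfl (ih p h h')
  have he : ∀ (f : Fin 2 ↪ Fin 3), place K f (R 0) = (emptyDiag 3).toUniv K := fun f => by
    rw [hR0, place_emptyDiag]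
  have he' : ∀ (f : Fin 2 ↪ Fin 3), place K f (R 0) ∈ diagSpan K fun d => d.1.2 0 = [] :=
    fun f => by
      rw [he]
      exact toUniv_mem_diagSpan K rfl
  have h1 := commutator_mem_of_mul_mul_eq (k := k) hk _ _ _ hR
    (by rw [leg_apply, hR0, place_emptyDiag]) (by rw [leg_apply, hR0, place_emptyDiag])
    (by rw [leg_apply, hR0, place_emptyDiag]) (spanA K (0 : Fin 3))
    (fun p q r m hm h hp hq hr => by
      refine gmul_mem_spanA_left K h _ ?_
      by_cases hp0 : p = 0
      · subst hp0
        exact gmul_mem_spanA_right K hm (he' f01) (hy q (by omega) hq)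
      · exact gmul_mem_spanA_left K hm _ (hx p (by omega) hp))
    (fun p q r m hm h hp hq hr => by
      by_cases hq0 : q = 0
      · subst hq0
        rw [leg_apply, leg_apply, he f02, gmul_gmul_one_mid K hm h (by omega)]
        exact gmul_mem_spanA_right K _ (place_mem_snd_nil f12 n12 _) (hx r (by omega) hr)
      · exact gmul_mem_spanA_left K h _
          (gmul_mem_spanA_right K hm (place_mem_snd_nil f12 n12 _) (hy q (by omega) hq)))
  simp only [leg_apply, hR1, place_toUniv] at h1
  obtain ⟨s, hs, hsR⟩ := exists_pos_of_mem_diagSpan (P := fun d : Diag 2 k => d.1.1 0 = [])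
    (fun d : Diag 2 k => d.1.1 0 ≠ []) (R k) fun d => em _
  set S := Representation.Coinvariants.mk (relabelRep K 2 k) s with hS
  suffices hS0 : S = 0 by rwa [hS0, sub_zero] at hsR
  obtain ⟨T, hT⟩ : ∃ T, T = R k - S := ⟨_, rfl⟩
  rw [← hT] at hsR
  have hRk : R k = S + T := by rw [hT]; abel
  set r01 := (placeDiag f01 rDiag).toUniv K with hr01
  set r02 := (placeDiag f02 rDiag).toUniv K with hr02
  set r12 := (placeDiag f12 rDiag).toUniv K with hr12
  have a01 : r01 ∈ spanA K (0 : Fin 3) := rDiag_mem_spanA f01 rfl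
  have a02 : r02 ∈ spanA K (0 : Fin 3) := rDiag_mem_spanA f02 rfl
  have a12 : r12 ∈ spanA K (1 : Fin 3) := rDiag_mem_spanA f12 rfl
  have b12 : r12 ∈ diagSpan K fun d => d.1.2 0 = [] :=
    toUniv_mem_diagSpan K (placeWords_of_notMem f12 rDiag.1.2 n12)
  have T01 : place K f01 T ∈ spanA K (0 : Fin 3) := place_mem_spanA f01 (α := 0) rfl hsR
  have T02 : place K f02 T ∈ spanA K (0 : Fin 3) := place_mem_spanA f02 (α := 0) rfl hsR
  -- the part of the equation which does not lie in the span for trivial reasons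
  have h2 : mulR K (place K f01 S) r02 + mulR K (place K f01 S) r12 + mulR K (place K f02 S) r12
      - (mulL K r12 (place K f02 S) + mulL K r12 (place K f01 S) + mulR K (place K f02 S) r01) ∈
      spanA K (0 : Fin 3) := by
    have e : mulR K (place K f01 S) r02 + mulR K (place K f01 S) r12 + mulR K (place K f02 S) r12
      - (mulL K r12 (place K f02 S) + mulL K r12 (place K f01 S) + mulR K (place K f02 S) r01) =
      ((mulL K r01 (place K f02 (R k)) + mulR K (place K f01 (R k)) r02
        + mulL K r01 (place K f12 (R k)) + mulR K (place K f01 (R k)) r12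
        + mulL K r02 (place K f12 (R k)) + mulR K (place K f02 (R k)) r12)
      - (mulL K r12 (place K f02 (R k)) + mulR K (place K f12 (R k)) r02
        + mulL K r12 (place K f01 (R k)) + mulR K (place K f12 (R k)) r01
        + mulL K r02 (place K f01 (R k)) + mulR K (place K f02 (R k)) r01))
      - (mulL K r01 (place K f02 (R k)) + mulR K (place K f01 T) r02
        + mulL K r01 (place K f12 (R k)) + mulR K (place K f01 T) r12
        + mulL K r02 (place K f12 (R k)) + mulR K (place K f02 T) r12)
      + (mulL K r12 (place K f02 T) + mulR K (place K f12 (R k)) r02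
        + mulL K r12 (place K f01 T) + mulR K (place K f12 (R k)) r01
        + mulL K r02 (place K f01 (R k)) + mulR K (place K f02 T) r01) := by
      simp only [mulL, mulR, hRk, map_add, LinearMap.add_apply]
      abel
    rw [e]
    refine Submodule.add_mem _ (Submodule.sub_mem _ h1 ?_) ?_
    · refine Submodule.add_mem _ (Submodule.add_mem _ (Submodule.add_mem _ (Submodule.add_mem _
        (Submodule.add_mem _ ?_ ?_) ?_) ?_) ?_) ?_
      · exact gmul_mem_spanA_left K _ _ a01
      · exact gmul_mem_spanA_left K _ _ T01
      · exact gmul_mem_spanA_left K _ _ a01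
      · exact gmul_mem_spanA_left K _ _ T01
      · exact gmul_mem_spanA_left K _ _ a02
      · exact gmul_mem_spanA_left K _ _ T02
    · refine Submodule.add_mem _ (Submodule.add_mem _ (Submodule.add_mem _ (Submodule.add_mem _
        (Submodule.add_mem _ ?_ ?_) ?_) ?_) ?_) ?_
      · exact gmul_mem_spanA_right K _ b12 T02
      · exact gmul_mem_spanA_right K _ (place_mem_snd_nil f12 n12 _) a02
      · exact gmul_mem_spanA_right K _ b12 T01
      · exact gmul_mem_spanA_right K _ (place_mem_snd_nil f12 n12 _) a01
      · exact gmul_mem_spanA_left K _ _ a02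
      · exact gmul_mem_spanA_left K _ _ T02
  -- no letter `b` of `S` stands in the first factor
  set W : Submodule K (Univ K 3 (k + 1)) :=
    diagSpan K fun d : Diag 3 (k + 1) => d.1.1 0 ≠ [] ∨ d.1.1 1 ≠ [] with hW
  have hW0 : spanA K (0 : Fin 3) ≤ W := diagSpan_le K fun d hd => toUniv_mem_diagSpan K (Or.inl hd)
  have hW1 : spanA K (1 : Fin 3) ≤ W := diagSpan_le K fun d hd => toUniv_mem_diagSpan K (Or.inr hd)
  -- as `S` has letters `a` only in its second factor, and has at least one of them
  have S01 : place K f01 S ∈ spanA K (1 : Fin 3) := by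
    refine place_mem_spanA f01 (α := 1) rfl (mk_mem_diagSpan K s fun d hd h0 => ?_)
    obtain ⟨α, hα⟩ := mem_of_cnt (d.2.1 ⟨0, by omega⟩)
    obtain rfl | rfl : α = 0 ∨ α = 1 := by omega
    · rw [hs d hd] at hα; simp at hα
    · rw [h0] at hα; simp at hα
  have h3 : mulR K (place K f02 S) r01 ∈ W := by
    have e : mulR K (place K f02 S) r01 = mulR K (place K f01 S) r02 + mulR K (place K f01 S) r12
        + mulR K (place K f02 S) r12 - mulL K r12 (place K f02 S) - mulL K r12 (place K f01 S)
        - (mulR K (place K f01 S) r02 + mulR K (place K f01 S) r12 + mulR K (place K f02 S) r12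
        - (mulL K r12 (place K f02 S) + mulL K r12 (place K f01 S)
          + mulR K (place K f02 S) r01)) := by abel
    rw [e]
    refine Submodule.sub_mem _ (hW1 ?_) (hW0 h2)
    refine Submodule.sub_mem _ (Submodule.sub_mem _ (Submodule.add_mem _ (Submodule.add_mem _
      ?_ ?_) ?_) ?_) ?_
    · exact gmul_mem_spanA_left K _ _ S01
    · exact gmul_mem_spanA_left K _ _ S01
    · exact gmul_mem_spanA_right K _ (place_mem_snd_nil f02 n02 _) a12
    · exact gmul_mem_spanA_left K _ _ a12
    · exact gmul_mem_spanA_left K _ _ a12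
  have h4 := snd_zero_eq_nil_of_mem K (f := f02) (fr := f01) (β := 1) n02 rfl rfl s hs h3
  have h5 := mk_filter_eq K s (fun p => p.2 0 = []) (fun f p => rename_eq_nil f _ _) h4
  set s' := s.filter fun d => d.1.2 0 = [] with hs'
  have hs1 : ∀ d ∈ s'.support, d.1.1 0 = [] ∧ d.1.2 0 = [] := fun d hd => by
    rw [Finsupp.support_filter, Finset.mem_filter] at hd
    exact ⟨hs d hd.1, hd.2⟩
  rw [← hS] at h5
  rw [← h5]
  rw [← h5] at h2
  have hS0 : ∀ (f : Fin 2 ↪ Fin 3), f 0 = 0 →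
      place K f (Representation.Coinvariants.mk (relabelRep K 2 k) s') ∈
        diagSpan K fun d => d.1.2 0 = [] := fun f hf =>
    place_mk_mem_snd_nil f hf s' fun d hd => (hs1 d hd).2
  refine mk_eq_zero_of_commutator (a := 1) (b := 2) (g := (0 : Fin 3)) hk (by decide)
    (by decide) (by decide) f01 f02 f12 1 rfl rfl rfl rfl s' (fun d hd π' hπ => ?_)
    (diagSpan_le K (fun d hd => toUniv_mem_diagSpan K (Or.inl hd)) (?_ : _ ∈ spanA K (0 : Fin 3)))
  · obtain rfl : π' = 0 := by omega
    exact hs1 d hd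
  · set S' := Representation.Coinvariants.mk (relabelRep K 2 k) s'
    have e : mulL K r12 (place K f01 S') - mulR K (place K f01 S') r12
        + (mulL K r12 (place K f02 S') - mulR K (place K f02 S') r12) =
        mulR K (place K f01 S') r02 - mulR K (place K f02 S') r01
        - (mulR K (place K f01 S') r02 + mulR K (place K f01 S') r12 + mulR K (place K f02 S') r12
        - (mulL K r12 (place K f02 S') + mulL K r12 (place K f01 S')
          + mulR K (place K f02 S') r01)) := by abel
    refine (congrArg (· ∈ spanA K (0 : Fin 3)) e).mpr ?_
    refine Submodule.sub_mem _ (Submodule.sub_mem _ ?_ ?_) h2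
    · exact gmul_mem_spanA_right K _ (hS0 f01 rfl) a02
    · exact gmul_mem_spanA_right K _ (hS0 f02 rfl) a01

/-- All components of positive degree lie in both spans. -/
theorem mem_spanB_and_mem_spanA (hR : IsQYBESolution R) (hR0 : R 0 = (emptyDiag 2).toUniv K)
    (hR1 : R 1 = rDiag.toUniv K) (N : ℕ) (hN : 1 ≤ N) :
    R N ∈ spanB K (1 : Fin 2) ∧ R N ∈ spanA K (0 : Fin 2) := by
  induction N using Nat.strong_induction_on with
  | _ N ih =>
    rcases Nat.lt_or_ge N 2 with h | h
    · obtain rfl : N = 1 := by omega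
      rw [hR1]
      exact ⟨toUniv_mem_diagSpan K (List.cons_ne_nil 0 []),
        toUniv_mem_diagSpan K (List.cons_ne_nil 0 [])⟩
    · exact ⟨mem_spanB_of_forall_lt hR hR0 hR1 h fun p hp hpN => (ih p hpN hp).1,
        mem_spanA_of_forall_lt hR hR0 hR1 h fun p hp hpN => (ih p hpN hp).2⟩

end QYBE

end UnivAlg

theorem mainTheorem3 (K : Type*) [Field K] [CharZero K] (R : UnivAlg.UnivHat K 2)
    (hR : UnivAlg.IsQYBESolution R)
    (hR0 : UnivAlg.homComp K 0 R = 1) (hR1 : UnivAlg.homComp K 1 R = UnivAlg.rMatrix K) :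
    ∀ N : ℕ, 1 ≤ N →
      UnivAlg.homComp K N R ∈ UnivAlg.UgUaUb0 K ∧ UnivAlg.homComp K N R ∈ UnivAlg.Ua0UbUg K := by
  intro N hN
  have h0 : R 0 = (UnivAlg.emptyDiag 2).toUniv K := by
    refine (UnivAlg.homComp_apply_self 0 R).symm.trans ((congrFun hR0 0).trans ?_)
    exact Pi.single_eq_same (M := fun N => UnivAlg.Univ K 2 N) 0 _
  have h1 : R 1 = UnivAlg.rDiag.toUniv K := by
    refine (UnivAlg.homComp_apply_self 1 R).symm.trans ((congrFun hR1 1).trans ?_)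
    exact Pi.single_eq_same (M := fun N => UnivAlg.Univ K 2 N) 1 _
  have h2 := UnivAlg.mem_spanB_and_mem_spanA hR h0 h1 N hN
  constructor <;> intro M _ <;> by_cases hM : M = N
  · subst hM
    rw [UnivAlg.homComp_apply_self]
    exact h2.1
  · rw [UnivAlg.homComp_apply_of_ne hM]
    exact Submodule.zero_mem _
  · subst hM
    rw [UnivAlg.homComp_apply_self]
    exact h2.2
  · rw [UnivAlg.homComp_apply_of_ne hM]
    exact Submodule.zero_mem _
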